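/- **Notation.** Let $E$ be a Euclidean space. For probability measures $F,G$ on $E$ let $W_1(F,G)=\inf_\pi\int (|x-y|\wedge 1)\,\pi(dx,dy)$, and for probability measures $F,G$ on $E^j$ let $W_1(F,G)=\inf_\pi\int \frac1j\sum_{i=1}^j(|x_i-y_i|\wedge 1)\,\pi(dX,dY)$, the infimum being over all couplings $\pi$ of $F$ and $G$. For $V\in E^N$, $N\ge1$, let $\mu^N_V=\frac1N\sum_{i=1}^N\delta_{V_i}$. For a probability measure $G^N$ on $E^N$, let $\mathcal Z^N\sim G^N$, let $\hat G^N$ be the law of $\mu^N_{\mathcal Z^N}$ on $\mathbf P(E)$, and let $\mathcal W_{W_1}$ be the Monge–Kantorovich–Wasserstein distance on $\mathbf P(\mathbf P(E))$ with cost $W_1$. Put $\Omega_\infty(G^N;f)=\mathcal W_{W_1}(\hat G^N,\delta_f)$ and $M_k(f)=\int|v|^kf(dv)$. Let $\mathcal{KS}^N=\{V\in\mathbb R^N:\ \sum_i|v_i|^2=N\}$ and $\mathcal{BS}^N=\{V\in(\mathbb R^3)^N:\ \sum_iv_i=0,\ \sum_i|v_i|^2=N\}$, each with its uniform probability measure $\sigma^N$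 (defined for $N\ge 1$, resp. $N\ge 2$). Let $\gamma^N$ be the uniform probability measure on $\mathcal{KS}^N$ and $\gamma$ the standard Gaussian law on $\mathbb R$. For a probability measure $f$ with density $\rho$, put $Z_N=\int\prod_i\rho(v_i)\,\sigma^N(dV)$; if $0<Z_N<\infty$, the measure $f^{\otimes N}$ conditioned to the sphere is $[f^{\otimes N}]=Z_N^{-1}\prod_i\rho(v_i)\,\sigma^N(dV)$. **Theorem.** In each of the cases below, $$\Omega_\infty(G^N;f)=\mathbb E\big[W_1(\mu^N_{\mathcal Z^N},f)\big]\le \frac{C}{N^{\alpha}}\qquad(\ast)$$ for every $N\ge1$ for which $G^N$ is defined. (i) Let $d\ge1$, $k>0$, $M\ge 0$ and $\alpha<\alpha_c:=\dfrac{1}{\max(d,2)+d/k}$. There is $C$, depending only on $d,k,M,\alpha$, such that $(\ast)$ holds with $G^N=f^{\otimes N}$ for every probability measure $f$ on $\mathbb R^d$ with $M_k(f)\le M$. (ii) For every $\alpha<1/2$ there is $C$ such that $(\ast)$ holds with $G^N=\gamma^N$ and $f=\gamma$. Moreover there is $C$ such that $W_1(\gamma^N,\gamma^{\otimes N})\le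 C/N^{1/2}$ for all $N\ge1$. (iii) Let $k\ge4$ and let $f$ be a probability measure on $\mathbb R$ with a density in $L^p(\mathbb R)$ for some $p>1$, with $M_k(f)<\infty$ and $\int v^2f(dv)=1$. Then on Kac's spheres $0<Z_N<\infty$ for all large $N$, and for every $\alpha<\dfrac1{2+2/k}$ there is $C$ such that $(\ast)$ holds with $G^N=[f^{\otimes N}]$ conditioned to $\mathcal{KS}^N$, for every $N\geq 1$ with $0<Z_N<\infty$. Likewise, let $k\ge4$ and let $f$ be a probability measure on $\mathbb R^3$ with a density in $L^p(\mathbb R^3)$ for some $p>1$, with $M_k(f)<\infty$, $\int v\,f(dv)=0$ and $\int|v|^2f(dv)=1$. Then on Boltzmann's spheres $0<Z_N<\infty$ for all large $N$, and for every $\alpha<\dfrac1{3+3/k}$ there is $C$ such that $(\ast)$ holds with $G^N=[f^{\otimes N}]$ conditioned to $\mathcal{BS}^N$, for every $N\ge1$ with $0<Z_N<\infty$. -/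

import Mathlib

open MeasureTheory ProbabilityTheory Filter
open scoped ENNReal NNReal

namespace KacChaos

noncomputable section

/-- The Monge-Kantorovich-Wasserstein cost between two measures on `X` for the cost function `c`:
the infimum of `∫ c dπ` over all measures `π` on `X × X` with marginals `F` and `G`. -/
def mkw {X : Type*} [MeasurableSpace X] (c : X → X → ℝ≥0∞) (F G : Measure X) : ℝ≥0∞ :=
  ⨅ (π : Measure (X × X)) (_ : π.fst = F ∧ π.snd = G), ∫⁻ p, c p.1 p.2 ∂π

/-- `W₁` on measures on `E`, for the bounded distance `|x - y| ∧ 1`. -/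
def W1 {E : Type*} [MeasurableSpace E] [PseudoEMetricSpace E] (F G : Measure E) : ℝ≥0∞ :=
  mkw (fun x y => min (edist x y) 1) F G

/-- The renormalized `W₁` on measures on `E^j`,
for the distance `(1/j) ∑ i, (|x i - y i| ∧ 1)`. -/
def W1prod {E : Type*} [MeasurableSpace E] [PseudoEMetricSpace E] {j : ℕ}
    (F G : Measure (Fin j → E)) : ℝ≥0∞ :=
  mkw (fun X Y => (j : ℝ≥0∞)⁻¹ * ∑ i, min (edist (X i) (Y i)) 1) F G

/-- The empirical measure `μ^N_V = (1/N) ∑ i, δ_{V i}`. -/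
def empirical {E : Type*} [MeasurableSpace E] {N : ℕ} [NeZero N] (V : Fin N → E) :
    ProbabilityMeasure E :=
  ⟨(N : ℝ≥0∞)⁻¹ • ∑ i, Measure.dirac (V i), ⟨by
    simp [ENNReal.inv_mul_cancel, NeZero.ne N]⟩⟩

/-- `E[W₁(μ^N_Z, f)]` for a random vector `Z` of law `G` on `E^N`. -/
def meanW1 {E : Type*} [MeasurableSpace E] [PseudoEMetricSpace E] {N : ℕ} [NeZero N]
    (G : Measure (Fin N → E)) (f : ProbabilityMeasure E) : ℝ≥0∞ :=
  ∫⁻ V, W1 (empirical V : Measure E) (f : Measure E) ∂G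

/-- `Ω_∞(G; f)`: the MKW distance, for the cost `W₁` on `P(E)`, between the law on `P(E)` of the
empirical measure under `G` and the Dirac mass at `f`. -/
def OmegaInf {E : Type*} [MeasurableSpace E] [PseudoEMetricSpace E] {N : ℕ} [NeZero N]
    (G : Measure (Fin N → E)) (f : ProbabilityMeasure E) : ℝ≥0∞ :=
  mkw (fun ρ η : ProbabilityMeasure E => W1 (ρ : Measure E) (η : Measure E))
    (G.map empirical) (Measure.dirac f)

/-- The tensor power `f^{⊗N}`. -/
def tensorPower {E : Type*} [MeasurableSpace E] (f : ProbabilityMeasure E) (N : ℕ) :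
    Measure (Fin N → E) :=
  Measure.pi fun _ => (f : Measure E)

/-- The moment `M_k(f) = ∫ |v|^k f(dv)`. -/
def moment {E : Type*} [MeasurableSpace E] [NormedAddCommGroup E] (k : ℝ)
    (f : ProbabilityMeasure E) : ℝ≥0∞ :=
  ∫⁻ v, ‖v‖ₑ ^ k ∂(f : Measure E)

/-- The uniform probability measure on the sphere of radius `r` about the origin of a nontrivial
Euclidean space `H` (the normalized surface measure of the unit sphere, dilated by `r`). -/
def sphereUniform (H : Type*) [NormedAddCommGroup H] [InnerProductSpace ℝ H]
    [FiniteDimensional ℝ H] [MeasurableSpace H] [BorelSpace H] (r : ℝ) : Measure H :=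
  ((volume : Measure H).toSphere Set.univ)⁻¹ •
    (volume : Measure H).toSphere.map (fun u : Metric.sphere (0 : H) 1 => r • (u : H))

/-- The uniform probability measure on Kac's sphere `{V ∈ ℝ^N ; ∑ i, |V i|² = N}`, `N ≥ 1`. -/
def kacUniform (N : ℕ) : Measure (Fin N → ℝ) :=
  (sphereUniform (EuclideanSpace ℝ (Fin N)) √N).map WithLp.ofLp

/-- The subspace `{V ∈ (ℝ³)^N ; ∑ i, V i = 0}` with its Euclidean structure. -/
def zeroMomentum (N : ℕ) : Submodule ℝ (PiLp 2 fun _ : Fin N => EuclideanSpace ℝ (Fin 3)) where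
  carrier := {V | ∑ i, V i = 0}
  zero_mem' := by simp
  add_mem' := by
    intro V W hV hW
    simp only [Set.mem_ofPred_eq] at hV hW ⊢
    simp [Finset.sum_add_distrib, hV, hW]
  smul_mem' := by
    intro c V hV
    simp only [Set.mem_ofPred_eq] at hV ⊢
    simp [← Finset.smul_sum, hV]

/-- The uniform probability measure on Boltzmann's sphere
`{V ∈ (ℝ³)^N ; ∑ i, V i = 0, ∑ i, |V i|² = N}`, `N ≥ 2`. -/
def boltzmannUniform (N : ℕ) : Measure (Fin N → EuclideanSpace ℝ (Fin 3)) :=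
  (sphereUniform (zeroMomentum N) √N).map fun V : zeroMomentum N =>
    WithLp.ofLp (V : PiLp 2 fun _ : Fin N => EuclideanSpace ℝ (Fin 3))

/-- The normalizing constant `Z_N = ∫ ∏ i, ρ (V i) σ(dV)` of the product density `ρ^{⊗N}`
on a sphere with uniform measure `σ`. -/
def condMass {E : Type*} [MeasurableSpace E] {N : ℕ} (σ : Measure (Fin N → E)) (ρ : E → ℝ≥0∞) :
    ℝ≥0∞ :=
  ∫⁻ V, ∏ i, ρ (V i) ∂σ

/-- The product density `ρ^{⊗N}` conditioned to a sphere with uniform measure `σ`, i.e. the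
probability measure `Z_N⁻¹ ρ^{⊗N} σ`; it makes sense when `0 < Z_N < ∞`. -/
def conditioned {E : Type*} [MeasurableSpace E] {N : ℕ} (σ : Measure (Fin N → E))
    (ρ : E → ℝ≥0∞) : Measure (Fin N → E) :=
  (condMass σ ρ)⁻¹ • σ.withDensity fun V => ∏ i, ρ (V i)

/-- The standard Gaussian law on `ℝ`. -/
def stdGaussian : ProbabilityMeasure ℝ := ⟨gaussianReal 0 1, inferInstance⟩

end

end KacChaos

/-! The identity between `OmegaInf` and `meanW1` holds because a coupling with a Dirac mass is a
product. The work there is measurability: `W₁(·, f)` is replaced by a measurable minorant that is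
exact on empirical measures (`exists_measurable_le_W1`).

Independent samples. Take nested dyadic partitions. Match as much mass as possible inside the finest
cells, then the leftover inside coarser and coarser ones. This bounds `W₁` by a sum over generations
of the scale times the total excess of one measure over the other in the cells
(`mkw_le_multiscale`). In a cell of mass `p` the mean excess of the empirical measure is at most
`√(p/N)`. Cauchy-Schwarz over the cells reached from a ball of radius `R`, and Markov's inequality
outside, give `sum_cells_le`. Taking `R` and the finest scale to be powers of `N` gives every
exponent below the critical one (`exists_scales`).

Conditioned products. To a velocity `v` attach the statistic `(π v, ‖v‖² - 1)`, with `π` null for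
Kac and the identity for Boltzmann; the sphere is the set where the statistics sum to zero. Split
the `N` velocities into a block of `m` and a complement of `n`, and let `h_n` be the density of the
sum of `n` statistics. Under the conditioned measure the block has density `h_n(-S_m) / h_N(0)` with
respect to `f^{⊗m}`, where `S_m` is the sum over the block. A local limit theorem gives `h_n ≤ C
n^{-D/2}` and `h_N(0) ≥ c N^{-D/2}`, so this density is bounded as soon as `m` and `n` are both
comparable to `N` (`exists_lintegral_conditioned_block_le`). The empirical measure is a mixture of
those of its two halves, so the rate for independent samples carries over up to a constant
(`conditioned_rate`).

The local limit theorem (`exists_local_limit`) needs some power of the characteristic function of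
the statistic to be integrable. For densities in `L^p`, `p > 1`, this comes from truncating the
density: the sum of two statistics has a density of at most linear growth, which controls the fourth
power for truncated densities, and dyadic level sets handle the rest
(`exists_integrable_norm_charFun_pow`).

Gaussian case. The Gaussian product density is constant on Kac's sphere, so the uniform measure is a
conditioned product with all moments finite, and `k` can be sent to infinity. The `N^{-1/2}` bound
on `E^N` comes from coupling a Gaussian vector with its radial projection. -/

namespace KacChaos

/-! ### Transport costs: matching inside cells and the multiscale bound -/

section Transport

variable {X : Type*} [MeasurableSpace X]

theorem mkw_le (c : X → X → ℝ≥0∞) {F G : Measure X} (π : Measure (X × X)) (h1 : π.fst = F)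
    (h2 : π.snd = G) : mkw c F G ≤ ∫⁻ p, c p.1 p.2 ∂π :=
  iInf₂_le π ⟨h1, h2⟩

theorem le_mkw (c : X → X → ℝ≥0∞) {F G : Measure X} {a : ℝ≥0∞}
    (h : ∀ π : Measure (X × X), π.fst = F → π.snd = G → a ≤ ∫⁻ p, c p.1 p.2 ∂π) :
    a ≤ mkw c F G :=
  le_iInf₂ fun π hπ => h π hπ.1 hπ.2

theorem fst_add' (π π' : Measure (X × X)) : (π + π').fst = π.fst + π'.fst :=
  Measure.map_add _ _ measurable_fst

theorem snd_add' (π π' : Measure (X × X)) : (π + π').snd = π.snd + π'.snd :=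
  Measure.map_add _ _ measurable_snd

/-- Couplings add up, so a matched part and a leftover part can be transported separately. -/
theorem mkw_add_le (c : X → X → ℝ≥0∞) (F G F' G' : Measure X) :
    mkw c (F + F') (G + G') ≤ mkw c F G + mkw c F' G' := by
  conv_rhs => rw [mkw, mkw]
  simp only [ENNReal.iInf_add, ENNReal.add_iInf]
  refine le_iInf₂ fun π hπ => le_iInf₂ fun π' hπ' => ?_
  rw [← lintegral_add_measure]
  refine mkw_le c _ ?_ ?_
  · rw [fst_add', hπ.1, hπ'.1]
  · rw [snd_add', hπ.2, hπ'.2]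

theorem mkw_smul_le (c : X → X → ℝ≥0∞) (F G : Measure X) {t : ℝ≥0∞} (ht : t ≠ ∞) :
    mkw c (t • F) (t • G) ≤ t * mkw c F G := by
  by_cases h0 : t = 0
  · subst h0
    refine (mkw_le c 0 ?_ ?_).trans ?_ <;> simp [Measure.fst, Measure.snd]
  conv_rhs => rw [mkw, ENNReal.mul_iInf_of_ne h0 ht]
  refine le_iInf fun π => ?_
  rw [ENNReal.mul_iInf_of_ne h0 ht]
  refine le_iInf fun hπ => ?_
  rw [← smul_eq_mul, ← lintegral_smul_measure]
  refine mkw_le c _ ?_ ?_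
  · rw [Measure.fst, Measure.map_smul, ← hπ.1]; rfl
  · rw [Measure.snd, Measure.map_smul, ← hπ.2]; rfl

/-- The product coupling bounds the cost by `δ` times the mass when the cost is at most `δ`. -/
theorem mkw_le_of_le (c : X → X → ℝ≥0∞) {δ : ℝ≥0∞} (hc : ∀ x y, c x y ≤ δ) (F G : Measure X)
    [IsFiniteMeasure F] [IsFiniteMeasure G] (h : F Set.univ = G Set.univ) :
    mkw c F G ≤ δ * F Set.univ := by
  by_cases h0 : F Set.univ = 0
  · have hF : F = 0 := Measure.measure_univ_eq_zero.1 h0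
    have hG : G = 0 := Measure.measure_univ_eq_zero.1 (h ▸ h0)
    subst hF; subst hG
    refine (mkw_le c 0 ?_ ?_).trans ?_ <;> simp [Measure.fst, Measure.snd]
  have hf : F Set.univ ≠ ∞ := measure_ne_top _ _
  refine (mkw_le c ((F Set.univ)⁻¹ • F.prod G) ?_ ?_).trans ?_
  · rw [Measure.fst, Measure.map_smul, Measure.map_fst_prod, smul_smul, ← h,
      ENNReal.inv_mul_cancel h0 hf, one_smul]
  · rw [Measure.snd, Measure.map_smul, Measure.map_snd_prod, smul_smul,
      ENNReal.inv_mul_cancel h0 hf, one_smul]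
  · calc ∫⁻ p, c p.1 p.2 ∂((F Set.univ)⁻¹ • F.prod G)
        ≤ ∫⁻ p, δ ∂((F Set.univ)⁻¹ • F.prod G) := lintegral_mono fun p => hc _ _
      _ = δ * F Set.univ := by
        rw [lintegral_const, Measure.smul_apply, ← Set.univ_prod_univ, Measure.prod_prod, ← h,
          smul_eq_mul, ← mul_assoc (F Set.univ)⁻¹, ENNReal.inv_mul_cancel h0 hf, one_mul]

variable {I : Type*} [Countable I] [MeasurableSpace I] [MeasurableSingletonClass I]

/-- Two finite measures can be matched inside the cells of a countable partition, so that
the leftover mass of the first one in each cell is its excess over the second one. -/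
theorem exists_matching {T : X → I} (hT : Measurable T) (μ ν : Measure X) [IsFiniteMeasure μ]
    [IsFiniteMeasure ν] :
    ∃ (π : Measure (X × X)) (μ' ν' : Measure X), μ = μ' + π.fst ∧ ν = ν' + π.snd ∧
      (∀ᵐ p ∂π, T p.1 = T p.2) ∧ ∀ i, μ' (T ⁻¹' {i}) = μ (T ⁻¹' {i}) - ν (T ⁻¹' {i}) := by
  have hA : ∀ i, MeasurableSet (T ⁻¹' {i}) := fun i => hT (measurableSet_singleton i)
  have hdisj : Pairwise (Function.onFun Disjoint fun i => T ⁻¹' {i}) := fun i j hij =>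
    Disjoint.preimage _ (by simpa using hij)
  have hcov : ⋃ i, T ⁻¹' {i} = Set.univ := by ext x; simp
  have hsum : ∀ η : Measure X, Measure.sum (fun i => η.restrict (T ⁻¹' {i})) = η := fun η => by
    rw [← Measure.restrict_iUnion hdisj hA, hcov, Measure.restrict_univ]
  -- Dividing the product of the two restrictions by the larger mass keeps the fraction `ν/m` of `μ`
  -- and `μ/m` of `ν`, so the smaller mass of each cell is entirely matched. When `m i = 0` both
  -- restrictions vanish and the value of `(m i)⁻¹` is irrelevant.
  set m : I → ℝ≥0∞ := fun i => max (μ (T ⁻¹' {i})) (ν (T ⁻¹' {i})) with hm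
  have hmtop : ∀ i, m i ≠ ∞ := fun i => (max_lt (measure_lt_top _ _) (measure_lt_top _ _)).ne
  have hle : ∀ i (b : ℝ≥0∞), b ≤ m i → (m i)⁻¹ * b ≤ 1 := fun i b hb => by
    by_cases h0 : m i = 0
    · have : b = 0 := by simpa [h0] using hb
      simp [this]
    · calc (m i)⁻¹ * b ≤ (m i)⁻¹ * m i := by gcongr
        _ = 1 := ENNReal.inv_mul_cancel h0 (hmtop i)
  refine ⟨Measure.sum fun i => (m i)⁻¹ • (μ.restrict (T ⁻¹' {i})).prod (ν.restrict (T ⁻¹' {i})),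
    Measure.sum fun i => (1 - (m i)⁻¹ * ν (T ⁻¹' {i})) • μ.restrict (T ⁻¹' {i}),
    Measure.sum fun i => (1 - (m i)⁻¹ * μ (T ⁻¹' {i})) • ν.restrict (T ⁻¹' {i}), ?_, ?_, ?_, ?_⟩
  · rw [Measure.fst, Measure.map_sum measurable_fst.aemeasurable, Measure.sum_add_sum]
    conv_lhs => rw [← hsum μ]
    congr 1; ext1 i
    rw [Measure.map_smul, Measure.map_fst_prod, smul_smul, Measure.restrict_apply_univ,
      ← add_smul, tsub_add_cancel_of_le (hle i _ (le_max_right _ _)), one_smul]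
  · rw [Measure.snd, Measure.map_sum measurable_snd.aemeasurable, Measure.sum_add_sum]
    conv_lhs => rw [← hsum ν]
    congr 1; ext1 i
    rw [Measure.map_smul, Measure.map_snd_prod, smul_smul, Measure.restrict_apply_univ,
      ← add_smul, tsub_add_cancel_of_le (hle i _ (le_max_left _ _)), one_smul]
  · rw [Measure.ae_sum_iff]
    intro i
    refine Measure.ae_smul_measure ?_ _
    rw [Measure.prod_restrict]
    filter_upwards [ae_restrict_mem ((hA i).prod (hA i))] with p hp
    exact (show T p.1 = i from hp.1).trans (show T p.2 = i from hp.2).symm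
  · intro i
    rw [Measure.sum_apply _ (hA i), tsum_eq_single i]
    · rw [Measure.smul_apply, Measure.restrict_apply (hA i), Set.inter_self, smul_eq_mul]
      rcases le_total (μ (T ⁻¹' {i})) (ν (T ⁻¹' {i})) with h | h
      · have : m i = ν (T ⁻¹' {i}) := max_eq_right h
        rw [this, tsub_eq_zero_of_le h]
        by_cases h0 : ν (T ⁻¹' {i}) = 0
        · have : μ (T ⁻¹' {i}) = 0 := by simpa [h0] using h
          simp [this]
        · rw [ENNReal.inv_mul_cancel h0 (measure_ne_top _ _)]; simp
      · have : m i = μ (T ⁻¹' {i}) := max_eq_left h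
        rw [this]
        by_cases h0 : μ (T ⁻¹' {i}) = 0
        · simp [h0]
        · rw [ENNReal.sub_mul (fun _ _ => measure_ne_top _ _), one_mul, mul_right_comm,
            ENNReal.inv_mul_cancel h0 (measure_ne_top _ _), one_mul]
    · intro j hj
      rw [Measure.smul_apply, Measure.restrict_apply (hA i),
        (Disjoint.preimage T (by simpa using hj.symm)).inter_eq]
      simp

/-- The mass of a measure is the sum of the masses of the cells. -/
theorem tsum_measure_cells {T : X → I} (hT : Measurable T) (μ : Measure X) :
    ∑' i, μ (T ⁻¹' {i}) = μ Set.univ := by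
  rw [← measure_iUnion (fun i j hij => Disjoint.preimage _ (by simpa using hij))
    (fun i => hT (measurableSet_singleton i))]
  congr 1; ext x; simp

/-- Multiscale bound for the transport cost. -/
theorem mkw_le_multiscale (c : X → X → ℝ≥0∞) {T : ℕ → X → I} (hT : ∀ l, Measurable (T l))
    {δ : ℕ → ℝ≥0∞} (h0 : ∀ x y, c x y ≤ δ 0) (hδ : ∀ l x y, T l x = T l y → c x y ≤ δ (l + 1))
    (hnest : ∀ l x y, T (l + 1) x = T (l + 1) y → T l x = T l y) (L : ℕ) :
    ∀ (μ ν : Measure X) [IsFiniteMeasure μ] [IsFiniteMeasure ν], μ Set.univ = ν Set.univ →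
      mkw c μ ν ≤ δ L * μ Set.univ + ∑ l ∈ Finset.range L,
        δ l * ∑' i, (μ (T l ⁻¹' {i}) - ν (T l ⁻¹' {i})) := by
  have hnest' : ∀ l k x y, T (l + k) x = T (l + k) y → T l x = T l y := by
    intro l k
    induction k with
    | zero => exact fun x y h => h
    | succ k ih => exact fun x y h => ih x y (hnest (l + k) x y h)
  induction L with
  | zero =>
    intro μ ν _ _ h
    simpa using mkw_le_of_le c h0 μ ν h
  | succ L ih =>
    intro μ ν _ _ h
    -- The finest generation is matched first, at cost `δ (L + 1)` per unit of mass; the induction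
    -- hypothesis then treats the leftovers, whose mass is the total excess at generation `L`.
    obtain ⟨π, μ', ν', h1, h2, hπ, h3⟩ := exists_matching (hT L) μ ν
    have hμ'μ : μ' ≤ μ := by rw [h1]; exact Measure.le_add_right le_rfl
    have hν'ν : ν' ≤ ν := by rw [h2]; exact Measure.le_add_right le_rfl
    have : IsFiniteMeasure μ' := isFiniteMeasure_of_le μ hμ'μ
    have : IsFiniteMeasure ν' := isFiniteMeasure_of_le ν hν'ν
    have hfstμ : π.fst ≤ μ := by rw [h1]; exact Measure.le_add_left le_rfl
    have hπu : π Set.univ ≤ μ Set.univ := by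
      rw [← Measure.fst_univ]; exact hfstμ _
    have hπfin : π Set.univ ≠ ∞ := ne_top_of_le_ne_top (measure_ne_top _ _) hπu
    have : IsFiniteMeasure π := ⟨hπfin.lt_top⟩
    -- Points matched in a cell of generation `L` share all their coarser cells, so removing the
    -- matched part leaves every coarser excess unchanged.
    have hcell : ∀ l ≤ L, ∀ i, π.fst (T l ⁻¹' {i}) = π.snd (T l ⁻¹' {i}) := by
      intro l hl i
      rw [Measure.fst_apply (hT l (measurableSet_singleton i)),
        Measure.snd_apply (hT l (measurableSet_singleton i))]
      refine measure_congr ?_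
      filter_upwards [hπ] with p hp
      obtain ⟨k, rfl⟩ := Nat.exists_eq_add_of_le hl
      have := hnest' l k _ _ hp
      refine propext ?_
      show T l p.1 = i ↔ T l p.2 = i
      rw [this]
    have hsub : ∀ l ≤ L, ∀ i, μ' (T l ⁻¹' {i}) - ν' (T l ⁻¹' {i})
        = μ (T l ⁻¹' {i}) - ν (T l ⁻¹' {i}) := by
      intro l hl i
      conv_rhs => rw [h1, h2]
      rw [Measure.add_apply, Measure.add_apply, hcell l hl i,
        ENNReal.add_sub_add_eq_sub_right (measure_ne_top _ _)]
    have hmass : μ' Set.univ = ν' Set.univ := by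
      have e1 : μ Set.univ = μ' Set.univ + π Set.univ := by
        conv_lhs => rw [h1]
        rw [Measure.add_apply, Measure.fst_univ]
      have e2 : ν Set.univ = ν' Set.univ + π Set.univ := by
        conv_lhs => rw [h2]
        rw [Measure.add_apply, Measure.snd_univ]
      rw [e1, e2] at h
      exact (ENNReal.add_left_inj hπfin).1 h
    have hμ'u : μ' Set.univ = ∑' i, (μ (T L ⁻¹' {i}) - ν (T L ⁻¹' {i})) := by
      rw [← tsum_measure_cells (hT L)]
      exact tsum_congr h3
    calc mkw c μ ν = mkw c (μ' + π.fst) (ν' + π.snd) := by rw [← h1, ← h2]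
      _ ≤ mkw c μ' ν' + mkw c π.fst π.snd := mkw_add_le _ _ _ _ _
      _ ≤ (δ L * μ' Set.univ + ∑ l ∈ Finset.range L,
            δ l * ∑' i, (μ' (T l ⁻¹' {i}) - ν' (T l ⁻¹' {i}))) + δ (L + 1) * μ Set.univ := by
          refine add_le_add (ih μ' ν' hmass) ((mkw_le c π rfl rfl).trans ?_)
          calc ∫⁻ p, c p.1 p.2 ∂π ≤ ∫⁻ _, δ (L + 1) ∂π := by
                refine lintegral_mono_ae ?_
                filter_upwards [hπ] with p hp using hδ L _ _ hp
            _ ≤ δ (L + 1) * μ Set.univ := by rw [lintegral_const]; gcongr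
      _ = _ := by
          rw [Finset.sum_range_succ, ← hμ'u, add_comm]
          congr 1
          rw [add_comm]
          congr 1
          refine Finset.sum_congr rfl fun l hl => ?_
          rw [tsum_congr (hsub l (Finset.mem_range.1 hl).le)]

end Transport

/-! ### Triangle inequality -/

section Triangle

variable {X : Type*} [MeasurableSpace X] [StandardBorelSpace X] [Nonempty X]

/-- Gluing of couplings: the transport cost satisfies the triangle inequality. -/
theorem mkw_triangle {c : X → X → ℝ≥0∞} (hc : Measurable fun p : X × X => c p.1 p.2)
    (htri : ∀ x y z, c x z ≤ c x y + c y z)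
    (F G H : Measure X) [IsFiniteMeasure G] : mkw c F H ≤ mkw c F G + mkw c G H := by
  conv_rhs => rw [mkw, mkw]
  simp only [ENNReal.iInf_add, ENNReal.add_iInf]
  refine le_iInf₂ fun π₂ h₂ => le_iInf₂ fun π₁ h₁ => ?_
  have hfin1 : IsFiniteMeasure π₁ := ⟨by
    rw [← Measure.snd_univ, h₁.2]; exact measure_lt_top _ _⟩
  have hfin2 : IsFiniteMeasure π₂ := ⟨by
    rw [← Measure.fst_univ, h₂.1]; exact measure_lt_top _ _⟩
  set ρ := π₁.map Prod.swap with hρ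
  have hfin3 : IsFiniteMeasure ρ := Measure.isFiniteMeasure_map _ _
  have hρ1 : ρ.fst = G := by rw [hρ, Measure.fst_map_swap, h₁.2]
  -- Both couplings are disintegrated over their common marginal `G`; given the middle point, the
  -- two outer points are taken independent.
  set κ₁ := ρ.condKernel
  set κ₂ := π₂.condKernel
  have e1 : G ⊗ₘ κ₁ = ρ := by rw [← hρ1]; exact Measure.disintegrate ρ ρ.condKernel
  have e2 : G ⊗ₘ κ₂ = π₂ := by rw [← h₂.1]; exact Measure.disintegrate π₂ π₂.condKernel
  set τ := G ⊗ₘ (κ₁ ×ₖ κ₂) with hτ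
  have m1 : τ.map (fun t : X × X × X => (t.1, t.2.1)) = ρ := by
    rw [← e1, hτ]
    conv_rhs => rw [← Kernel.fst_prod κ₁ κ₂, Kernel.fst_eq, Measure.compProd_map measurable_fst]
    rfl
  have m2 : τ.map (fun t : X × X × X => (t.1, t.2.2)) = π₂ := by
    rw [← e2, hτ]
    conv_rhs => rw [← Kernel.snd_prod κ₁ κ₂, Kernel.snd_eq, Measure.compProd_map measurable_snd]
    rfl
  refine (mkw_le c τ.snd ?_ ?_).trans ?_
  · have : τ.snd.fst = (τ.map (fun t : X × X × X => (t.1, t.2.1))).snd := by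
      rw [Measure.snd, Measure.snd, Measure.fst, Measure.map_map, Measure.map_map] <;> try fun_prop
      rfl
    rw [this, m1, hρ, Measure.snd_map_swap, h₁.1]
  · have : τ.snd.snd = (τ.map (fun t : X × X × X => (t.1, t.2.2))).snd := by
      rw [Measure.snd, Measure.snd, Measure.snd, Measure.map_map, Measure.map_map] <;> try fun_prop
      rfl
    rw [this, m2, h₂.2]
  · have i0 : ∫⁻ p, c p.1 p.2 ∂τ.snd = ∫⁻ t, c t.2.1 t.2.2 ∂τ := by
      rw [Measure.snd, lintegral_map hc measurable_snd]
    have i1 : ∫⁻ p, c p.1 p.2 ∂π₁ = ∫⁻ t, c t.2.1 t.1 ∂τ := by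
      have : π₁ = ρ.map Prod.swap := by
        rw [hρ, Measure.map_map measurable_swap measurable_swap]; simp
      rw [this, ← m1, Measure.map_map measurable_swap (by fun_prop),
        lintegral_map hc (by fun_prop)]
      rfl
    have i2 : ∫⁻ p, c p.1 p.2 ∂π₂ = ∫⁻ t, c t.1 t.2.2 ∂τ := by
      rw [← m2, lintegral_map hc (by fun_prop)]
    rw [i0, i1, i2, ← lintegral_add_left]
    · exact lintegral_mono fun t => htri _ _ _
    · exact hc.comp (by fun_prop : Measurable fun t : X × X × X => (t.2.1, t.1))

end Triangle

/-- Coordinates on `E` that are dominated by the norm and control the distance. -/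
structure GridChart (E : Type*) [NormedAddCommGroup E] [MeasurableSpace E] (d : ℕ) where
  q : E → Fin d → ℝ
  measurable_q : Measurable q
  K : ℝ≥0
  antilipschitz : AntilipschitzWith K q
  abs_le : ∀ x i, |q x i| ≤ ‖x‖

/-! ### Dyadic cells -/

section Cells

variable {E : Type*} [NormedAddCommGroup E] [MeasurableSpace E] {d : ℕ} (Q : GridChart E d)

/-- The dyadic cell of generation `l` containing a point. -/
noncomputable def GridChart.cell (l : ℕ) (x : E) : Fin d → ℤ := fun i => ⌊(2 : ℝ) ^ l * Q.q x i⌋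

theorem GridChart.measurable_cell (l : ℕ) : Measurable (Q.cell l) := by
  refine measurable_pi_lambda _ fun i => Int.measurable_floor.comp ?_
  exact ((measurable_pi_apply i).comp Q.measurable_q).const_mul _

theorem GridChart.cell_nested (l : ℕ) (x y : E) (h : Q.cell (l + 1) x = Q.cell (l + 1) y) :
    Q.cell l x = Q.cell l y := by
  have key : ∀ t : ℝ, ⌊(2 : ℝ) ^ l * t⌋ = ⌊(2 : ℝ) ^ (l + 1) * t⌋ / 2 := fun t => by
    have := Int.floor_div_natCast ((2 : ℝ) ^ (l + 1) * t) 2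
    rw [show (2 : ℝ) ^ l * t = (2 : ℝ) ^ (l + 1) * t / (2 : ℕ) by push_cast; ring]
    exact_mod_cast this
  funext i
  have hi := congrFun h i
  simp only [GridChart.cell] at hi ⊢
  rw [key, key, hi]

theorem GridChart.min_edist_le (l : ℕ) (x y : E) (h : Q.cell l x = Q.cell l y) :
    min (edist x y) 1 ≤ Q.K * (2⁻¹ : ℝ≥0∞) ^ l := by
  refine (min_le_left _ _).trans ((Q.antilipschitz x y).trans ?_)
  gcongr
  refine edist_pi_le_iff.2 fun i => ?_
  have hi := congrFun h i
  simp only [GridChart.cell] at hi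
  have h1 := Int.abs_sub_lt_one_of_floor_eq_floor hi
  rw [← mul_sub, abs_mul, abs_of_pos (by positivity : (0 : ℝ) < 2 ^ l)] at h1
  rw [edist_dist, Real.dist_eq]
  have h2 : |Q.q x i - Q.q y i| ≤ (2⁻¹ : ℝ) ^ l := by
    rw [inv_pow, ← one_div, le_div_iff₀' (by positivity)]; exact h1.le
  refine (ENNReal.ofReal_le_ofReal h2).trans (le_of_eq ?_)
  rw [ENNReal.ofReal_pow (by norm_num), ENNReal.ofReal_inv_of_pos (by norm_num)]
  simp

end Cells

/-! ### The bounded distance and the cells -/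

section W1

variable {E : Type*} [NormedAddCommGroup E] [MeasurableSpace E]

theorem W1_le_one (F G : Measure E) [IsProbabilityMeasure F] [IsProbabilityMeasure G] :
    W1 F G ≤ 1 := by
  have := mkw_le_of_le (fun x y : E => min (edist x y) 1) (δ := 1) (fun x y => min_le_right _ _)
    F G (by simp)
  unfold W1
  simpa using this

/-- Matching in one generation only is too crude for rates, but this bound depends on the measures
through countably many cell masses, and is therefore measurable in each of them. -/
theorem W1_le_cells {d : ℕ} (Q : GridChart E d) (l : ℕ) (F G : Measure E) [IsProbabilityMeasure F]
    [IsProbabilityMeasure G] :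
    W1 F G ≤ Q.K * (2⁻¹ : ℝ≥0∞) ^ l + ∑' i, (F (Q.cell l ⁻¹' {i}) - G (Q.cell l ⁻¹' {i})) := by
  have := mkw_le_multiscale (fun x y : E => min (edist x y) 1) (T := fun _ => Q.cell l)
    (fun _ => Q.measurable_cell l) (δ := fun k => if k = 0 then 1 else Q.K * (2⁻¹ : ℝ≥0∞) ^ l)
    (by simp) (by simpa using Q.min_edist_le l) (by simp) 1 F G (by simp)
  unfold W1
  simpa using this

theorem W1_le_multiscale {d : ℕ} (Q : GridChart E d) (L : ℕ) (F G : Measure E)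
    [IsProbabilityMeasure F] [IsProbabilityMeasure G] :
    W1 F G ≤ 2 * max 1 (Q.K : ℝ≥0∞) * ((2⁻¹ : ℝ≥0∞) ^ L + ∑ l ∈ Finset.range L,
      (2⁻¹ : ℝ≥0∞) ^ l * ∑' i, (F (Q.cell l ⁻¹' {i}) - G (Q.cell l ⁻¹' {i}))) := by
  have h2 : ∀ l, 2 * max 1 (Q.K : ℝ≥0∞) * (2⁻¹ : ℝ≥0∞) ^ (l + 1)
      = max 1 (Q.K : ℝ≥0∞) * (2⁻¹ : ℝ≥0∞) ^ l := fun l => by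
    rw [pow_succ, mul_comm 2, mul_assoc, mul_comm 2, mul_assoc,
      ENNReal.inv_mul_cancel (by norm_num) (by norm_num), mul_one]
  have := mkw_le_multiscale (fun x y : E => min (edist x y) 1) (T := fun l => Q.cell l)
    (fun l => Q.measurable_cell l)
    -- The maximum with `1` covers the cost bound at generation `0`; the factor `2` absorbs the
    -- shift between generation `l` and `δ (l + 1)`.
    (δ := fun l => 2 * max 1 (Q.K : ℝ≥0∞) * (2⁻¹ : ℝ≥0∞) ^ l)
    (fun x y => (min_le_right _ _).trans (by
      rw [pow_zero, mul_one]
      calc (1 : ℝ≥0∞) ≤ 2 * 1 := by norm_num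
        _ ≤ _ := by gcongr; exact le_max_left _ _))
    (fun l x y h => by
      rw [h2]
      exact (Q.min_edist_le l x y h).trans (by gcongr; exact le_max_right _ _))
    (fun l x y h => Q.cell_nested l x y h) L F G (by simp)
  refine this.trans (le_of_eq ?_)
  rw [measure_univ, mul_one, mul_add, Finset.mul_sum]
  congr 1
  exact Finset.sum_congr rfl fun l _ => by rw [mul_assoc]

theorem W1_triangle [BorelSpace E] [SecondCountableTopology E] [StandardBorelSpace E]
    (F G H : Measure E) [IsFiniteMeasure G] : W1 F H ≤ W1 F G + W1 G H := by
  refine mkw_triangle (X := E) ?_ ?_ F G H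
  · exact measurable_edist.min measurable_const
  · intro x y z
    rcases le_total (edist x y) 1 with h1 | h1
    · rcases le_total (edist y z) 1 with h2 | h2
      · rw [min_eq_left h1, min_eq_left h2]
        exact (min_le_left _ _).trans (edist_triangle _ _ _)
      · rw [min_eq_right h2]; exact (min_le_right _ _).trans le_add_self
    · rw [min_eq_right h1]; exact (min_le_right _ _).trans le_self_add

end W1

/-! ### The law of the empirical measure against a Dirac mass -/

section Omega

variable {E : Type*} [MeasurableSpace E]

theorem empirical_apply {N : ℕ} [NeZero N] (V : Fin N → E) {A : Set E} (hA : MeasurableSet A) :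
    (empirical V : Measure E) A = (N : ℝ≥0∞)⁻¹ * ∑ i, A.indicator 1 (V i) := by
  show ((N : ℝ≥0∞)⁻¹ • ∑ i, Measure.dirac (V i)) A = _
  simp [Measure.dirac_apply' _ hA]

theorem measurable_empirical (N : ℕ) [NeZero N] :
    Measurable (empirical : (Fin N → E) → ProbabilityMeasure E) := by
  refine Measurable.subtype_mk (Measure.measurable_of_measurable_coe _ fun A hA => ?_)
  have : (fun V : Fin N → E => ((N : ℝ≥0∞)⁻¹ • ∑ i, Measure.dirac (V i)) A)
      = fun V => (N : ℝ≥0∞)⁻¹ * ∑ i, A.indicator 1 (V i) := by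
    funext V; exact empirical_apply V hA
  rw [this]
  refine Measurable.const_mul (Finset.measurable_sum _ fun i _ => ?_) _
  exact (measurable_one.indicator hA).comp (measurable_pi_apply i)

theorem measurable_probabilityMeasure_apply {A : Set E} (hA : MeasurableSet A) :
    Measurable fun ρ : ProbabilityMeasure E => (ρ : Measure E) A :=
  (Measure.measurable_coe hA).comp measurable_subtype_coe

theorem tendsto_const_mul_inv_two_pow (c : ℝ≥0) :
    Tendsto (fun l : ℕ => (c : ℝ≥0∞) * (2⁻¹ : ℝ≥0∞) ^ l) atTop (nhds 0) := by
  have := ENNReal.Tendsto.const_mul (a := (c : ℝ≥0∞)) (b := 0)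
    (ENNReal.tendsto_pow_atTop_nhds_zero_of_lt_one (r := 2⁻¹) (by norm_num))
    (Or.inr ENNReal.coe_ne_top)
  simpa using this

/-- A measurable function of `ρ` that agrees with `W₁(ρ, f)` on empirical measures, and controls it
from below in general. -/
theorem exists_measurable_le_W1 {E : Type*} [NormedAddCommGroup E] [MeasurableSpace E]
    [BorelSpace E] [SecondCountableTopology E] [StandardBorelSpace E] {d : ℕ} (Q : GridChart E d)
    (N : ℕ) [NeZero N] (f : ProbabilityMeasure E) :
    ∃ k u : ProbabilityMeasure E → ℝ≥0∞, Measurable k ∧ Measurable u ∧ u f = 0 ∧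
      (∀ ρ η : ProbabilityMeasure E, k ρ ≤ W1 (ρ : Measure E) (η : Measure E) + u η) ∧
      ∀ V : Fin N → E, W1 (empirical V : Measure E) (f : Measure E) ≤ k (empirical V) := by
  have hcell : ∀ l i, MeasurableSet (Q.cell l ⁻¹' {i}) := fun l i =>
    Q.measurable_cell l (measurableSet_singleton i)
  set D : ℕ → ProbabilityMeasure E → ProbabilityMeasure E → ℝ≥0∞ := fun l μ ρ =>
    Q.K * (2⁻¹ : ℝ≥0∞) ^ l + ∑' i, ((μ : Measure E) (Q.cell l ⁻¹' {i})
      - (ρ : Measure E) (Q.cell l ⁻¹' {i})) with hD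
  have hWD : ∀ l (μ ρ : ProbabilityMeasure E), W1 (μ : Measure E) (ρ : Measure E) ≤ D l μ ρ :=
    fun l μ ρ => W1_le_cells Q l _ _
  -- One point per cell, so that the configurations of `N` representatives form a countable family.
  -- For an empty cell the point is arbitrary, which is harmless: the upper bound on `k` holds for
  -- any choice of points.
  let rep : ℕ → (Fin d → ℤ) → E := fun l => Function.invFun (Q.cell l)
  have hrep : ∀ l x, Q.cell l (rep l (Q.cell l x)) = Q.cell l x := fun l x =>
    Function.invFun_eq ⟨x, rfl⟩
  let V' : ℕ → (Fin N → Fin d → ℤ) → ProbabilityMeasure E := fun l z =>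
    empirical fun i => rep l (z i)
  -- By the triangle inequality each term is at most `W₁(ρ, f)`. The supremum is countable and its
  -- terms are measurable in `ρ`, so `k` is a measurable minorant of `W₁(·, f)`.
  set k : ProbabilityMeasure E → ℝ≥0∞ := fun ρ => ⨆ (l : ℕ) (z : Fin N → Fin d → ℤ),
    W1 (V' l z : Measure E) (f : Measure E) - D l (V' l z) ρ with hk
  set u : ProbabilityMeasure E → ℝ≥0∞ := fun η => ⨅ l, D l η f with hu
  have hkm : Measurable k := by
    refine Measurable.iSup fun l => Measurable.iSup fun z => Measurable.const_sub ?_ _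
    refine Measurable.const_add (Measurable.tsum fun i => Measurable.const_sub ?_ _) _
    exact measurable_probabilityMeasure_apply (hcell l i)
  have hum : Measurable u := by
    refine Measurable.iInf fun l => ?_
    refine Measurable.const_add (Measurable.tsum fun i => Measurable.sub_const ?_ _) _
    exact measurable_probabilityMeasure_apply (hcell l i)
  have huf : u f = 0 := by
    refine le_antisymm ?_ bot_le
    refine ge_of_tendsto' (tendsto_const_mul_inv_two_pow Q.K) fun l => ?_
    refine (iInf_le _ l).trans (le_of_eq ?_)
    simp [hD]
  have hkW : ∀ ρ η : ProbabilityMeasure E, k ρ ≤ W1 (ρ : Measure E) (η : Measure E) + u η := by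
    intro ρ η
    refine iSup_le fun l => iSup_le fun z => ?_
    rw [tsub_le_iff_right]
    have h1 := W1_triangle (V' l z : Measure E) (ρ : Measure E) (f : Measure E)
    have h2 := W1_triangle (ρ : Measure E) (η : Measure E) (f : Measure E)
    have h3 : W1 (η : Measure E) (f : Measure E) ≤ u η := le_iInf fun l => hWD l η f
    calc W1 (V' l z : Measure E) (f : Measure E)
        ≤ D l (V' l z) ρ + (W1 (ρ : Measure E) (η : Measure E) + u η) :=
          h1.trans (add_le_add (hWD _ _ _) (h2.trans (by gcongr)))
      _ = _ := add_comm _ _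
  have hke : ∀ V : Fin N → E, W1 (empirical V : Measure E) (f : Measure E) ≤ k (empirical V) := by
    intro V
    have hlim : Tendsto (fun l : ℕ => k (empirical V) + ((2 * Q.K : ℝ≥0) : ℝ≥0∞) * 2⁻¹ ^ l)
        atTop (nhds (k (empirical V))) := by
      simpa using (tendsto_const_mul_inv_two_pow (2 * Q.K)).const_add (k (empirical V))
    refine ge_of_tendsto' hlim fun l => ?_
    -- Moving each atom to the representative of its cell preserves the masses of all cells of
    -- generation `l`, hence costs at most `K 2^{-l}` in either direction. This makes `k` exact on
    -- empirical measures as `l → ∞`.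
    set z : Fin N → Fin d → ℤ := fun i => Q.cell l (V i)
    have hsame : ∀ i, (empirical V : Measure E) (Q.cell l ⁻¹' {i})
        = (V' l z : Measure E) (Q.cell l ⁻¹' {i}) := by
      intro i
      rw [empirical_apply _ (hcell l i), empirical_apply _ (hcell l i)]
      congr 1
      refine Finset.sum_congr rfl fun j _ => ?_
      simp only [Set.indicator, Set.mem_preimage, Set.mem_singleton_iff]
      rw [show Q.cell l (rep l (z j)) = Q.cell l (V j) from hrep l (V j)]
      rfl
    have hD1 : D l (empirical V) (V' l z) = Q.K * (2⁻¹ : ℝ≥0∞) ^ l := by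
      simp [hD, hsame]
    have hD2 : D l (V' l z) (empirical V) = Q.K * (2⁻¹ : ℝ≥0∞) ^ l := by
      simp [hD, hsame]
    have h1 := (W1_triangle (empirical V : Measure E) (V' l z : Measure E) (f : Measure E)).trans
      (add_le_add_left (hWD l _ _) _)
    have h2 : W1 (V' l z : Measure E) (f : Measure E)
        ≤ k (empirical V) + D l (V' l z) (empirical V) := by
      rw [← tsub_le_iff_right]
      exact le_iSup₂ (f := fun (l : ℕ) (z : Fin N → Fin d → ℤ) =>
        W1 (V' l z : Measure E) (f : Measure E) - D l (V' l z) (empirical V)) l z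
    rw [hD1] at h1
    rw [hD2] at h2
    refine h1.trans ((add_le_add_right h2 _).trans (le_of_eq ?_))
    push_cast
    ring
  exact ⟨k, u, hkm, hum, huf, hkW, hke⟩

theorem measurable_W1_empirical {E : Type*} [NormedAddCommGroup E] [MeasurableSpace E]
    [BorelSpace E] [SecondCountableTopology E] [StandardBorelSpace E] {d : ℕ} (Q : GridChart E d)
    (N : ℕ) [NeZero N] (f : ProbabilityMeasure E) :
    Measurable fun V : Fin N → E => W1 (empirical V : Measure E) (f : Measure E) := by
  obtain ⟨k, u, hkm, -, huf, hkW, hke⟩ := exists_measurable_le_W1 Q N f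
  have h : (fun V : Fin N → E => W1 (empirical V : Measure E) (f : Measure E)) =
      fun V => k (empirical V) := by
    funext V
    refine le_antisymm (hke V) ((hkW _ f).trans ?_)
    rw [huf, add_zero]
  rw [h]
  exact hkm.comp (measurable_empirical N)

/-- The distance between the law of the empirical measure and a Dirac mass is the mean
distance. -/
theorem OmegaInf_eq_meanW1 {E : Type*} [NormedAddCommGroup E] [MeasurableSpace E]
    [BorelSpace E] [SecondCountableTopology E] [StandardBorelSpace E] {d : ℕ} (Q : GridChart E d)
    {N : ℕ} [NeZero N] (G : Measure (Fin N → E))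
    [IsProbabilityMeasure G] (f : ProbabilityMeasure E) : OmegaInf G f = meanW1 G f := by
  have : IsProbabilityMeasure (G.map (empirical : (Fin N → E) → ProbabilityMeasure E)) :=
    Measure.isProbabilityMeasure_map (measurable_empirical N).aemeasurable
  refine le_antisymm ?_ ?_
  · refine (mkw_le _ ((G.map empirical).prod (Measure.dirac f)) Measure.fst_prod
      Measure.snd_prod).trans ?_
    rw [Measure.prod_dirac, Measure.map_map (by fun_prop) (measurable_empirical N)]
    exact lintegral_map_le _ _
  · obtain ⟨k, u, hkm, hum, huf, hkW, hke⟩ := exists_measurable_le_W1 Q N f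
    refine le_mkw _ fun π h1 h2 => ?_
    -- The marginal `δ_f` is only tested against the measurable function `u`; no almost sure
    -- identity `p.2 = f` is needed.
    have hu0 : ∫⁻ p, u p.2 ∂π = 0 := by
      have : ∫⁻ p, u p.2 ∂π = ∫⁻ η, u η ∂π.snd := by
        rw [Measure.snd, lintegral_map hum measurable_snd]
      rw [this, h2, lintegral_dirac' _ hum, huf]
    calc meanW1 G f ≤ ∫⁻ V, k (empirical V) ∂G := lintegral_mono hke
      _ = ∫⁻ p, k p.1 ∂π := by
        rw [← lintegral_map hkm (measurable_empirical N), ← h1, Measure.fst,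
          lintegral_map hkm measurable_fst]
      _ ≤ ∫⁻ p, W1 (p.1 : Measure E) (p.2 : Measure E) + u p.2 ∂π :=
        lintegral_mono fun p => hkW _ _
      _ = ∫⁻ p, W1 (p.1 : Measure E) (p.2 : Measure E) ∂π := by
        rw [lintegral_add_right _ (show Measurable fun p : ProbabilityMeasure E × ProbabilityMeasure E
          => u p.2 from hum.comp measurable_snd), hu0, add_zero]

end Omega

/-! ### Fluctuations of empirical measures of independent samples -/

section Iid

variable {E : Type*} [MeasurableSpace E]

instance (f : ProbabilityMeasure E) (N : ℕ) : IsProbabilityMeasure (tensorPower f N) := by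
  unfold tensorPower; infer_instance

theorem lintegral_empirical_apply (f : ProbabilityMeasure E) (N : ℕ) [NeZero N] {A : Set E}
    (hA : MeasurableSet A) :
    ∫⁻ V, (empirical V : Measure E) A ∂tensorPower f N = (f : Measure E) A := by
  have hm : ∀ i : Fin N, Measurable fun V : Fin N → E => A.indicator (1 : E → ℝ≥0∞) (V i) :=
    fun i => (measurable_one.indicator hA).comp (measurable_pi_apply i)
  simp_rw [empirical_apply _ hA]
  rw [lintegral_const_mul _ (Finset.measurable_sum _ fun i _ => hm i),
    lintegral_finsetSum _ fun i _ => hm i]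
  have : ∀ i : Fin N, ∫⁻ V : Fin N → E, A.indicator (1 : E → ℝ≥0∞) (V i) ∂tensorPower f N
      = (f : Measure E) A := by
    intro i
    have hp := measurePreserving_eval (fun _ : Fin N => (f : Measure E)) i
    have := hp.lintegral_comp (measurable_one.indicator hA)
    rw [lintegral_indicator_one hA] at this
    exact this
  rw [Finset.sum_congr rfl fun i _ => this i, Finset.sum_const, Finset.card_univ, Fintype.card_fin,
    nsmul_eq_mul, ← mul_assoc, ENNReal.inv_mul_cancel (by simp [NeZero.ne N]) (by simp), one_mul]

/-- Mean fluctuation of the empirical measure of a set. -/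
theorem lintegral_empirical_sub_le (f : ProbabilityMeasure E) (N : ℕ) [NeZero N] {A : Set E}
    (hA : MeasurableSet A) :
    ∫⁻ V, ((empirical V : Measure E) A - (f : Measure E) A) ∂tensorPower f N
      ≤ ENNReal.ofReal √((f : Measure E).real A / N) := by
  set p := (f : Measure E).real A with hp
  have hN : (0 : ℝ) < N := by exact_mod_cast Nat.pos_of_ne_zero (NeZero.ne N)
  rcases (show 0 ≤ p from measureReal_nonneg).eq_or_lt with h0 | hpos
  · have hfA : (f : Measure E) A = 0 := by
      have : (f : Measure E).real A = 0 := h0.symm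
      rwa [measureReal_eq_zero_iff] at this
    calc _ ≤ ∫⁻ V, (empirical V : Measure E) A ∂tensorPower f N :=
          lintegral_mono fun V => tsub_le_self
      _ ≤ _ := by rw [lintegral_empirical_apply f N hA, hfA]; exact bot_le
  -- `s` bounds the standard deviation of the empirical mass. Integrating the pointwise inequality
  -- `y ≤ s/2 + y²/(2s)` gives exactly `s`; the case `p = 0` was set apart because `s` is a divisor
  -- here.
  set s := √(p / N) with hs
  have hspos : 0 < s := Real.sqrt_pos.2 (by positivity)
  have hs2 : s ^ 2 = p / N := Real.sq_sqrt (by positivity)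
  set X : Fin N → (Fin N → E) → ℝ := fun i V => A.indicator (1 : E → ℝ) (V i) with hX
  have hXm : ∀ i, Measurable (X i) := fun i =>
    (measurable_one.indicator hA).comp (measurable_pi_apply i)
  have h1 : ∀ v : E, A.indicator (1 : E → ℝ) v ∈ Set.Icc (0 : ℝ) 1 := fun v => by
    by_cases hv : v ∈ A <;> simp [hv]
  have hL2 : MemLp (A.indicator (1 : E → ℝ)) 2 (f : Measure E) :=
    MemLp.of_bound (measurable_one.indicator hA).aestronglyMeasurable 1
      (ae_of_all _ fun v => by
        rw [Real.norm_eq_abs, abs_of_nonneg (h1 v).1]; exact (h1 v).2)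
  set Y : (Fin N → E) → ℝ := ∑ i, X i with hY
  have hY2 : MemLp Y 2 (tensorPower f N) := by
    have hYm : Measurable Y := by
      rw [show Y = fun V => ∑ i, X i V by funext V; simp [hY]]
      exact Finset.measurable_fun_sum _ fun i _ => hXm i
    refine MemLp.of_bound hYm.aestronglyMeasurable N
      (ae_of_all _ fun V => ?_)
    rw [hY, Finset.sum_apply, Real.norm_eq_abs,
      abs_of_nonneg (Finset.sum_nonneg fun i _ => (h1 _).1)]
    calc ∑ i, X i V ≤ ∑ _i : Fin N, (1 : ℝ) := Finset.sum_le_sum fun i _ => (h1 _).2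
      _ = N := by simp
  have hEY : ∫ V, Y V ∂tensorPower f N = N * p := by
    have hi : ∀ i, ∫ V, X i V ∂tensorPower f N = p := by
      intro i
      have hpres := measurePreserving_eval (fun _ : Fin N => (f : Measure E)) i
      have := integral_map (μ := tensorPower f N) (φ := Function.eval i)
        (measurable_pi_apply i).aemeasurable (f := A.indicator (1 : E → ℝ))
        (measurable_one.indicator hA).aestronglyMeasurable
      rw [show (tensorPower f N).map (Function.eval i) = (f : Measure E) from hpres.map_eq,
        integral_indicator_one hA] at this
      exact this.symm
    simp only [hY, Finset.sum_apply]
    rw [integral_finsetSum]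
    · simp [hi]
    · intro i _
      exact (MemLp.of_bound (p := 1) (hXm i).aestronglyMeasurable 1 (ae_of_all _ fun V => by
        rw [Real.norm_eq_abs, abs_of_nonneg (h1 _).1]; exact (h1 _).2)).integrable le_rfl
  have hVar : variance Y (tensorPower f N) ≤ N * p := by
    have := variance_sum_pi (μ := fun _ : Fin N => (f : Measure E))
      (X := fun _ => A.indicator (1 : E → ℝ)) (fun _ => hL2)
    have hv : variance (A.indicator (1 : E → ℝ)) (f : Measure E) ≤ p := by
      refine (variance_le_expectation_sq hL2.aestronglyMeasurable).trans (le_of_eq ?_)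
      rw [hp, ← integral_indicator_one hA]
      refine integral_congr_ae (ae_of_all _ fun v => ?_)
      by_cases hv : v ∈ A <;> simp [hv]
    have e : variance Y (tensorPower f N)
        = ∑ _i : Fin N, variance (A.indicator (1 : E → ℝ)) (f : Measure E) := this
    rw [e, Finset.sum_const, Finset.card_univ, Fintype.card_fin, nsmul_eq_mul]
    gcongr
  have hVar' : ∫ V, (Y V - N * p) ^ 2 ∂tensorPower f N ≤ N * p := by
    rw [variance_eq_integral hY2.aestronglyMeasurable.aemeasurable, hEY] at hVar
    exact hVar
  have hpt : ∀ V, (empirical V : Measure E) A - (f : Measure E) A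
      ≤ ENNReal.ofReal (s / 2 + (Y V - N * p) ^ 2 / (2 * s * N ^ 2)) := by
    intro V
    have e1 : (empirical V : Measure E) A = ENNReal.ofReal (Y V / N) := by
      rw [empirical_apply _ hA, hY, Finset.sum_apply, ENNReal.ofReal_div_of_pos hN,
        ENNReal.ofReal_sum_of_nonneg fun i _ => (h1 _).1, ENNReal.ofReal_natCast, div_eq_mul_inv,
        mul_comm]
      congr 1
      refine Finset.sum_congr rfl fun i _ => ?_
      by_cases hv : V i ∈ A <;> simp [hv]
    have e2 : (f : Measure E) A = ENNReal.ofReal p := by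
      rw [hp, ofReal_measureReal]
    rw [e1, e2, ← ENNReal.ofReal_sub _ hpos.le]
    refine ENNReal.ofReal_le_ofReal ?_
    have e3 : Y V / N - p = (Y V - N * p) / N := by field_simp
    have e4 : (Y V - N * p) ^ 2 / (2 * s * N ^ 2) = ((Y V - N * p) / N) ^ 2 / (2 * s) := by
      field_simp
    rw [e3, e4]
    set y := (Y V - N * p) / N
    have : s / 2 + y ^ 2 / (2 * s) - y = (y - s) ^ 2 / (2 * s) := by field_simp; ring
    have h5 : 0 ≤ (y - s) ^ 2 / (2 * s) := by positivity
    linarith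
  have hint : Integrable (fun V => (Y V - N * p) ^ 2) (tensorPower f N) :=
    (hY2.sub (memLp_const _)).integrable_sq
  refine (lintegral_mono hpt).trans ?_
  rw [← ofReal_integral_eq_lintegral_ofReal (f := fun V => s / 2 + (Y V - N * p) ^ 2 /
    (2 * s * N ^ 2)) ((integrable_const _).add (hint.div_const _))
    (ae_of_all _ fun V => by positivity)]
  refine ENNReal.ofReal_le_ofReal ?_
  rw [integral_add (integrable_const _) (hint.div_const _)]
  simp only [integral_const, probReal_univ, one_smul, integral_div]
  have : (∫ V, (Y V - N * p) ^ 2 ∂tensorPower f N) / (2 * s * N ^ 2) ≤ s / 2 := by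
    rw [div_le_iff₀ (by positivity)]
    have : s / 2 * (2 * s * N ^ 2) = N * p := by
      have : s / 2 * (2 * s * N ^ 2) = s ^ 2 * N ^ 2 := by ring
      rw [this, hs2]; field_simp
    linarith
  linarith

end Iid

theorem meanW1_le_one {E : Type*} [NormedAddCommGroup E] [MeasurableSpace E] {N : ℕ} [NeZero N]
    (G : Measure (Fin N → E)) [IsProbabilityMeasure G] (f : ProbabilityMeasure E) : meanW1 G f ≤ 1 := by
  refine (lintegral_mono fun V => W1_le_one _ _).trans ?_
  simp

/-! ### Rate for independent samples -/

section IidRate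

variable {E : Type*} [NormedAddCommGroup E] [MeasurableSpace E] [BorelSpace E] {d : ℕ}
  (Q : GridChart E d)

theorem measure_norm_ge_le {k : ℝ} (hk : 0 < k) {M : ℝ≥0} {f : ProbabilityMeasure E}
    (hf : moment k f ≤ M) {R : ℝ} (hR : 0 < R) :
    (f : Measure E) {v | R ≤ ‖v‖} ≤ M * ENNReal.ofReal (R ^ (-k)) := by
  have h1 : {v : E | R ≤ ‖v‖} ⊆ {v | ENNReal.ofReal R ^ k ≤ ‖v‖ₑ ^ k} := by
    intro v hv
    refine ENNReal.rpow_le_rpow ?_ hk.le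
    rw [← ofReal_norm]
    exact ENNReal.ofReal_le_ofReal hv
  have h2 := mul_meas_ge_le_lintegral (μ := (f : Measure E))
    (f := fun v => ‖v‖ₑ ^ k) (by fun_prop) (ENNReal.ofReal R ^ k)
  have h3 : ENNReal.ofReal (R ^ (-k)) = (ENNReal.ofReal R ^ k)⁻¹ := by
    rw [← ENNReal.ofReal_rpow_of_pos hR, ENNReal.rpow_neg]
  have hne : ENNReal.ofReal R ^ k ≠ 0 := by
    simp [ENNReal.rpow_eq_zero_iff, hR]
  have hnt : ENNReal.ofReal R ^ k ≠ ∞ := ENNReal.rpow_ne_top_of_nonneg hk.le ENNReal.ofReal_ne_top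
  rw [h3, ← div_eq_mul_inv, ENNReal.le_div_iff_mul_le (Or.inl hne) (Or.inl hnt), mul_comm]
  calc _ ≤ ENNReal.ofReal R ^ k * (f : Measure E) {v | ENNReal.ofReal R ^ k ≤ ‖v‖ₑ ^ k} := by
        gcongr
    _ ≤ moment k f := h2
    _ ≤ M := hf

/-- In the finitely many cells of a box containing those of the ball of radius `R`, the fluctuations
`√(p_i/N)` are summed by Cauchy-Schwarz. In the other cells the excess is bounded by the empirical
mass, whose mean is the mass of `f`, and Markov's inequality applies. -/
theorem sum_cells_le {k : ℝ} (hk : 0 < k) {M : ℝ≥0} {f : ProbabilityMeasure E}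
    (hf : moment k f ≤ M) (N : ℕ) [NeZero N] {R : ℝ} (hR : 1 ≤ R) (l : ℕ) :
    ∫⁻ V, ∑' i, ((empirical V : Measure E) (Q.cell l ⁻¹' {i}) - (f : Measure E) (Q.cell l ⁻¹' {i}))
      ∂tensorPower f N
      ≤ ENNReal.ofReal √((5 * (2 ^ l * R)) ^ d / N) + M * ENNReal.ofReal (R ^ (-k)) := by
  have hcell : ∀ i, MeasurableSet (Q.cell l ⁻¹' {i}) := fun i =>
    Q.measurable_cell l (measurableSet_singleton i)
  have hN : (0 : ℝ) < N := by exact_mod_cast Nat.pos_of_ne_zero (NeZero.ne N)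
  have hmeas : ∀ i, Measurable fun V : Fin N → E =>
      (empirical V : Measure E) (Q.cell l ⁻¹' {i}) - (f : Measure E) (Q.cell l ⁻¹' {i}) := fun i =>
    ((measurable_probabilityMeasure_apply (hcell i)).comp (measurable_empirical N)).sub_const _
  rw [lintegral_tsum fun i => (hmeas i).aemeasurable]
  set m : ℕ := ⌈2 ^ l * R⌉₊ with hm
  -- Each coordinate takes `2m + 1 ≤ 2 (2^l R + 1) + 1` values, at most `5 · 2^l R` because `2^l R ≥
  -- 1`.
  set J : Finset (Fin d → ℤ) := Fintype.piFinset fun _ => Finset.Icc (-(m : ℤ)) m with hJ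
  have h2R : (1 : ℝ) ≤ 2 ^ l * R := by
    have : (1 : ℝ) ≤ 2 ^ l := one_le_pow₀ (by norm_num)
    nlinarith
  have hcard : (J.card : ℝ) ≤ (5 * (2 ^ l * R)) ^ d := by
    rw [hJ, Fintype.card_piFinset]
    simp only [Int.card_Icc, Finset.prod_const, Finset.card_univ, Fintype.card_fin]
    push_cast
    gcongr
    have h3 : (((m : ℤ) + 1 - -(m : ℤ)).toNat : ℝ) = 2 * m + 1 := by
      have : ((m : ℤ) + 1 - -(m : ℤ)).toNat = 2 * m + 1 := by omega
      rw [this]; push_cast; ring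
    rw [h3]
    have h4 : (m : ℝ) < 2 ^ l * R + 1 := Nat.ceil_lt_add_one (by linarith)
    linarith
  have hout : ∀ v, Q.cell l v ∉ J → R ≤ ‖v‖ := by
    intro v hv
    by_contra! hlt
    refine hv (Fintype.mem_piFinset.2 fun i => Finset.mem_Icc.2 ?_)
    have h5 : |2 ^ l * Q.q v i| ≤ m := by
      rw [abs_mul, abs_of_pos (by positivity : (0 : ℝ) < 2 ^ l)]
      refine le_trans ?_ (Nat.le_ceil _)
      gcongr
      exact (Q.abs_le v i).trans hlt.le
    rw [abs_le] at h5
    refine ⟨Int.le_floor.2 (by push_cast; exact h5.1), ?_⟩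
    have := (Int.floor_le (2 ^ l * Q.q v i)).trans h5.2
    show ⌊(2 : ℝ) ^ l * Q.q v i⌋ ≤ (m : ℤ)
    exact_mod_cast this
  rw [← ENNReal.sum_add_tsum_compl J]
  refine add_le_add ?_ ?_
  · calc _ ≤ ∑ i ∈ J, ENNReal.ofReal √((f : Measure E).real (Q.cell l ⁻¹' {i}) / N) :=
          Finset.sum_le_sum fun i _ => lintegral_empirical_sub_le f N (hcell i)
      _ = ENNReal.ofReal (∑ i ∈ J, √((f : Measure E).real (Q.cell l ⁻¹' {i}) / N)) :=
          (ENNReal.ofReal_sum_of_nonneg fun i _ => Real.sqrt_nonneg _).symm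
      _ ≤ _ := by
        refine ENNReal.ofReal_le_ofReal (Real.le_sqrt_of_sq_le ?_)
        refine (sq_sum_le_card_mul_sum_sq).trans ?_
        have h6 : ∑ i ∈ J, √((f : Measure E).real (Q.cell l ⁻¹' {i}) / N) ^ 2 ≤ 1 / N := by
          have : ∀ i, √((f : Measure E).real (Q.cell l ⁻¹' {i}) / N) ^ 2
              = (f : Measure E).real (Q.cell l ⁻¹' {i}) / N := fun i =>
            Real.sq_sqrt (by positivity)
          rw [Finset.sum_congr rfl fun i _ => this i, ← Finset.sum_div]
          gcongr
          rw [← measureReal_biUnion_finset _ fun i _ => hcell i]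
          · exact measureReal_le_one
          · intro i _ j _ hij
            exact Disjoint.preimage _ (by simpa using hij)
        calc (J.card : ℝ) * _ ≤ (5 * (2 ^ l * R)) ^ d * (1 / N) := by gcongr
          _ = _ := by ring
  · calc _ ≤ ∑' i : ↥((J : Set (Fin d → ℤ))ᶜ), (f : Measure E) (Q.cell l ⁻¹' {(i : Fin d → ℤ)}) := by
          refine ENNReal.tsum_le_tsum fun i => ?_
          rw [← lintegral_empirical_apply f N (hcell i)]
          exact lintegral_mono fun V => tsub_le_self
      _ = (f : Measure E) (⋃ i : ↥((J : Set (Fin d → ℤ))ᶜ), Q.cell l ⁻¹' {(i : Fin d → ℤ)}) := by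
          refine (measure_iUnion (fun i j hij => ?_) fun i => hcell _).symm
          exact Disjoint.preimage _ (by simpa [Subtype.ext_iff] using hij)
      _ ≤ (f : Measure E) {v | R ≤ ‖v‖} := by
          refine measure_mono fun v hv => ?_
          obtain ⟨i, hi⟩ := Set.mem_iUnion.1 hv
          refine hout v fun h => i.2 ?_
          rw [show Q.cell l v = i from hi] at h
          exact h
      _ ≤ _ := measure_norm_ge_le hk hf (by linarith)

theorem meanW1_tensorPower_le_explicit {k : ℝ} (hk : 0 < k) {M : ℝ≥0} {f : ProbabilityMeasure E}
    (hf : moment k f ≤ M) (N : ℕ) [NeZero N] {R : ℝ} (hR : 1 ≤ R) (L : ℕ) :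
    meanW1 (tensorPower f N) f ≤ ENNReal.ofReal (2 * max 1 (Q.K : ℝ) * ((1 / 2) ^ L +
      ∑ l ∈ Finset.range L, (1 / 2) ^ l *
        (√((5 * (2 ^ l * R)) ^ d / N) + M * R ^ (-k)))) := by
  set S : ℕ → (Fin N → E) → ℝ≥0∞ := fun l V => ∑' i, ((empirical V : Measure E)
      (Q.cell l ⁻¹' {i}) - (f : Measure E) (Q.cell l ⁻¹' {i})) with hS
  have hmeas : ∀ l, Measurable (S l) := fun l =>
    Measurable.tsum fun i => ((measurable_probabilityMeasure_apply
      (Q.measurable_cell l (measurableSet_singleton i))).comp (measurable_empirical N)).sub_const _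
  have hhalf : ∀ l : ℕ, (2⁻¹ : ℝ≥0∞) ^ l = ENNReal.ofReal ((1 / 2) ^ l) := fun l => by
    rw [ENNReal.ofReal_pow (by norm_num), one_div, ENNReal.ofReal_inv_of_pos (by norm_num)]
    simp
  have hR0 : 0 ≤ R ^ (-k) := Real.rpow_nonneg (by linarith) _
  have hT : ∀ l, 0 ≤ (1 / 2 : ℝ) ^ l * (√((5 * (2 ^ l * R)) ^ d / N) + M * R ^ (-k)) := fun l => by
    positivity
  calc meanW1 (tensorPower f N) f
      ≤ ∫⁻ V, 2 * max 1 (Q.K : ℝ≥0∞) * ((2⁻¹ : ℝ≥0∞) ^ L + ∑ l ∈ Finset.range L,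
          (2⁻¹ : ℝ≥0∞) ^ l * S l V) ∂tensorPower f N :=
        lintegral_mono fun V => W1_le_multiscale Q L (empirical V : Measure E) (f : Measure E)
    _ = 2 * max 1 (Q.K : ℝ≥0∞) * ((2⁻¹ : ℝ≥0∞) ^ L + ∑ l ∈ Finset.range L,
          (2⁻¹ : ℝ≥0∞) ^ l * ∫⁻ V, S l V ∂tensorPower f N) := by
        have hs : Measurable fun V : Fin N → E => ∑ l ∈ Finset.range L, (2⁻¹ : ℝ≥0∞) ^ l * S l V :=
          Finset.measurable_fun_sum _ fun l _ => (hmeas l).const_mul _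
        rw [lintegral_const_mul _ (hs.const_add _), lintegral_add_left measurable_const,
          lintegral_const, measure_univ, mul_one,
          lintegral_finsetSum _ fun l _ => (hmeas l).const_mul _]
        congr 2
        exact Finset.sum_congr rfl fun l _ => lintegral_const_mul _ (hmeas l)
    _ ≤ 2 * max 1 (Q.K : ℝ≥0∞) * (ENNReal.ofReal ((1 / 2) ^ L) + ∑ l ∈ Finset.range L,
          ENNReal.ofReal ((1 / 2) ^ l * (√((5 * (2 ^ l * R)) ^ d / N) + M * R ^ (-k)))) := by
        rw [← hhalf]
        gcongr with l hl
        rw [ENNReal.ofReal_mul (by positivity), ← hhalf, ENNReal.ofReal_add (Real.sqrt_nonneg _)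
          (by positivity), ENNReal.ofReal_mul (by positivity), ENNReal.ofReal_coe_nnreal]
        gcongr
        exact sum_cells_le Q hk hf N hR l
    _ = _ := by
        rw [ENNReal.ofReal_mul (by positivity), ENNReal.ofReal_add (by positivity)
          (Finset.sum_nonneg fun l _ => hT l), ENNReal.ofReal_sum_of_nonneg fun l _ => hT l,
          ENNReal.ofReal_mul (by norm_num), ENNReal.ofReal_max]
        simp

/-- Elementary optimization of the scales in the multiscale bound. -/
theorem exists_scales {d : ℕ} {k α : ℝ} (hk : 0 < k) (hα0 : 0 < α)
    (hα : α < 1 / (max (d : ℝ) 2 + d / k)) (M : ℝ≥0) :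
    ∃ C : ℝ, 0 ≤ C ∧ ∀ N : ℕ, 1 ≤ N → ∃ (R : ℝ) (L : ℕ), 1 ≤ R ∧
      (1 / 2) ^ L + ∑ l ∈ Finset.range L, (1 / 2) ^ l *
        (√((5 * (2 ^ l * R)) ^ d / N) + M * R ^ (-k)) ≤ C / (N : ℝ) ^ α := by
  set D : ℝ := max (d : ℝ) 2 with hD
  have hD2 : 2 ≤ D := le_max_right _ _
  have hdD : (d : ℝ) ≤ D := le_max_left _ _
  -- The fluctuation at each generation turns out to be at most a constant times `N^{-α-ε}`.
  -- Positivity of `ε` is the condition that `α` is below the critical exponent, and the spare `N^ε`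
  -- pays for the logarithmic number of generations.
  set ε : ℝ := 1 / 2 - α / 2 * (D + d / k) with hε
  have hεpos : 0 < ε := by
    have h0 : 0 < D + d / k := by positivity
    rw [lt_div_iff₀ h0] at hα
    rw [hε]; linarith
  set c₁ : ℝ := α / (ε * Real.log 2) + 1 with hc₁
  have hl2 : 0 < Real.log 2 := Real.log_pos (by norm_num)
  set c₂ : ℝ := (5 : ℝ) ^ ((d : ℝ) / 2) * 2 ^ (D / 2 - 1) with hc₂
  refine ⟨1 + 2 * M + c₁ * c₂, by positivity, fun N hN => ?_⟩
  have hN1 : (1 : ℝ) ≤ N := by exact_mod_cast hN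
  have hN0 : (0 : ℝ) < N := by linarith
  -- The finest scale is about `N^{-α}`: `2^L` lies between `N^α` and `2 N^α`.
  set L : ℕ := ⌈α * Real.logb 2 N⌉₊ with hL
  have hlog : 0 ≤ α * Real.logb 2 N := mul_nonneg hα0.le (Real.logb_nonneg (by norm_num) hN1)
  have hpow : (2 : ℝ) ^ (α * Real.logb 2 N) = (N : ℝ) ^ α := by
    rw [mul_comm, Real.rpow_mul (by norm_num), Real.rpow_logb (by norm_num) (by norm_num) hN0]
  have hL1 : (N : ℝ) ^ α ≤ 2 ^ L := by
    rw [← hpow, ← Real.rpow_natCast]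
    exact Real.rpow_le_rpow_of_exponent_le (by norm_num) (Nat.le_ceil _)
  have hL2 : (2 : ℝ) ^ (L : ℝ) ≤ 2 * (N : ℝ) ^ α := by
    rw [← hpow]
    calc (2 : ℝ) ^ (L : ℝ) ≤ 2 ^ (α * Real.logb 2 N + 1) :=
          Real.rpow_le_rpow_of_exponent_le (by norm_num) (Nat.ceil_lt_add_one hlog).le
      _ = _ := by rw [Real.rpow_add (by norm_num), Real.rpow_one, mul_comm]
  have hL3 : (L : ℝ) ≤ c₁ * (N : ℝ) ^ ε := by
    have h1 : (1 : ℝ) ≤ (N : ℝ) ^ ε := Real.one_le_rpow hN1 hεpos.le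
    have h2 : Real.log N ≤ (N : ℝ) ^ ε / ε := Real.log_le_rpow_div hN0.le hεpos
    calc (L : ℝ) ≤ α * Real.logb 2 N + 1 := (Nat.ceil_lt_add_one hlog).le
      _ = α / Real.log 2 * Real.log N + 1 := by rw [Real.logb]; ring
      _ ≤ α / Real.log 2 * ((N : ℝ) ^ ε / ε) + (N : ℝ) ^ ε := by gcongr
      _ = c₁ * (N : ℝ) ^ ε := by rw [hc₁]; field_simp
  have hNα : 0 < (N : ℝ) ^ α := Real.rpow_pos_of_pos hN0 _
  -- This radius makes the tail `R^{-k}` equal to `N^{-α}`.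
  refine ⟨(N : ℝ) ^ (α / k), L, Real.one_le_rpow hN1 (by positivity), ?_⟩
  set R : ℝ := (N : ℝ) ^ (α / k) with hR
  have hR0 : 0 < R := Real.rpow_pos_of_pos hN0 _
  have hRk : R ^ (-k) = ((N : ℝ) ^ α)⁻¹ := by
    rw [hR, ← Real.rpow_mul hN0.le, ← Real.rpow_neg hN0.le]
    congr 1; field_simp
  have hgeom : ∑ l ∈ Finset.range L, (1 / 2 : ℝ) ^ l ≤ 2 := by
    have := Summable.sum_le_tsum (Finset.range L) (fun l _ => by positivity)
      summable_geometric_two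
    rwa [tsum_geometric_two] at this
  have hterm : ∀ l ∈ Finset.range L, (1 / 2 : ℝ) ^ l * √((5 * (2 ^ l * R)) ^ d / N)
      ≤ c₂ * (N : ℝ) ^ (-α - ε) := by
    intro l hl
    have hlL : (l : ℝ) ≤ L := by exact_mod_cast (Finset.mem_range.1 hl).le
    have e1 : √((5 * (2 ^ l * R)) ^ d / N)
        = 5 ^ ((d : ℝ) / 2) * (2 : ℝ) ^ (l * ((d : ℝ) / 2)) * R ^ ((d : ℝ) / 2)
          * (N : ℝ) ^ (-(1 / 2 : ℝ)) := by
      rw [Real.sqrt_eq_rpow, ← Real.rpow_natCast, Real.div_rpow (by positivity) hN0.le,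
        ← Real.rpow_mul (by positivity), Real.mul_rpow (by norm_num) (by positivity),
        Real.mul_rpow (by positivity) hR0.le, ← Real.rpow_natCast 2 l, ← Real.rpow_mul (by norm_num),
        Real.rpow_neg hN0.le]
      ring_nf
    have e2 : (1 / 2 : ℝ) ^ l = 2 ^ (-(l : ℝ)) := by
      rw [Real.rpow_neg (by norm_num), Real.rpow_natCast, one_div, inv_pow]
    have e3 : (1 / 2 : ℝ) ^ l * (2 : ℝ) ^ (l * ((d : ℝ) / 2)) ≤ (2 * (N : ℝ) ^ α) ^ (D / 2 - 1) := by
      rw [e2, ← Real.rpow_add (by norm_num)]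
      calc (2 : ℝ) ^ (-(l : ℝ) + l * ((d : ℝ) / 2)) ≤ 2 ^ ((L : ℝ) * (D / 2 - 1)) := by
            refine Real.rpow_le_rpow_of_exponent_le (by norm_num) ?_
            have : 0 ≤ D / 2 - 1 := by linarith
            have h0 : (0 : ℝ) ≤ l := by positivity
            nlinarith
        _ = ((2 : ℝ) ^ (L : ℝ)) ^ (D / 2 - 1) := Real.rpow_mul (by norm_num) _ _
        _ ≤ _ := Real.rpow_le_rpow (by positivity) hL2 (by linarith)
    have e4 : (2 * (N : ℝ) ^ α) ^ (D / 2 - 1) = 2 ^ (D / 2 - 1) * (N : ℝ) ^ (α * (D / 2 - 1)) := by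
      rw [Real.mul_rpow (by norm_num) hNα.le, ← Real.rpow_mul hN0.le]
    have e5 : R ^ ((d : ℝ) / 2) = (N : ℝ) ^ (α / k * (d / 2)) := by
      rw [hR, ← Real.rpow_mul hN0.le]
    calc _ = ((1 / 2 : ℝ) ^ l * (2 : ℝ) ^ (l * ((d : ℝ) / 2))) * (5 ^ ((d : ℝ) / 2)
          * R ^ ((d : ℝ) / 2) * (N : ℝ) ^ (-(1 / 2 : ℝ))) := by rw [e1]; ring
      _ ≤ (2 ^ (D / 2 - 1) * (N : ℝ) ^ (α * (D / 2 - 1))) * (5 ^ ((d : ℝ) / 2)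
          * R ^ ((d : ℝ) / 2) * (N : ℝ) ^ (-(1 / 2 : ℝ))) := by rw [← e4]; gcongr
      _ = c₂ * ((N : ℝ) ^ (α * (D / 2 - 1)) * (N : ℝ) ^ (α / k * (d / 2))
          * (N : ℝ) ^ (-(1 / 2 : ℝ))) := by rw [e5, hc₂]; ring
      _ = c₂ * (N : ℝ) ^ (-α - ε) := by
          rw [← Real.rpow_add hN0, ← Real.rpow_add hN0]
          congr 2; rw [hε]; field_simp; ring
  calc _ = (1 / 2 : ℝ) ^ L + (∑ l ∈ Finset.range L, (1 / 2) ^ l * √((5 * (2 ^ l * R)) ^ d / N)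
        + (∑ l ∈ Finset.range L, (1 / 2) ^ l) * (M * R ^ (-k))) := by
        rw [Finset.sum_mul, ← Finset.sum_add_distrib]
        congr 1
        exact Finset.sum_congr rfl fun l _ => by ring
    _ ≤ ((N : ℝ) ^ α)⁻¹ + (L * (c₂ * (N : ℝ) ^ (-α - ε)) + 2 * (M * ((N : ℝ) ^ α)⁻¹)) := by
        rw [hRk]
        gcongr
        · rw [one_div, inv_pow]; gcongr
        · refine (Finset.sum_le_sum hterm).trans ?_
          simp
    _ ≤ ((N : ℝ) ^ α)⁻¹ + (c₁ * (N : ℝ) ^ ε * (c₂ * (N : ℝ) ^ (-α - ε))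
        + 2 * (M * ((N : ℝ) ^ α)⁻¹)) := by gcongr
    _ = _ := by
        have : (N : ℝ) ^ ε * (N : ℝ) ^ (-α - ε) = ((N : ℝ) ^ α)⁻¹ := by
          rw [← Real.rpow_add hN0, ← Real.rpow_neg hN0.le]; congr 1; ring
        calc _ = ((N : ℝ) ^ α)⁻¹ + (c₁ * c₂ * ((N : ℝ) ^ ε * (N : ℝ) ^ (-α - ε))
            + 2 * (M * ((N : ℝ) ^ α)⁻¹)) := by ring
          _ = _ := by rw [this]; field_simp; ring

/-- Quantitative law of large numbers for the empirical measures of independent samples. -/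
theorem exists_meanW1_tensorPower_le (Q : GridChart E d) {k : ℝ} (hk : 0 < k) (M : ℝ≥0) {α : ℝ}
    (hα : α < 1 / (max (d : ℝ) 2 + d / k)) :
    ∃ C : ℝ, 0 ≤ C ∧ ∀ f : ProbabilityMeasure E, moment k f ≤ M → ∀ (N : ℕ) [NeZero N],
      meanW1 (tensorPower f N) f ≤ ENNReal.ofReal (C / (N : ℝ) ^ α) := by
  -- For `α ≤ 0` the right-hand side is at least `1`, which already bounds `W₁`.
  rcases le_or_gt α 0 with h0 | h0
  · refine ⟨1, zero_le_one, fun f _ N _ => (meanW1_le_one _ f).trans ?_⟩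
    rw [← ENNReal.ofReal_one]
    refine ENNReal.ofReal_le_ofReal ?_
    have hN : (1 : ℝ) ≤ N := by exact_mod_cast Nat.one_le_iff_ne_zero.2 (NeZero.ne N)
    rw [one_div]
    exact (one_le_inv₀ (Real.rpow_pos_of_pos (by linarith) _)).2
      (Real.rpow_le_one_of_one_le_of_nonpos hN h0)
  · obtain ⟨C, hC, h⟩ := exists_scales hk h0 hα M
    refine ⟨2 * max 1 (Q.K : ℝ) * C, by positivity, fun f hf N _ => ?_⟩
    obtain ⟨R, L, hR, hRL⟩ := h N (Nat.one_le_iff_ne_zero.2 (NeZero.ne N))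
    refine (meanW1_tensorPower_le_explicit Q hk hf N hR L).trans (ENNReal.ofReal_le_ofReal ?_)
    rw [mul_div_assoc]
    gcongr

end IidRate

/-! ### Fourier inversion for densities -/

section FourierDensity

open scoped FourierTransform RealInnerProductSpace
open Complex (exp I)

variable {F : Type*} [NormedAddCommGroup F] [InnerProductSpace ℝ F] [FiniteDimensional ℝ F]
  [MeasurableSpace F] [BorelSpace F]

/-- Fourier inversion, almost everywhere. -/
theorem fourierInv_fourier_ae_eq {f : F → ℂ} (hf : Integrable f) (hf' : Integrable (𝓕 f)) :
    ∀ᵐ x, f x = 𝓕⁻ (𝓕 f) x := by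
  have hcont : Continuous (𝓕⁻ (𝓕 f)) := by
    rw [Real.fourierInv_eq_fourier_comp_neg]
    exact VectorFourier.fourierIntegral_continuous Real.continuous_fourierChar
      (L := innerₗ F) (by exact continuous_inner) hf'.comp_neg
  -- Both sides are tested against `g` smooth with compact support. With `η = 𝓕⁻ g`, each integral
  -- is turned into `∫ 𝓕 f · η` by moving one transform across the pairing.
  refine ae_eq_of_integral_contDiff_smul_eq hf.locallyIntegrable hcont.locallyIntegrable
    fun g hg hgs => ?_
  set ψ : SchwartzMap F ℂ := HasCompactSupport.toSchwartzMap (f := fun x => (g x : ℂ))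
    (hgs.comp_left (g := fun r : ℝ => (r : ℂ)) rfl)
    (Complex.ofRealCLM.contDiff.comp hg) with hψ
  have hψx : ∀ x, ψ x = (g x : ℂ) := fun x => rfl
  set η : SchwartzMap F ℂ := 𝓕⁻ ψ with hη
  have hηψ : 𝓕 η = ψ := FourierTransform.fourier_fourierInv_eq ψ
  have e1 : ∫ ξ, 𝓕 f ξ * η ξ = ∫ x, f x * ψ x := by
    have := VectorFourier.integral_fourierIntegral_smul_eq_flip (μ := (volume : Measure F))
      (ν := (volume : Measure F)) (L := innerₗ F)
      Real.continuous_fourierChar (by exact continuous_inner) hf η.integrable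
    rw [flip_innerₗ] at this
    rw [← hηψ, SchwartzMap.fourier_coe]
    exact this
  have e2 : ∫ ξ, 𝓕 f ξ * η ξ = ∫ x, 𝓕⁻ (𝓕 f) x * ψ x := by
    have h1 := VectorFourier.integral_fourierIntegral_smul_eq_flip (μ := (volume : Measure F))
      (ν := (volume : Measure F)) (L := -innerₗ F)
      Real.continuous_fourierChar (by exact continuous_inner.neg) hf' ψ.integrable
    have h2 : (-innerₗ F).flip = -innerₗ F := by
      ext x y; simp [real_inner_comm]
    rw [h2] at h1
    rw [hη, SchwartzMap.fourierInv_coe]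
    exact h1.symm
  have e3 : ∀ u : F → ℂ, ∫ x, g x • u x = ∫ x, u x * ψ x := fun u =>
    integral_congr_ae (ae_of_all _ fun x => by
      simp only [hψx, Complex.real_smul, mul_comm])
  rw [e3, e3, ← e1, e2]

/-- The Fourier inversion integral of a characteristic function. -/
noncomputable def invCharFun (μ : Measure F) (x : F) : ℂ :=
  𝓕⁻ (fun ζ => charFun μ ((-(2 * Real.pi)) • ζ)) x

/-- A density of a probability measure with integrable characteristic function is given by Fourier
inversion. -/
theorem density_ae_eq_invCharFun {h : F → ℝ≥0∞} (hm : Measurable h) {μ : Measure F}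
    [IsProbabilityMeasure μ] (hμ : μ = volume.withDensity h) (hint : Integrable (charFun μ)) :
    ∀ᵐ x, h x = ‖invCharFun μ x‖ₑ := by
  have hfin : ∫⁻ x, h x ≠ ∞ := by
    have : μ Set.univ = ∫⁻ x, h x := by rw [hμ, withDensity_apply _ .univ, setLIntegral_univ]
    rw [← this]; exact measure_ne_top _ _
  have hlt : ∀ᵐ x, h x < ∞ := ae_lt_top hm hfin
  set f : F → ℂ := fun x => ((h x).toReal : ℂ) with hf
  have hfi : Integrable f := (integrable_toReal_of_lintegral_ne_top hm.aemeasurable hfin).ofReal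
  have hft : 𝓕 f = fun ζ => charFun μ ((-(2 * Real.pi)) • ζ) := by
    funext ζ
    rw [Real.fourier_eq', charFun_apply, hμ,
      integral_withDensity_eq_integral_toReal_smul hm hlt]
    refine integral_congr_ae (ae_of_all _ fun x => ?_)
    simp only [hf, smul_eq_mul, Complex.real_smul, inner_smul_right]
    rw [mul_comm]
    push_cast
    ring_nf
  have hint' : Integrable (𝓕 f) := by
    rw [hft]
    exact hint.comp_smul (by simp [Real.pi_ne_zero])
  filter_upwards [fourierInv_fourier_ae_eq hfi hint', hlt] with x hx hxt
  rw [invCharFun, ← hft, ← hx, hf]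
  rw [← ofReal_norm, Complex.norm_real, Real.norm_of_nonneg ENNReal.toReal_nonneg,
    ENNReal.ofReal_toReal hxt.ne]

/-- The constant in the Fourier inversion formula. -/
noncomputable def invConst (F : Type*) [NormedAddCommGroup F] [InnerProductSpace ℝ F] : ℝ :=
  |((-(2 * Real.pi)) ^ Module.finrank ℝ F)⁻¹|

theorem invConst_pos (F : Type*) [NormedAddCommGroup F] [InnerProductSpace ℝ F] :
    0 < invConst F := by
  unfold invConst
  have : (-(2 * Real.pi)) ≠ 0 := by simp [Real.pi_ne_zero]
  positivity

theorem norm_invCharFun_le (μ : Measure F) (x : F) :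
    ‖invCharFun μ x‖ ≤ invConst F * ∫ ζ, ‖charFun μ ζ‖ := by
  have h1 : ‖invCharFun μ x‖ ≤ ∫ ζ, ‖charFun μ ((-(2 * Real.pi)) • ζ)‖ :=
    VectorFourier.norm_fourierIntegral_le_integral_norm _ _ _ _ _
  rwa [Measure.integral_comp_smul volume (fun ζ => ‖charFun μ ζ‖), smul_eq_mul] at h1

/-- Fubini. The left side plays the role of the density of `μ ∗ ν` at the origin, written with the
inversion formula for `μ` only. -/
theorem integral_invCharFun_neg (μ ν : Measure F) [IsProbabilityMeasure ν]
    (hint : Integrable (charFun μ)) :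
    ∫ s, invCharFun μ (-s) ∂ν = invConst F * ∫ ζ, charFun μ ζ * charFun ν ζ := by
  have hne : (-(2 * Real.pi)) ≠ 0 := by simp [Real.pi_ne_zero]
  have hint' : Integrable fun ζ => charFun μ ((-(2 * Real.pi)) • ζ) := hint.comp_smul hne
  have h1 : ∀ s, invCharFun μ (-s) = ∫ ζ, exp (⟪s, (-(2 * Real.pi)) • ζ⟫ * I)
      * charFun μ ((-(2 * Real.pi)) • ζ) := by
    intro s
    rw [invCharFun, Real.fourierInv_eq']
    refine integral_congr_ae (ae_of_all _ fun ζ => ?_)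
    simp only [smul_eq_mul, inner_neg_right, inner_smul_right, real_inner_comm]
    push_cast
    ring_nf
  simp_rw [h1]
  rw [integral_integral_swap]
  · have h2 : ∀ ζ : F, ∫ s, exp (⟪s, (-(2 * Real.pi)) • ζ⟫ * I)
        * charFun μ ((-(2 * Real.pi)) • ζ) ∂ν
        = charFun μ ((-(2 * Real.pi)) • ζ) * charFun ν ((-(2 * Real.pi)) • ζ) := by
      intro ζ
      rw [integral_mul_const, mul_comm, charFun_apply (μ := ν)]
    simp_rw [h2]
    rw [Measure.integral_comp_smul volume (fun ζ => charFun μ ζ * charFun ν ζ), invConst,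
      Complex.real_smul]
  · refine Integrable.mono' (g := fun p : F × F => ‖charFun μ ((-(2 * Real.pi)) • p.2)‖)
      (hint'.norm.comp_snd ν) ?_ (ae_of_all _ fun p => ?_)
    · refine AEStronglyMeasurable.mul (Continuous.aestronglyMeasurable ?_)
        hint'.aestronglyMeasurable.comp_snd
      fun_prop
    · simp only [Function.uncurry, norm_mul]
      rw [Complex.norm_exp_ofReal_mul_I, one_mul]

theorem density_le {h : F → ℝ≥0∞} (hm : Measurable h) {μ : Measure F}
    [IsProbabilityMeasure μ] (hμ : μ = volume.withDensity h) (hint : Integrable (charFun μ)) :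
    ∀ᵐ x, h x ≤ ENNReal.ofReal (invConst F * ∫ ζ, ‖charFun μ ζ‖) := by
  filter_upwards [density_ae_eq_invCharFun hm hμ hint] with x hx
  rw [hx, ← ofReal_norm]
  exact ENNReal.ofReal_le_ofReal (norm_invCharFun_le μ x)

/-- The right side is the density at the origin of the convolution `μ ∗ ν`. Absolute continuity of
`ν` is what lets the inversion formula, valid only almost everywhere, be used under `ν`. -/
theorem le_lintegral_density_neg {h : F → ℝ≥0∞} (hm : Measurable h) {μ : Measure F}
    [IsProbabilityMeasure μ] (hμ : μ = volume.withDensity h) (hint : Integrable (charFun μ))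
    (ν : Measure F) [IsProbabilityMeasure ν] (hν : ν ≪ volume) :
    ENNReal.ofReal (invConst F * ‖∫ ζ, charFun μ ζ * charFun ν ζ‖) ≤ ∫⁻ s, h (-s) ∂ν := by
  have h1 : ∀ᵐ s ∂ν, h (-s) = ‖invCharFun μ (-s)‖ₑ :=
    hν.ae_le ((Measure.measurePreserving_neg (volume : Measure F)).quasiMeasurePreserving.ae
      (density_ae_eq_invCharFun hm hμ hint))
  rw [lintegral_congr_ae h1]
  refine le_trans (le_of_eq ?_) (enorm_integral_le_lintegral_enorm _)
  rw [integral_invCharFun_neg μ ν hint, ← ofReal_norm, norm_mul, Complex.norm_real,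
    Real.norm_of_nonneg (invConst_pos F).le]

/-- The Riemann-Lebesgue lemma, after rescaling the frequency by `-(2π)⁻¹`. -/
theorem tendsto_charFun_cocompact {h : F → ℝ≥0∞} (hm : Measurable h) {μ : Measure F}
    [IsProbabilityMeasure μ] (hμ : μ = volume.withDensity h) :
    Tendsto (charFun μ) (cocompact F) (nhds 0) := by
  have hfin : ∫⁻ x, h x ≠ ∞ := by
    have : μ Set.univ = ∫⁻ x, h x := by rw [hμ, withDensity_apply _ .univ, setLIntegral_univ]
    rw [← this]; exact measure_ne_top _ _
  have hlt : ∀ᵐ x, h x < ∞ := ae_lt_top hm hfin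
  have h1 := tendsto_integral_exp_inner_smul_cocompact (V := F) (fun x => ((h x).toReal : ℂ))
  have h2 : charFun μ = (fun w : F => ∫ v, 𝐞 (-⟪v, w⟫) • ((h v).toReal : ℂ))
      ∘ fun ζ => (-(2 * Real.pi)⁻¹) • ζ := by
    funext ζ
    rw [charFun_apply, hμ, integral_withDensity_eq_integral_toReal_smul hm hlt]
    refine integral_congr_ae (ae_of_all _ fun x => ?_)
    simp only [Circle.smul_def, Real.fourierChar_apply, smul_eq_mul, Complex.real_smul,
      inner_smul_right]
    rw [mul_comm]
    congr 3
    push_cast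
    have : (Real.pi : ℂ) ≠ 0 := by exact_mod_cast Real.pi_ne_zero
    field_simp
  rw [h2]
  refine h1.comp ?_
  exact (Homeomorph.smulOfNeZero (-(2 * Real.pi)⁻¹ : ℝ)
    (by simp [Real.pi_ne_zero])).toCocompactMap.cocompact_tendsto'

end FourierDensity

/-! ### Decay of characteristic functions and local limit estimates -/

section LocalLimit

open scoped RealInnerProductSpace Topology
open Complex (exp I)

variable {F : Type*} [NormedAddCommGroup F] [InnerProductSpace ℝ F] [FiniteDimensional ℝ F]
  [MeasurableSpace F] [BorelSpace F]

/-- The symmetrization of a law. -/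
noncomputable def symmetrized (ν : Measure F) : Measure F := ν.conv (ν.map ((-1 : ℝ) • ·))

instance (ν : Measure F) [IsProbabilityMeasure ν] : IsProbabilityMeasure (symmetrized ν) := by
  have : IsProbabilityMeasure (ν.map ((-1 : ℝ) • ·)) :=
    Measure.isProbabilityMeasure_map (by fun_prop)
  unfold symmetrized; infer_instance

theorem charFun_symmetrized (ν : Measure F) [IsFiniteMeasure ν] (ζ : F) :
    charFun (symmetrized ν) ζ = ((‖charFun ν ζ‖ ^ 2 : ℝ) : ℂ) := by
  rw [symmetrized, charFun_conv, charFun_map_smul, neg_one_smul, charFun_neg, Complex.mul_conj,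
    Complex.normSq_eq_norm_sq]

theorem norm_charFun_sq (ν : Measure F) [IsProbabilityMeasure ν] (ζ : F) :
    ‖charFun ν ζ‖ ^ 2 = ∫ z, Real.cos ⟪z, ζ⟫ ∂symmetrized ν := by
  have h := congrArg Complex.re (charFun_symmetrized ν ζ)
  rw [Complex.ofReal_re, charFun_apply] at h
  rw [← h]
  have hi : Integrable (fun z => exp (⟪z, ζ⟫ * I)) (symmetrized ν) :=
    Integrable.mono' (integrable_const (1 : ℝ)) (by fun_prop) (ae_of_all _ fun z => by
      rw [Complex.norm_exp_ofReal_mul_I])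
  have := integral_re hi
  simp only [RCLike.re_eq_complex_re] at this
  rw [← this]
  refine integral_congr_ae (ae_of_all _ fun z => ?_)
  simp only [Complex.exp_ofReal_mul_I_re]

/-- `‖φ‖²` is the characteristic function of the symmetrized law, hence an average of cosines, and
`1 - cos 2x = 2 (1 - cos x)(1 + cos x) ≤ 4 (1 - cos x)`. -/
theorem one_sub_norm_charFun_sq_two_smul (ν : Measure F) [IsProbabilityMeasure ν] (ζ : F) :
    1 - ‖charFun ν ((2 : ℝ) • ζ)‖ ^ 2 ≤ 4 * (1 - ‖charFun ν ζ‖ ^ 2) := by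
  have hi : ∀ ξ : F, Integrable (fun z => Real.cos ⟪z, ξ⟫) (symmetrized ν) := fun ξ =>
    Integrable.mono' (integrable_const (1 : ℝ)) (by fun_prop) (ae_of_all _ fun z => by
      simpa using Real.abs_cos_le_one _)
  have h1 : ∀ ξ : F, 1 - ‖charFun ν ξ‖ ^ 2 = ∫ z, (1 - Real.cos ⟪z, ξ⟫) ∂symmetrized ν := by
    intro ξ
    rw [integral_sub (integrable_const _) (hi ξ), norm_charFun_sq]
    simp
  rw [h1, h1, ← integral_const_mul]
  refine integral_mono ((integrable_const _).sub (hi _))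
    (((integrable_const _).sub (hi _)).const_mul _) fun z => ?_
  simp only [inner_smul_right, Real.cos_two_mul]
  nlinarith [Real.cos_le_one ⟪z, ζ⟫, Real.neg_one_le_cos ⟪z, ζ⟫,
    sq_nonneg (1 - Real.cos ⟪z, ζ⟫)]

theorem one_sub_norm_charFun_sq_two_pow_smul (ν : Measure F) [IsProbabilityMeasure ν] (ζ : F)
    (n : ℕ) : 1 - ‖charFun ν ((2 : ℝ) ^ n • ζ)‖ ^ 2 ≤ 4 ^ n * (1 - ‖charFun ν ζ‖ ^ 2) := by
  induction n with
  | zero => simp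
  | succ n ih =>
    have h := one_sub_norm_charFun_sq_two_smul ν ((2 : ℝ) ^ n • ζ)
    rw [smul_smul, ← pow_succ'] at h
    calc _ ≤ 4 * (1 - ‖charFun ν ((2 : ℝ) ^ n • ζ)‖ ^ 2) := h
      _ ≤ 4 * (4 ^ n * (1 - ‖charFun ν ζ‖ ^ 2)) := by gcongr
      _ = _ := by ring

/-- By the doubling inequality, modulus `1` at `ζ` would persist at all `2^n ζ`, against the decay
at infinity. -/
theorem norm_charFun_lt_one (ν : Measure F) [IsProbabilityMeasure ν]
    (h0 : Tendsto (charFun ν) (cocompact F) (𝓝 0)) {ζ : F} (hζ : ζ ≠ 0) : ‖charFun ν ζ‖ < 1 := by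
  refine lt_of_le_of_ne (norm_charFun_le_one ζ) fun h1 => ?_
  have h2 : ∀ n : ℕ, 1 ≤ ‖charFun ν ((2 : ℝ) ^ n • ζ)‖ ^ 2 := fun n => by
    have := one_sub_norm_charFun_sq_two_pow_smul ν ζ n
    rw [h1] at this
    linarith [this]
  have h3 : Tendsto (fun n : ℕ => (2 : ℝ) ^ n • ζ) atTop (cocompact F) := by
    rw [← Metric.cobounded_eq_cocompact, ← tendsto_norm_atTop_iff_cobounded]
    simp_rw [norm_smul, norm_pow, Real.norm_ofNat]
    exact (tendsto_pow_atTop_atTop_of_one_lt (by norm_num)).atTop_mul_const (norm_pos_iff.2 hζ)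
  have h4 := ((h0.comp h3).norm.pow 2)
  have := ge_of_tendsto' h4 h2
  norm_num at this

/-- Uniform decay of the characteristic function away from the origin and quadratic decay near the
origin. -/
theorem exists_charFun_decay (ν : Measure F) [IsProbabilityMeasure ν]
    (h0 : Tendsto (charFun ν) (cocompact F) (𝓝 0)) :
    ∃ θ c : ℝ, 0 < θ ∧ θ < 1 ∧ 0 < c ∧ (∀ ζ, 1 ≤ ‖ζ‖ → ‖charFun ν ζ‖ ≤ θ) ∧
      ∀ ζ, ‖ζ‖ ≤ 1 → ‖charFun ν ζ‖ ≤ Real.exp (-c * ‖ζ‖ ^ 2) := by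
  obtain ⟨θ, hθ0, hθ1, hθ⟩ : ∃ θ : ℝ, 0 < θ ∧ θ < 1 ∧ ∀ ζ, 1 ≤ ‖ζ‖ → ‖charFun ν ζ‖ ≤ θ := by
    have h1 : ∀ᶠ ζ in cocompact F, ‖charFun ν ζ‖ < 1 / 2 := by
      have := h0.norm
      rw [norm_zero] at this
      exact this.eventually_lt_const (by norm_num)
    obtain ⟨K, hK, hKc⟩ := mem_cocompact.1 h1
    have hK' : IsCompact (K ∩ {ζ | 1 ≤ ‖ζ‖}) :=
      hK.inter_right (isClosed_le continuous_const continuous_norm)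
    have hc : Continuous fun ζ => ‖charFun ν ζ‖ := continuous_charFun.norm
    rcases (K ∩ {ζ | 1 ≤ ‖ζ‖}).eq_empty_or_nonempty with he | hne
    · refine ⟨1 / 2, by norm_num, by norm_num, fun ζ hζ => ?_⟩
      have : ζ ∉ K := fun hk => by
        have : ζ ∈ K ∩ {ζ | 1 ≤ ‖ζ‖} := ⟨hk, hζ⟩
        rw [he] at this; exact this
      exact (show ‖charFun ν ζ‖ < 1 / 2 from hKc this).le
    · obtain ⟨ζ₀, hζ₀, hmax⟩ := hK'.exists_isMaxOn hne hc.continuousOn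
      have hζ₀0 : ζ₀ ≠ 0 := by
        rintro rfl
        have : (1 : ℝ) ≤ ‖(0 : F)‖ := hζ₀.2
        norm_num at this
      refine ⟨max (1 / 2) ‖charFun ν ζ₀‖, lt_max_of_lt_left (by norm_num),
        max_lt (by norm_num) (norm_charFun_lt_one ν h0 hζ₀0), fun ζ hζ => ?_⟩
      by_cases hk : ζ ∈ K
      · exact (hmax ⟨hk, hζ⟩ : ‖charFun ν ζ‖ ≤ ‖charFun ν ζ₀‖).trans (le_max_right _ _)
      · exact (show ‖charFun ν ζ‖ < 1 / 2 from hKc hk).le.trans (le_max_left _ _)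
  have hθ2 : 0 < 1 - θ ^ 2 := by nlinarith
  -- The doubling argument gives `(1 - θ²)/4` for `‖φ‖²`; half of it remains for `‖φ‖`.
  refine ⟨θ, (1 - θ ^ 2) / 8, hθ0, hθ1, by positivity, hθ, fun ζ hζ => ?_⟩
  have key : ‖charFun ν ζ‖ ^ 2 ≤ 1 - (1 - θ ^ 2) / 4 * ‖ζ‖ ^ 2 := by
    rcases eq_or_ne ζ 0 with rfl | hne
    · have := norm_charFun_le_one (μ := ν) (0 : F)
      simp only [norm_zero]
      nlinarith [norm_nonneg (charFun ν (0 : F))]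
    · have hpos : 0 < ‖ζ‖ := norm_pos_iff.2 hne
      -- With `2^n ≤ ‖ζ‖⁻¹ < 2^{n+1}`, doubling `n + 1` times brings `ζ` just outside the unit ball,
      -- where `θ` applies, and the loss `4^{n+1}` is at most `4 ‖ζ‖⁻²`. No moment of `ν` is
      -- involved.
      obtain ⟨n, hn1, hn2⟩ := exists_nat_pow_near ((one_le_inv₀ hpos).2 hζ)
        (by norm_num : (1 : ℝ) < 2)
      have h1 : 1 ≤ ‖(2 : ℝ) ^ (n + 1) • ζ‖ := by
        rw [norm_smul, norm_pow, Real.norm_ofNat]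
        have := (inv_lt_iff_one_lt_mul₀ hpos).1 hn2
        linarith
      have h2 := one_sub_norm_charFun_sq_two_pow_smul ν ζ (n + 1)
      have h3 := hθ _ h1
      have h4 : ‖charFun ν ((2 : ℝ) ^ (n + 1) • ζ)‖ ^ 2 ≤ θ ^ 2 := by gcongr
      have h5 : (4 : ℝ) ^ (n + 1) * ‖ζ‖ ^ 2 ≤ 4 := by
        have : (2 : ℝ) ^ n * ‖ζ‖ ≤ 1 := by
          have := mul_le_mul_of_nonneg_right hn1 hpos.le
          rwa [inv_mul_cancel₀ hpos.ne'] at this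
        have h6 : (4 : ℝ) ^ (n + 1) * ‖ζ‖ ^ 2 = 4 * ((2 : ℝ) ^ n * ‖ζ‖) ^ 2 := by
          rw [mul_pow, ← pow_mul, mul_comm n, pow_mul]; norm_num; ring
        rw [h6]
        have : ((2 : ℝ) ^ n * ‖ζ‖) ^ 2 ≤ 1 := pow_le_one₀ (by positivity) this
        linarith
      have h7 : 0 ≤ 1 - ‖charFun ν ζ‖ ^ 2 := by
        have := pow_le_one₀ (n := 2) (norm_nonneg _) (norm_charFun_le_one (μ := ν) ζ)
        linarith
      have h8 : (1 - θ ^ 2) * ‖ζ‖ ^ 2 ≤ 4 * (1 - ‖charFun ν ζ‖ ^ 2) := by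
        calc (1 - θ ^ 2) * ‖ζ‖ ^ 2 ≤ (4 ^ (n + 1) * (1 - ‖charFun ν ζ‖ ^ 2)) * ‖ζ‖ ^ 2 := by
              gcongr; linarith
          _ = (4 ^ (n + 1) * ‖ζ‖ ^ 2) * (1 - ‖charFun ν ζ‖ ^ 2) := by ring
          _ ≤ _ := by gcongr
      linarith
  have h9 : ‖charFun ν ζ‖ ^ 2 ≤ Real.exp (-((1 - θ ^ 2) / 8) * ‖ζ‖ ^ 2) ^ 2 := by
    refine key.trans ?_
    rw [← Real.exp_nat_mul]
    have := Real.add_one_le_exp (((2 : ℕ) : ℝ) * (-((1 - θ ^ 2) / 8) * ‖ζ‖ ^ 2))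
    refine le_trans (le_of_eq ?_) this
    push_cast; ring
  exact (pow_le_pow_iff_left₀ (norm_nonneg _) (Real.exp_pos _).le two_ne_zero).1 h9

/-- Pointwise convergence of rescaled powers of a characteristic function. -/
theorem tendsto_charFun_inv_sqrt_smul_pow {ν : Measure F} [IsProbabilityMeasure ν]
    (h2 : MemLp id 2 ν) (hmean : ∫ x, x ∂ν = 0) (ζ : F) :
    Tendsto (fun n : ℕ => charFun ν ((√(n : ℝ))⁻¹ • ζ) ^ n) atTop
      (𝓝 (exp (-((∫ x, ⟪x, ζ⟫ ^ 2 ∂ν : ℝ) : ℂ) / 2))) := by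
  set V := ∫ x, ⟪x, ζ⟫ ^ 2 ∂ν with hV
  have hL2 : MemLp (fun x => ⟪x, ζ⟫) 2 ν := h2.inner_const ζ
  have hV0 : 0 ≤ V := integral_nonneg fun x => sq_nonneg _
  -- In a direction of zero variance the normalization by `√V` is impossible, but there `φ` is
  -- identically `1` on the line through `ζ`.
  rcases hV0.eq_or_lt with h | hpos
  · have hz : ∀ᵐ x ∂ν, ⟪x, ζ⟫ = 0 := by
      have := (integral_eq_zero_iff_of_nonneg (fun x => sq_nonneg (⟪x, ζ⟫))
        hL2.integrable_sq).1 h.symm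
      filter_upwards [this] with x hx using by simpa using hx
    have h1 : ∀ r : ℝ, charFun ν (r • ζ) = 1 := by
      intro r
      rw [charFun_apply]
      have : (fun x => exp (⟪x, r • ζ⟫ * I)) =ᵐ[ν] fun _ => 1 := by
        filter_upwards [hz] with x hx
        simp [inner_smul_right, hx]
      rw [integral_congr_ae this]
      simp
    simp only [h1, one_pow, ← h]
    simp
  · set X : F → ℝ := fun x => ⟪x, ζ⟫ / √V with hX
    have hs : √V ≠ 0 := (Real.sqrt_pos.2 hpos).ne'
    have hXm : AEMeasurable X ν := by fun_prop
    have hint1 : Integrable (fun x : F => x) ν := h2.integrable (by norm_num)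
    have e0 : ν[X] = 0 := by
      rw [hX, integral_div]
      have : ∫ x, ⟪x, ζ⟫ ∂ν = 0 := by
        have := integral_inner (𝕜 := ℝ) hint1 ζ
        simp_rw [real_inner_comm ζ] at this ⊢
        rw [this, hmean, inner_zero_right]
      rw [this, zero_div]
    have e1 : ν[X ^ 2] = 1 := by
      have : ∀ x, (X ^ 2) x = ⟪x, ζ⟫ ^ 2 / V := fun x => by
        simp only [hX, Pi.pow_apply, div_pow, Real.sq_sqrt hV0]
      simp_rw [this]
      rw [integral_div, ← hV, div_self hpos.ne']
    have := tendsto_charFun_inv_sqrt_mul_pow hXm e0 e1 (√V)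
    have e2 : ∀ n : ℕ, charFun (ν.map X) ((√(n : ℝ))⁻¹ * √V) = charFun ν ((√(n : ℝ))⁻¹ • ζ) := by
      intro n
      rw [charFun_apply_real, charFun_apply, integral_map hXm (by fun_prop)]
      refine integral_congr_ae (ae_of_all _ fun x => ?_)
      simp only [hX, inner_smul_right]
      rw [← Complex.ofReal_mul]
      congr 3
      field_simp
    simp_rw [e2] at this
    convert this using 4
    rw [← Complex.ofReal_pow, Real.sq_sqrt hV0]

theorem integral_comp_inv_sqrt_smul {G : Type*} [NormedAddCommGroup G] [NormedSpace ℝ G]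
    (f : F → G) (n : ℕ) :
    ∫ ζ, f ((√(n : ℝ))⁻¹ • ζ) = √(n : ℝ) ^ Module.finrank ℝ F • ∫ ζ, f ζ := by
  rw [Measure.integral_comp_smul]
  congr 1
  rw [inv_pow, inv_inv, abs_of_nonneg (by positivity)]

/-- Local limit estimates for the powers of a characteristic function. -/
theorem exists_local_limit {ν : Measure F} [IsProbabilityMeasure ν]
    (h0 : Tendsto (charFun ν) (cocompact F) (𝓝 0))
    (h2 : MemLp id 2 ν) (hmean : ∫ x, x ∂ν = 0) {q : ℕ}
    (hq : Integrable fun ζ => ‖charFun ν ζ‖ ^ q) :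
    ∃ C c : ℝ, 0 < C ∧ 0 < c ∧ ∀ᶠ n : ℕ in atTop, Integrable (fun ζ => charFun ν ζ ^ n) ∧
      ∫ ζ, ‖charFun ν ζ‖ ^ n ≤ C / √(n : ℝ) ^ Module.finrank ℝ F ∧
      c / √(n : ℝ) ^ Module.finrank ℝ F ≤ ‖∫ ζ, charFun ν ζ ^ n‖ := by
  obtain ⟨θ, c, hθ0, hθ1, hc, hout, hin⟩ := exists_charFun_decay ν h0
  set D := Module.finrank ℝ F with hD
  set φ := charFun ν with hφ
  have hφc : Continuous φ := continuous_charFun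
  have hφ1 : ∀ ζ, ‖φ ζ‖ ≤ 1 := fun ζ => norm_charFun_le_one ζ
  have hgauss : Integrable fun ζ : F => Real.exp (-c * ‖ζ‖ ^ 2) := by
    have := (GaussianFourier.integrable_cexp_neg_mul_sq_norm_add (b := (c : ℂ)) (by simpa) 0
      (0 : F)).norm
    refine this.congr (ae_of_all _ fun ζ => ?_)
    simp only [zero_mul, add_zero]
    rw [Complex.norm_exp]
    norm_cast
  -- Contribution of the frequencies beyond `√n` after rescaling: `q` of the `n` factors ensure
  -- integrability, the others give a geometric decay that beats `√n ^ D`.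
  set r : ℕ → ℝ := fun n => θ ^ (n - q) * (√(n : ℝ) ^ D * ∫ ζ, ‖φ ζ‖ ^ q) with hr
  have hr0 : Tendsto r atTop (𝓝 0) := by
    have h1 := tendsto_pow_const_mul_const_pow_of_abs_lt_one D (r := θ)
      (by rw [abs_of_pos hθ0]; exact hθ1)
    have h3 := h1.mul_const ((θ ^ q)⁻¹ * ∫ ζ, ‖φ ζ‖ ^ q)
    rw [zero_mul] at h3
    refine squeeze_zero' (Eventually.of_forall fun n => ?_) ?_ h3
    · have : 0 ≤ ∫ ζ, ‖φ ζ‖ ^ q := integral_nonneg fun ζ => by positivity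
      positivity
    · filter_upwards [eventually_ge_atTop q, eventually_ge_atTop 1] with n hn hn1
      have h4 : 0 ≤ ∫ ζ, ‖φ ζ‖ ^ q := integral_nonneg fun ζ => by positivity
      have h5 : √(n : ℝ) ≤ n := by
        rw [Real.sqrt_le_left (by positivity)]
        have : (1 : ℝ) ≤ n := by exact_mod_cast hn1
        nlinarith
      have h6 : θ ^ (n - q) = θ ^ n * (θ ^ q)⁻¹ := pow_sub₀ θ hθ0.ne' hn
      simp only [hr]
      calc _ ≤ θ ^ (n - q) * ((n : ℝ) ^ D * ∫ ζ, ‖φ ζ‖ ^ q) := by gcongr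
        _ = _ := by rw [h6]; ring
  have hscale : ∀ n : ℕ, 1 ≤ n → Integrable fun ζ => ‖φ ((√(n : ℝ))⁻¹ • ζ)‖ ^ q := fun n hn =>
    hq.comp_smul (by
      have : (0 : ℝ) < √(n : ℝ) := Real.sqrt_pos.2 (by exact_mod_cast hn)
      positivity)
  -- the two regimes
  have hfar : ∀ n : ℕ, q ≤ n → 1 ≤ n → ∀ ζ : F, √(n : ℝ) < ‖ζ‖ →
      ‖φ ((√(n : ℝ))⁻¹ • ζ)‖ ^ n ≤ θ ^ (n - q) * ‖φ ((√(n : ℝ))⁻¹ • ζ)‖ ^ q := by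
    intro n hn hn1 ζ hζ
    have hs : 0 < √(n : ℝ) := Real.sqrt_pos.2 (by exact_mod_cast hn1)
    have h3 : 1 ≤ ‖(√(n : ℝ))⁻¹ • ζ‖ := by
      rw [norm_smul, norm_inv, Real.norm_of_nonneg hs.le, ← div_eq_inv_mul, le_div_iff₀ hs]
      linarith
    calc ‖φ ((√(n : ℝ))⁻¹ • ζ)‖ ^ n
        = ‖φ ((√(n : ℝ))⁻¹ • ζ)‖ ^ (n - q) * ‖φ ((√(n : ℝ))⁻¹ • ζ)‖ ^ q := by
          rw [← pow_add, Nat.sub_add_cancel hn]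
      _ ≤ _ := by gcongr; exact hout _ h3
  have hnear : ∀ n : ℕ, 1 ≤ n → ∀ ζ : F, ‖ζ‖ ≤ √(n : ℝ) →
      ‖φ ((√(n : ℝ))⁻¹ • ζ)‖ ^ n ≤ Real.exp (-c * ‖ζ‖ ^ 2) := by
    intro n hn1 ζ hζ
    have hs : 0 < √(n : ℝ) := Real.sqrt_pos.2 (by exact_mod_cast hn1)
    have e : ‖(√(n : ℝ))⁻¹ • ζ‖ = ‖ζ‖ / √(n : ℝ) := by
      rw [norm_smul, norm_inv, Real.norm_of_nonneg hs.le, ← div_eq_inv_mul]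
    have h3 : ‖(√(n : ℝ))⁻¹ • ζ‖ ≤ 1 := by
      rw [e, div_le_one hs]; exact hζ
    calc ‖φ ((√(n : ℝ))⁻¹ • ζ)‖ ^ n ≤ Real.exp (-c * ‖(√(n : ℝ))⁻¹ • ζ‖ ^ 2) ^ n := by
          gcongr; exact hin _ h3
      _ = _ := by
          rw [← Real.exp_nat_mul, e, div_pow, Real.sq_sqrt (by positivity)]
          congr 1
          have : (n : ℝ) ≠ 0 := by positivity
          field_simp
  have hbound : ∀ n : ℕ, q ≤ n → 1 ≤ n → ∀ ζ : F, ‖φ ((√(n : ℝ))⁻¹ • ζ)‖ ^ n ≤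
      Real.exp (-c * ‖ζ‖ ^ 2) + θ ^ (n - q) * ‖φ ((√(n : ℝ))⁻¹ • ζ)‖ ^ q := by
    intro n hn hn1 ζ
    rcases le_or_gt ‖ζ‖ (√(n : ℝ)) with h | h
    · exact (hnear n hn1 ζ h).trans (le_add_of_nonneg_right (by positivity))
    · exact (hfar n hn hn1 ζ h).trans (le_add_of_nonneg_left (Real.exp_pos _).le)
  have hint : ∀ n : ℕ, q ≤ n → Integrable fun ζ => φ ζ ^ n := by
    intro n hn
    refine hq.mono' (hφc.pow n).aestronglyMeasurable (ae_of_all _ fun ζ => ?_)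
    rw [norm_pow]
    exact pow_le_pow_of_le_one (norm_nonneg _) (hφ1 ζ) hn
  set Gs := ∫ ζ : F, Real.exp (-c * ‖ζ‖ ^ 2) with hGs
  have hGs0 : 0 ≤ Gs := integral_nonneg fun ζ => (Real.exp_pos _).le
  have hupper : ∀ n : ℕ, q ≤ n → 1 ≤ n → √(n : ℝ) ^ D * ∫ ζ, ‖φ ζ‖ ^ n ≤ Gs + r n := by
    intro n hn hn1
    rw [← smul_eq_mul, ← integral_comp_inv_sqrt_smul (fun ζ => ‖φ ζ‖ ^ n) n]
    have hi := (hscale n hn1).const_mul (θ ^ (n - q))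
    calc _ ≤ ∫ ζ : F, (Real.exp (-c * ‖ζ‖ ^ 2) + θ ^ (n - q) * ‖φ ((√(n : ℝ))⁻¹ • ζ)‖ ^ q) := by
          refine integral_mono_of_nonneg (ae_of_all _ fun ζ => by positivity) (hgauss.add hi)
            (ae_of_all _ fun ζ => hbound n hn hn1 ζ)
      _ = _ := by
          rw [integral_add hgauss hi, integral_const_mul,
            integral_comp_inv_sqrt_smul (fun ζ => ‖φ ζ‖ ^ q) n, smul_eq_mul]
  -- the limit
  set lim : F → ℂ := fun ζ => exp (-((∫ x, ⟪x, ζ⟫ ^ 2 ∂ν : ℝ) : ℂ) / 2) with hlim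
  set A : ℕ → F → ℂ := fun n => {ζ : F | ‖ζ‖ ≤ √(n : ℝ)}.indicator
    fun ζ => φ ((√(n : ℝ))⁻¹ • ζ) ^ n with hA
  set B : ℕ → F → ℂ := fun n => {ζ : F | ‖ζ‖ ≤ √(n : ℝ)}ᶜ.indicator
    fun ζ => φ ((√(n : ℝ))⁻¹ • ζ) ^ n with hB
  have hms : ∀ n : ℕ, MeasurableSet {ζ : F | ‖ζ‖ ≤ √(n : ℝ)} := fun n =>
    measurableSet_le measurable_norm measurable_const
  have hA1 : ∀ (n : ℕ) (ζ : F), ‖ζ‖ ≤ √(n : ℝ) → A n ζ = φ ((√(n : ℝ))⁻¹ • ζ) ^ n :=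
    fun n ζ h => Set.indicator_of_mem (s := {ζ : F | ‖ζ‖ ≤ √(n : ℝ)}) h _
  have hA2 : ∀ (n : ℕ) (ζ : F), ¬ ‖ζ‖ ≤ √(n : ℝ) → A n ζ = 0 :=
    fun n ζ h => Set.indicator_of_notMem (s := {ζ : F | ‖ζ‖ ≤ √(n : ℝ)}) h _
  have hB1 : ∀ (n : ℕ) (ζ : F), ¬ ‖ζ‖ ≤ √(n : ℝ) → B n ζ = φ ((√(n : ℝ))⁻¹ • ζ) ^ n :=
    fun n ζ h => Set.indicator_of_mem (s := {ζ : F | ‖ζ‖ ≤ √(n : ℝ)}ᶜ) h _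
  have hB2 : ∀ (n : ℕ) (ζ : F), ‖ζ‖ ≤ √(n : ℝ) → B n ζ = 0 :=
    fun n ζ h => Set.indicator_of_notMem (s := {ζ : F | ‖ζ‖ ≤ √(n : ℝ)}ᶜ) (by simpa using h) _
  have hAm : ∀ n, AEStronglyMeasurable (A n) := fun n =>
    (Continuous.aestronglyMeasurable (by fun_prop)).indicator (hms n)
  have hAb : ∀ n : ℕ, 1 ≤ n → ∀ ζ, ‖A n ζ‖ ≤ Real.exp (-c * ‖ζ‖ ^ 2) := by
    intro n hn ζ
    by_cases h : ‖ζ‖ ≤ √(n : ℝ)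
    · rw [hA1 n ζ h, norm_pow]
      exact hnear n hn ζ h
    · rw [hA2 n ζ h, norm_zero]
      exact (Real.exp_pos _).le
  have hAlim : ∀ ζ, Tendsto (fun n => A n ζ) atTop (𝓝 (lim ζ)) := by
    intro ζ
    refine (tendsto_charFun_inv_sqrt_smul_pow h2 hmean ζ).congr' ?_
    have : Tendsto (fun n : ℕ => √(n : ℝ)) atTop atTop :=
      Real.tendsto_sqrt_atTop.comp tendsto_natCast_atTop_atTop
    filter_upwards [this.eventually_ge_atTop ‖ζ‖] with n hn
    rw [hA1 n ζ hn]
  have hAint : Tendsto (fun n => ∫ ζ, A n ζ) atTop (𝓝 (∫ ζ, lim ζ)) := by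
    refine tendsto_integral_filter_of_dominated_convergence _ (Eventually.of_forall hAm) ?_ hgauss
      (ae_of_all _ hAlim)
    filter_upwards [eventually_ge_atTop 1] with n hn using ae_of_all _ (hAb n hn)
  have hBint : Tendsto (fun n => ∫ ζ, B n ζ) atTop (𝓝 0) := by
    refine squeeze_zero_norm' ?_ hr0
    filter_upwards [eventually_ge_atTop q, eventually_ge_atTop 1] with n hn hn1
    calc ‖∫ ζ, B n ζ‖ ≤ ∫ ζ, θ ^ (n - q) * ‖φ ((√(n : ℝ))⁻¹ • ζ)‖ ^ q := by
          refine norm_integral_le_of_norm_le ((hscale n hn1).const_mul _) (ae_of_all _ fun ζ => ?_)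
          by_cases h : ‖ζ‖ ≤ √(n : ℝ)
          · rw [hB2 n ζ h, norm_zero]; positivity
          · rw [hB1 n ζ h, norm_pow]
            exact hfar n hn hn1 ζ (not_le.1 h)
      _ = r n := by
          rw [integral_const_mul, integral_comp_inv_sqrt_smul (fun ζ => ‖φ ζ‖ ^ q) n, smul_eq_mul]
  have hsum : ∀ᶠ n : ℕ in atTop, (∫ ζ, A n ζ) + ∫ ζ, B n ζ = (√(n : ℝ) ^ D : ℝ) • ∫ ζ, φ ζ ^ n := by
    filter_upwards [eventually_ge_atTop q, eventually_ge_atTop 1] with n hn hn1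
    have hi : Integrable fun ζ => φ ((√(n : ℝ))⁻¹ • ζ) ^ n :=
      (hint n hn).comp_smul (by
        have : (0 : ℝ) < √(n : ℝ) := Real.sqrt_pos.2 (by exact_mod_cast hn1)
        positivity)
    rw [← integral_comp_inv_sqrt_smul (fun ζ => φ ζ ^ n) n,
      ← integral_add (hi.indicator (hms n)) (hi.indicator (hms n).compl)]
    refine integral_congr_ae (ae_of_all _ fun ζ => ?_)
    exact congrFun (Set.indicator_self_add_compl _ _) ζ
  have hlimre : ∀ ζ, lim ζ = ((Real.exp (-(∫ x, ⟪x, ζ⟫ ^ 2 ∂ν) / 2) : ℝ) : ℂ) := fun ζ => by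
    simp only [hlim]; push_cast; rfl
  -- The limit inherits the Gaussian majorant of its approximants, so nondegeneracy of the
  -- covariance need not be checked.
  have hlimi : Integrable lim := by
    refine hgauss.mono' (aestronglyMeasurable_of_tendsto_ae atTop hAm (ae_of_all _ hAlim))
      (ae_of_all _ fun ζ => ?_)
    refine le_of_tendsto (hAlim ζ).norm ?_
    filter_upwards [eventually_ge_atTop 1] with n hn using hAb n hn ζ
  have hlimpos : 0 < ‖∫ ζ, lim ζ‖ := by
    have e : ∫ ζ, lim ζ = ((∫ ζ, Real.exp (-(∫ x, ⟪x, ζ⟫ ^ 2 ∂ν) / 2) : ℝ) : ℂ) := by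
      rw [← integral_complex_ofReal]
      exact integral_congr_ae (ae_of_all _ hlimre)
    have hi : Integrable fun ζ : F => Real.exp (-(∫ x, ⟪x, ζ⟫ ^ 2 ∂ν) / 2) := by
      have := hlimi.re
      refine this.congr (ae_of_all _ fun ζ => ?_)
      simp only [hlimre, RCLike.re_eq_complex_re, Complex.ofReal_re]
    rw [e, Complex.norm_real, norm_pos_iff]
    refine ne_of_gt ((integral_pos_iff_support_of_nonneg (fun ζ => (Real.exp_pos _).le) hi).2 ?_)
    have : (Function.support fun ζ : F => Real.exp (-(∫ x, ⟪x, ζ⟫ ^ 2 ∂ν) / 2)) = Set.univ := by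
      ext ζ; simp [Real.exp_ne_zero]
    rw [this]
    exact isOpen_univ.measure_pos volume Set.univ_nonempty
  refine ⟨Gs + 1, ‖∫ ζ, lim ζ‖ / 2, by linarith, by linarith, ?_⟩
  have hfinal := ((hAint.add hBint).congr' hsum).norm
  rw [add_zero] at hfinal
  filter_upwards [eventually_ge_atTop q, eventually_ge_atTop 1,
    hr0.eventually_le_const (show (0 : ℝ) < 1 by norm_num),
    hfinal.eventually_const_le (show ‖∫ ζ, lim ζ‖ / 2 < ‖∫ ζ, lim ζ‖ by linarith)]
    with n hn hn1 hrn hlow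
  have hs : 0 < √(n : ℝ) ^ D := pow_pos (Real.sqrt_pos.2 (by exact_mod_cast hn1)) _
  refine ⟨hint n hn, ?_, ?_⟩
  · rw [le_div_iff₀' hs]
    exact (hupper n hn hn1).trans (by linarith)
  · rw [div_le_iff₀' hs]
    rwa [norm_smul, Real.norm_of_nonneg hs.le] at hlow

end LocalLimit

/-! ### Integrability of a power of the characteristic function -/

section CharFunIntegrable

open scoped RealInnerProductSpace Topology
open Complex (exp I)

variable {F : Type*} [NormedAddCommGroup F] [InnerProductSpace ℝ F] [FiniteDimensional ℝ F]
  [MeasurableSpace F] [BorelSpace F]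

/-- Gaussian regularization of the integral of a characteristic function. -/
theorem integral_gaussian_mul_charFun (κ : Measure F) [IsFiniteMeasure κ] {ε : ℝ} (hε : 0 < ε) :
    ∫ ζ, (Real.exp (-(ε ^ 2 / 2) * ‖ζ‖ ^ 2) : ℂ) * charFun κ ζ =
      ((2 * Real.pi / ε ^ 2) ^ (Module.finrank ℝ F / 2 : ℝ) *
        ∫ x, Real.exp (-(1 / (2 * ε ^ 2)) * ‖x‖ ^ 2) ∂κ : ℝ) := by
  have hb : 0 < ((ε ^ 2 / 2 : ℝ) : ℂ).re := by rw [Complex.ofReal_re]; positivity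
  have h1 : ∀ ζ, (Real.exp (-(ε ^ 2 / 2) * ‖ζ‖ ^ 2) : ℂ) * charFun κ ζ
      = ∫ x, exp (-((ε ^ 2 / 2 : ℝ) : ℂ) * ‖ζ‖ ^ 2 + I * ⟪x, ζ⟫) ∂κ := by
    intro ζ
    rw [charFun_apply, ← integral_const_mul]
    refine integral_congr_ae (ae_of_all _ fun x => ?_)
    simp only
    rw [Complex.exp_add, mul_comm I]
    push_cast
    rfl
  simp_rw [h1]
  rw [integral_integral_swap]
  · have h2 : ∀ x : F, ∫ ζ, exp (-((ε ^ 2 / 2 : ℝ) : ℂ) * ‖ζ‖ ^ 2 + I * ⟪x, ζ⟫)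
        = (((2 * Real.pi / ε ^ 2) ^ (Module.finrank ℝ F / 2 : ℝ) *
          Real.exp (-(1 / (2 * ε ^ 2)) * ‖x‖ ^ 2) : ℝ) : ℂ) := by
      intro x
      rw [GaussianFourier.integral_cexp_neg_mul_sq_norm_add hb]
      push_cast
      congr 1
      · have : (2 * Real.pi / ε ^ 2 : ℝ) = Real.pi / (ε ^ 2 / 2) := by field_simp
        rw [Complex.ofReal_cpow (by positivity), this]
        push_cast
        rfl
      · congr 1
        rw [Complex.I_sq]
        have : (ε : ℂ) ≠ 0 := by exact_mod_cast hε.ne'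
        field_simp
        ring
    simp_rw [h2]
    rw [integral_complex_ofReal, integral_const_mul]
  · have hg : Integrable fun ζ : F => Real.exp (-(ε ^ 2 / 2) * ‖ζ‖ ^ 2) := by
      have := (GaussianFourier.integrable_cexp_neg_mul_sq_norm_add hb 0 (0 : F)).norm
      refine this.congr (ae_of_all _ fun ζ => ?_)
      simp only [zero_mul, add_zero]
      rw [Complex.norm_exp]
      norm_cast
    refine Integrable.mono' (g := fun p : F × F => Real.exp (-(ε ^ 2 / 2) * ‖p.1‖ ^ 2))
      (hg.comp_fst κ) (Continuous.aestronglyMeasurable (by fun_prop)) (ae_of_all _ fun p => ?_)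
    simp only [Function.uncurry]
    rw [Complex.exp_add, norm_mul, mul_comm I, Complex.norm_exp_ofReal_mul_I, mul_one,
      Complex.norm_exp]
    norm_cast

section Trunc

variable {E : Type*}

/-- Truncation of a density at height `T`. -/
noncomputable def truncDensity (ρ : E → ℝ≥0∞) (T : ℝ≥0) : E → ℝ≥0∞ :=
  {v | ρ v ≤ T}.indicator ρ

theorem measurable_truncDensity [MeasurableSpace E] {ρ : E → ℝ≥0∞} (hρ : Measurable ρ) (T : ℝ≥0) :
    Measurable (truncDensity ρ T) :=
  hρ.indicator (measurableSet_le hρ measurable_const)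

theorem truncDensity_le (ρ : E → ℝ≥0∞) (T : ℝ≥0) (v : E) : truncDensity ρ T v ≤ T := by
  by_cases h : ρ v ≤ T <;> simp [truncDensity, h]

theorem truncDensity_le_self (ρ : E → ℝ≥0∞) (T : ℝ≥0) (v : E) : truncDensity ρ T v ≤ ρ v :=
  Set.indicator_le_self _ _ _

end Trunc

variable {E : Type*} [MeasureSpace E]

/-- The sum of two copies of the statistic `X` has locally bounded density at all scales, up to
linear growth. -/
def SmallBall (X : E → F) (C : ℝ≥0∞) : Prop :=
  ∀ (c : F) (ε : ℝ), 0 < ε → ε ≤ 1 →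
    ∫⁻ v, ∫⁻ w, ENNReal.ofReal (Real.exp (-(1 / (2 * ε ^ 2)) * ‖X v + X w - c‖ ^ 2))
      ≤ C * (1 + ‖c‖ₑ) * ENNReal.ofReal (ε ^ Module.finrank ℝ F)

/-- Truncating the density changes the characteristic function by at most the mass cut off. -/
theorem enorm_charFun_sub_charFun_trunc_le {X : E → F} (hX : Measurable X)
    {ρ : E → ℝ≥0∞} (hρ : Measurable ρ) (hρ1 : ∫⁻ v, ρ v = 1) {p : ℝ} (hp : 1 < p) {T : ℝ≥0}
    {a : ℝ≥0∞} (ha : a ≠ ∞) (hI : ∫⁻ v, ρ v ^ p ≤ a)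
    {b : ℝ≥0∞} (hT : a * b ≤ (T : ℝ≥0∞) ^ (p - 1)) (ha0 : a ≠ 0) (ζ : F) :
    ‖charFun ((volume.withDensity ρ).map X) ζ -
      charFun ((volume.withDensity (truncDensity ρ T)).map X) ζ‖ₑ ≤ b⁻¹ := by
  set S : Set E := {v | ρ v ≤ T} with hS
  have hSm : MeasurableSet S := measurableSet_le hρ measurable_const
  -- Where `ρ > T` one has `T^{p-1} ρ ≤ ρ^p`, so the mass cut off is at most `a / T^{p-1} ≤ b⁻¹`.
  set tail : E → ℝ≥0∞ := Sᶜ.indicator ρ with htail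
  have htm : Measurable tail := hρ.indicator hSm.compl
  have hsum : ρ = truncDensity ρ T + tail := by
    rw [htail, truncDensity, ← hS, Set.indicator_self_add_compl]
  have hmass : (∫⁻ v, tail v) ≤ b⁻¹ := by
    have h1 : (T : ℝ≥0∞) ^ (p - 1) * ∫⁻ v, tail v ≤ a := by
      rw [← lintegral_const_mul _ htm]
      refine le_trans (lintegral_mono fun v => ?_) hI
      by_cases hv : v ∈ S
      · simp [htail, hv]
      · have h2 : (T : ℝ≥0∞) ≤ ρ v := (not_le.1 hv).le
        simp only [htail, Set.indicator_of_mem (Set.mem_compl hv)]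
        calc (T : ℝ≥0∞) ^ (p - 1) * ρ v ≤ ρ v ^ (p - 1) * ρ v ^ (1 : ℝ) := by
              rw [ENNReal.rpow_one]
              gcongr
          _ = ρ v ^ p := by
              rw [← ENNReal.rpow_add_of_nonneg _ _ (by linarith) zero_le_one]
              congr 1; ring
    have h2 : a * (b * ∫⁻ v, tail v) ≤ a * 1 := by
      rw [← mul_assoc, mul_one]
      exact le_trans (by gcongr) h1
    have h3 : b * ∫⁻ v, tail v ≤ 1 := (ENNReal.mul_le_mul_iff_right ha0 ha).1 h2
    rw [← one_div, ENNReal.le_div_iff_mul_le]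
    · rwa [mul_comm]
    · refine Or.inr (by simp)
    · refine Or.inr (by simp)
  have hfin : IsFiniteMeasure (volume.withDensity ρ : Measure E) :=
    isFiniteMeasure_withDensity (by simp [hρ1])
  have hfin1 : IsFiniteMeasure (volume.withDensity (truncDensity ρ T) : Measure E) :=
    isFiniteMeasure_of_le _ (withDensity_mono (ae_of_all _ (truncDensity_le_self ρ T)))
  have hfin2 : IsFiniteMeasure (volume.withDensity tail : Measure E) :=
    isFiniteMeasure_of_le _ (withDensity_mono (ae_of_all _ fun v => Set.indicator_le_self _ _ _))
  have hsplit : (volume.withDensity ρ).map X =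
      (volume.withDensity (truncDensity ρ T)).map X + (volume.withDensity tail).map X := by
    rw [← Measure.map_add _ _ hX, ← withDensity_add_left (measurable_truncDensity hρ T), ← hsum]
  have hint : ∀ κ : Measure F, IsFiniteMeasure κ → Integrable (fun x => exp (⟪x, ζ⟫ * I)) κ :=
    fun κ _ => Integrable.mono' (integrable_const (1 : ℝ)) (by fun_prop) (ae_of_all _ fun z => by
      rw [Complex.norm_exp_ofReal_mul_I])
  have hφ : charFun ((volume.withDensity ρ).map X) ζ -
      charFun ((volume.withDensity (truncDensity ρ T)).map X) ζ =
      charFun ((volume.withDensity tail).map X) ζ := by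
    rw [hsplit, charFun_apply, charFun_apply, charFun_apply, integral_add_measure, add_sub_cancel_left]
    · exact hint _ (Measure.isFiniteMeasure_map _ _)
    · exact hint _ (Measure.isFiniteMeasure_map _ _)
  rw [hφ]
  refine le_trans ?_ hmass
  rw [charFun_apply]
  refine (enorm_integral_le_lintegral_enorm _).trans (le_of_eq ?_)
  have h1 : ∀ x : F, ‖exp (⟪x, ζ⟫ * I)‖ₑ = 1 := fun x => by
    rw [← ofReal_norm, Complex.norm_exp_ofReal_mul_I, ENNReal.ofReal_one]
  simp_rw [h1]
  rw [lintegral_one, Measure.map_apply hX .univ, Set.preimage_univ, withDensity_apply _ .univ,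
    setLIntegral_univ]

variable [SFinite (volume : Measure E)]

/-- Fourth power integrability of the characteristic function for truncated densities. -/
theorem exists_lintegral_charFun_trunc_le {X : E → F} (hX : Measurable X) {C : ℝ≥0∞} (hC : C ≠ ∞)
    (hA : SmallBall X C) {ρ : E → ℝ≥0∞} (hρ : Measurable ρ) (hρ1 : ∫⁻ v, ρ v = 1)
    (hB : ∫⁻ v, ‖X v‖ₑ ∂(volume.withDensity ρ) ≠ ∞) :
    ∃ C' : ℝ≥0∞, C' ≠ ∞ ∧ ∀ T : ℝ≥0,
      ∫⁻ ζ, ‖charFun ((volume.withDensity (truncDensity ρ T)).map X) ζ‖ₑ ^ 4 ≤ C' * T ^ 2 := by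
  set B := ∫⁻ v, ‖X v‖ₑ ∂(volume.withDensity ρ) with hBdef
  set D := Module.finrank ℝ F with hD
  refine ⟨ENNReal.ofReal ((2 * Real.pi) ^ (D / 2 : ℝ)) * (C * (1 + 2 * B)),
    ENNReal.mul_ne_top ENNReal.ofReal_ne_top (ENNReal.mul_ne_top hC
      (ENNReal.add_ne_top.2 ⟨by simp, ENNReal.mul_ne_top (by simp) hB⟩)), fun T => ?_⟩
  set τ := volume.withDensity (truncDensity ρ T) with hτ
  have hτm := measurable_truncDensity hρ T
  have hτle : τ ≤ volume.withDensity ρ :=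
    withDensity_mono (ae_of_all _ (truncDensity_le_self ρ T))
  have hprob : (volume.withDensity ρ : Measure E) Set.univ = 1 := by
    rw [withDensity_apply _ .univ, setLIntegral_univ, hρ1]
  have hτ1 : τ Set.univ ≤ 1 := (hτle _).trans hprob.le
  have hτfin : IsFiniteMeasure τ := ⟨hτ1.trans_lt (by simp)⟩
  have hτB : ∫⁻ v, ‖X v‖ₑ ∂τ ≤ B := lintegral_mono' hτle le_rfl
  have hτT : ∀ g : E → ℝ≥0∞, Measurable g → ∫⁻ v, g v ∂τ ≤ T * ∫⁻ v, g v := by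
    intro g hg
    rw [hτ, lintegral_withDensity_eq_lintegral_mul _ hτm hg, ← lintegral_const_mul _ hg]
    exact lintegral_mono fun v => mul_le_mul_left (truncDensity_le ρ T v) _
  set ν := τ.map X with hν
  have : IsFiniteMeasure ν := Measure.isFiniteMeasure_map _ _
  -- `‖φ‖⁴` is the characteristic function of `X₁ + X₂ - X₃ - X₄`. The small ball hypothesis applies
  -- to `X₁ + X₂` with centre `X₃ + X₄`; the first moment `B` controls the growth in the centre, and
  -- the two integrations against `τ` cost a factor `T` each.
  set μ := ν.conv ν with hμ
  have : IsFiniteMeasure μ := by rw [hμ]; infer_instance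
  have : IsFiniteMeasure (symmetrized μ) := by
    have : IsFiniteMeasure (μ.map ((-1 : ℝ) • ·)) := Measure.isFiniteMeasure_map _ _
    unfold symmetrized; infer_instance
  have hφ : ∀ ζ, charFun (symmetrized μ) ζ = ((‖charFun ν ζ‖ ^ 4 : ℝ) : ℂ) := by
    intro ζ
    rw [charFun_symmetrized, hμ, charFun_conv, norm_mul]
    congr 1; ring
  have hμint : ∀ g : F → ℝ≥0∞, Measurable g →
      ∫⁻ y, g y ∂μ = ∫⁻ v, ∫⁻ w, g (X v + X w) ∂τ ∂τ := by
    intro g hg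
    have hgm : Measurable fun p : F × F => g (p.1 + p.2) := hg.comp (by fun_prop)
    rw [hμ, Measure.lintegral_conv hg, hν, lintegral_map (Measurable.lintegral_prod_right' hgm) hX]
    refine lintegral_congr fun v => ?_
    exact lintegral_map (f := fun y => g (X v + y)) (hg.comp (measurable_const_add _)) hX
  have key : ∀ ε : ℝ, 0 < ε → ε ≤ 1 →
      ∫⁻ x, ENNReal.ofReal (Real.exp (-(1 / (2 * ε ^ 2)) * ‖x‖ ^ 2)) ∂symmetrized μ
        ≤ T ^ 2 * (C * (1 + 2 * B)) * ENNReal.ofReal (ε ^ D) := by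
    intro ε hε hε1
    have hgm : Measurable fun x : F => ENNReal.ofReal (Real.exp (-(1 / (2 * ε ^ 2)) * ‖x‖ ^ 2)) := by
      fun_prop
    have hgm' : Measurable fun p : F × F =>
        ENNReal.ofReal (Real.exp (-(1 / (2 * ε ^ 2)) * ‖p.1 + p.2‖ ^ 2)) := by fun_prop
    rw [symmetrized, Measure.lintegral_conv hgm, lintegral_lintegral_swap hgm'.aemeasurable,
      lintegral_map (Measurable.lintegral_prod_left' hgm') (by fun_prop)]
    have inner : ∀ y : F, ∫⁻ x, ENNReal.ofReal (Real.exp (-(1 / (2 * ε ^ 2)) *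
        ‖x + (-1 : ℝ) • y‖ ^ 2)) ∂μ ≤ T ^ 2 * C * ENNReal.ofReal (ε ^ D) * (1 + ‖y‖ₑ) := by
      intro y
      rw [hμint (fun x => ENNReal.ofReal (Real.exp (-(1 / (2 * ε ^ 2)) *
        ‖x + (-1 : ℝ) • y‖ ^ 2))) (by fun_prop)]
      have hm2 : Measurable fun p : E × E => ENNReal.ofReal (Real.exp (-(1 / (2 * ε ^ 2)) *
          ‖X p.1 + X p.2 + (-1 : ℝ) • y‖ ^ 2)) := by fun_prop
      have hm3 : Measurable fun v => ∫⁻ w, ENNReal.ofReal (Real.exp (-(1 / (2 * ε ^ 2)) *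
          ‖X v + X w + (-1 : ℝ) • y‖ ^ 2)) := Measurable.lintegral_prod_right' hm2
      calc _ ≤ ∫⁻ v, T * ∫⁻ w, ENNReal.ofReal (Real.exp (-(1 / (2 * ε ^ 2)) *
            ‖X v + X w + (-1 : ℝ) • y‖ ^ 2)) ∂volume ∂τ :=
            lintegral_mono fun v => hτT (fun w => ENNReal.ofReal (Real.exp (-(1 / (2 * ε ^ 2)) *
              ‖X v + X w + (-1 : ℝ) • y‖ ^ 2))) (hm2.comp measurable_prodMk_left)
        _ ≤ T * ∫⁻ v, T * ∫⁻ w, ENNReal.ofReal (Real.exp (-(1 / (2 * ε ^ 2)) *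
            ‖X v + X w + (-1 : ℝ) • y‖ ^ 2)) := hτT _ (hm3.const_mul _)
        _ = T ^ 2 * ∫⁻ v, ∫⁻ w, ENNReal.ofReal (Real.exp (-(1 / (2 * ε ^ 2)) *
            ‖X v + X w - y‖ ^ 2)) := by
            rw [lintegral_const_mul _ hm3, ← mul_assoc, ← sq]
            simp_rw [neg_one_smul, ← sub_eq_add_neg]
        _ ≤ T ^ 2 * (C * (1 + ‖y‖ₑ) * ENNReal.ofReal (ε ^ D)) := by
            gcongr
            exact hA y ε hε hε1
        _ = _ := by ring
    calc _ ≤ ∫⁻ y, T ^ 2 * C * ENNReal.ofReal (ε ^ D) * (1 + ‖y‖ₑ) ∂μ := lintegral_mono inner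
      _ = T ^ 2 * C * ENNReal.ofReal (ε ^ D) * ∫⁻ y, (1 + ‖y‖ₑ) ∂μ :=
          lintegral_const_mul _ (by fun_prop)
      _ ≤ T ^ 2 * C * ENNReal.ofReal (ε ^ D) * (1 + 2 * B) := by
          gcongr
          rw [hμint _ (by fun_prop)]
          calc _ ≤ ∫⁻ v, ∫⁻ w, (1 + ‖X v‖ₑ) + ‖X w‖ₑ ∂τ ∂τ := by
                refine lintegral_mono fun v => lintegral_mono fun w => ?_
                rw [add_assoc]
                gcongr
                exact enorm_add_le _ _
            _ ≤ ∫⁻ v, (1 + ‖X v‖ₑ) + B ∂τ := by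
                refine lintegral_mono fun v => ?_
                rw [lintegral_add_left measurable_const, lintegral_const]
                refine add_le_add ?_ hτB
                calc (1 + ‖X v‖ₑ) * τ Set.univ ≤ (1 + ‖X v‖ₑ) * 1 := by gcongr
                  _ = _ := mul_one _
            _ ≤ 1 + 2 * B := by
                rw [lintegral_add_right _ measurable_const, lintegral_const,
                  lintegral_add_left measurable_const, lintegral_const, two_mul, ← add_assoc]
                refine add_le_add (add_le_add ?_ hτB) ?_
                · simpa using hτ1
                · calc B * τ Set.univ ≤ B * 1 := by gcongr
                    _ = B := mul_one _
      _ = _ := by ring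
  have hreg : ∀ ε : ℝ, 0 < ε → ε ≤ 1 →
      ∫⁻ ζ, ENNReal.ofReal (Real.exp (-(ε ^ 2 / 2) * ‖ζ‖ ^ 2) * ‖charFun ν ζ‖ ^ 4)
        ≤ ENNReal.ofReal ((2 * Real.pi) ^ (D / 2 : ℝ)) * (C * (1 + 2 * B)) * T ^ 2 := by
    intro ε hε hε1
    have hi : Integrable fun ζ => Real.exp (-(ε ^ 2 / 2) * ‖ζ‖ ^ 2) * ‖charFun ν ζ‖ ^ 4 := by
      have hg : Integrable fun ζ : F => Real.exp (-(ε ^ 2 / 2) * ‖ζ‖ ^ 2) := by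
        have := (GaussianFourier.integrable_cexp_neg_mul_sq_norm_add
          (b := ((ε ^ 2 / 2 : ℝ) : ℂ)) (by rw [Complex.ofReal_re]; positivity) 0 (0 : F)).norm
        refine this.congr (ae_of_all _ fun ζ => ?_)
        simp only [zero_mul, add_zero]
        rw [Complex.norm_exp]
        norm_cast
      refine hg.mul_bdd (c := ν.real Set.univ ^ 4)
        (measurable_charFun.norm.pow_const 4).aestronglyMeasurable (ae_of_all _ fun ζ => ?_)
      rw [Real.norm_of_nonneg (by positivity)]
      gcongr
      exact norm_charFun_le ζ
    rw [← ofReal_integral_eq_lintegral_ofReal hi (ae_of_all _ fun ζ => by positivity)]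
    have h1 := integral_gaussian_mul_charFun (symmetrized μ) hε
    have h2 : ∫ ζ, (Real.exp (-(ε ^ 2 / 2) * ‖ζ‖ ^ 2) : ℂ) * charFun (symmetrized μ) ζ
        = ((∫ ζ, Real.exp (-(ε ^ 2 / 2) * ‖ζ‖ ^ 2) * ‖charFun ν ζ‖ ^ 4 : ℝ) : ℂ) := by
      rw [← integral_complex_ofReal]
      refine integral_congr_ae (ae_of_all _ fun ζ => ?_)
      simp only [hφ]
      push_cast
      rfl
    rw [h2] at h1
    have h3 := Complex.ofReal_injective h1
    have hi2 : Integrable (fun x : F => Real.exp (-(1 / (2 * ε ^ 2)) * ‖x‖ ^ 2))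
        (symmetrized μ) := by
      refine Integrable.mono' (integrable_const (1 : ℝ))
        (Continuous.aestronglyMeasurable (by fun_prop)) (ae_of_all _ fun x => ?_)
      rw [Real.norm_of_nonneg (Real.exp_pos _).le]
      refine Real.exp_le_one_iff.2 ?_
      have : 0 ≤ 1 / (2 * ε ^ 2) * ‖x‖ ^ 2 := by positivity
      linarith
    rw [h3, ENNReal.ofReal_mul (by positivity),
      ofReal_integral_eq_lintegral_ofReal hi2 (ae_of_all _ fun x => (Real.exp_pos _).le)]
    -- The normalization `ε^{-D}` of the Gaussian integral cancels the small ball factor `ε^D`, so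
    -- the regularized bound is uniform in `ε`.
    have h4 : (2 * Real.pi / ε ^ 2) ^ (D / 2 : ℝ) * ε ^ D = (2 * Real.pi) ^ (D / 2 : ℝ) := by
      rw [Real.div_rpow (by positivity) (by positivity), ← Real.rpow_natCast ε 2,
        ← Real.rpow_mul hε.le, ← Real.rpow_natCast ε D]
      have : ((2 : ℕ) : ℝ) * (D / 2 : ℝ) = (D : ℝ) := by push_cast; ring
      rw [this, div_mul_cancel₀ _ (Real.rpow_pos_of_pos hε _).ne']
    calc _ ≤ ENNReal.ofReal ((2 * Real.pi / ε ^ 2) ^ (D / 2 : ℝ)) *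
          (T ^ 2 * (C * (1 + 2 * B)) * ENNReal.ofReal (ε ^ D)) := by gcongr; exact key ε hε hε1
      _ = (ENNReal.ofReal ((2 * Real.pi / ε ^ 2) ^ (D / 2 : ℝ)) * ENNReal.ofReal (ε ^ D)) *
          (C * (1 + 2 * B)) * T ^ 2 := by ring
      _ = _ := by rw [← ENNReal.ofReal_mul (by positivity), h4]
  -- The regularization is removed along `ε → 0` by Fatou's lemma.
  set e : ℕ → ℝ := fun n => 1 / ((n : ℝ) + 1) with he
  have he0 : Tendsto e atTop (𝓝 0) := tendsto_one_div_add_atTop_nhds_zero_nat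
  have hlim : ∀ ζ, Tendsto (fun n => ENNReal.ofReal (Real.exp (-(e n ^ 2 / 2) * ‖ζ‖ ^ 2) *
      ‖charFun ν ζ‖ ^ 4)) atTop (𝓝 (‖charFun ν ζ‖ₑ ^ 4)) := by
    intro ζ
    have h1 : Tendsto (fun n => Real.exp (-(e n ^ 2 / 2) * ‖ζ‖ ^ 2) * ‖charFun ν ζ‖ ^ 4) atTop
        (𝓝 (Real.exp (-((0 : ℝ) ^ 2 / 2) * ‖ζ‖ ^ 2) * ‖charFun ν ζ‖ ^ 4)) := by
      refine Tendsto.mul_const _ ((Real.continuous_exp.tendsto _).comp ?_)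
      exact (((he0.pow 2).div_const 2).neg).mul_const _
    have h2 := (ENNReal.continuous_ofReal.tendsto _).comp h1
    have h3 : ENNReal.ofReal (Real.exp (-((0 : ℝ) ^ 2 / 2) * ‖ζ‖ ^ 2) * ‖charFun ν ζ‖ ^ 4)
        = ‖charFun ν ζ‖ₑ ^ 4 := by
      rw [← ofReal_norm, ← ENNReal.ofReal_pow (norm_nonneg _)]
      congr 1
      simp
    rw [← h3]
    exact h2
  calc ∫⁻ ζ, ‖charFun ν ζ‖ₑ ^ 4
      = ∫⁻ ζ, liminf (fun n => ENNReal.ofReal (Real.exp (-(e n ^ 2 / 2) * ‖ζ‖ ^ 2) *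
          ‖charFun ν ζ‖ ^ 4)) atTop := lintegral_congr fun ζ => (hlim ζ).liminf_eq.symm
    _ ≤ liminf (fun n => ∫⁻ ζ, ENNReal.ofReal (Real.exp (-(e n ^ 2 / 2) * ‖ζ‖ ^ 2) *
          ‖charFun ν ζ‖ ^ 4)) atTop := by
        refine lintegral_liminf_le fun n => ?_
        have := (measurable_charFun (μ := ν)).norm.pow_const 4
        fun_prop
    _ ≤ _ := by
        refine (liminf_le_liminf (Eventually.of_forall fun n => hreg (e n) ?_ ?_)).trans
          (le_of_eq (liminf_const _))
        · simp only [he]; positivity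
        · simp only [he]
          rw [div_le_one (by positivity)]
          have : (0 : ℝ) ≤ n := by positivity
          linarith

/-- A power of the characteristic function of the statistic `X` is integrable if the density is in
`L^p` for some `p > 1`. -/
theorem exists_integrable_norm_charFun_pow {X : E → F} (hX : Measurable X) {C : ℝ≥0∞} (hC : C ≠ ∞)
    (hA : SmallBall X C) {ρ : E → ℝ≥0∞} (hρ : Measurable ρ) (hρ1 : ∫⁻ v, ρ v = 1)
    (hB : ∫⁻ v, ‖X v‖ₑ ∂(volume.withDensity ρ) ≠ ∞) {p : ℝ} (hp : 1 < p)
    (hI : ∫⁻ v, ρ v ^ p < ∞) :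
    ∃ q : ℕ, Integrable fun ζ => ‖charFun ((volume.withDensity ρ).map X) ζ‖ ^ q := by
  obtain ⟨C', hC', hquad⟩ := exists_lintegral_charFun_trunc_le hX hC hA hρ hρ1 hB
  set φ := charFun ((volume.withDensity ρ).map X) with hφ
  have hprob : IsProbabilityMeasure (volume.withDensity ρ : Measure E) :=
    ⟨by rw [withDensity_apply _ .univ, setLIntegral_univ, hρ1]⟩
  have hprob' : IsProbabilityMeasure ((volume.withDensity ρ).map X) :=
    Measure.isProbabilityMeasure_map hX.aemeasurable
  obtain ⟨s, hs⟩ := exists_nat_ge (1 / (p - 1))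
  set J : ℝ≥0 := (∫⁻ v, ρ v ^ p).toNNReal + 1 with hJ
  have hJI : ∫⁻ v, ρ v ^ p ≤ J := by
    rw [hJ, ENNReal.coe_add, ENNReal.coe_toNNReal hI.ne]
    exact le_self_add
  have hJ1 : 1 ≤ J := by rw [hJ]; exact le_add_self
  -- This height satisfies `T_j^{p-1} ≥ 2^{j+2} J`, so truncating there moves `φ` by at most
  -- `2^{-j-2}`. The integer exponent `s ≥ 1/(p-1)` makes `T_j` grow like `2^{sj}`.
  set T : ℕ → ℝ≥0 := fun j => (J * (2 ^ j * 4)) ^ s with hT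
  have hTj : ∀ j, (J : ℝ≥0∞) * (2 ^ j * 4) ≤ (T j : ℝ≥0∞) ^ (p - 1) := by
    intro j
    have h1 : (1 : ℝ≥0) ≤ J * (2 ^ j * 4) := by
      have : (1 : ℝ≥0) ≤ 2 ^ j := one_le_pow₀ (by norm_num)
      calc (1 : ℝ≥0) = 1 * (1 * 1) := by norm_num
        _ ≤ J * (2 ^ j * 4) := by gcongr; norm_num
    have h2 : J * (2 ^ j * 4) ≤ (T j) ^ (p - 1) := by
      rw [hT]
      simp only
      rw [← NNReal.rpow_natCast _ s, ← NNReal.rpow_mul]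
      conv_lhs => rw [← NNReal.rpow_one (J * (2 ^ j * 4))]
      refine NNReal.rpow_le_rpow_of_exponent_le h1 ?_
      rwa [div_le_iff₀ (by linarith)] at hs
    rw [← ENNReal.coe_rpow_of_nonneg _ (by linarith)]
    exact_mod_cast h2
  have hdiff : ∀ j ζ, ‖φ ζ - charFun ((volume.withDensity (truncDensity ρ (T j))).map X) ζ‖ₑ
      ≤ (2 ^ j * 4)⁻¹ := fun j ζ =>
    enorm_charFun_sub_charFun_trunc_le hX hρ hρ1 hp ENNReal.coe_ne_top hJI (hTj j)
      (by have := zero_lt_one.trans_le hJ1; exact_mod_cast this.ne') ζ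
  -- The `j`-th level set will contribute `2^{-jq} · 2^{4j} · T_j²` up to constants, that is `2^{j(4
  -- + 2s - q)}`; this `q` leaves the geometric series of ratio `1/2`.
  set q := 5 + 2 * s with hq
  refine ⟨q, ?_⟩
  have hpt : ∀ ζ, ‖φ ζ‖ₑ ^ q ≤ ∑' j : ℕ, (2⁻¹ ^ j) ^ q * (2 ^ (j + 2)) ^ 4 *
      ‖charFun ((volume.withDensity (truncDensity ρ (T j))).map X) ζ‖ₑ ^ 4 := by
    intro ζ
    by_cases h0 : φ ζ = 0
    · rw [h0, enorm_zero, zero_pow (by omega)]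
      exact zero_le
    -- On the level set `2^{-j-1} < ‖φ‖ ≤ 2^{-j}` the truncated characteristic function is still at
    -- least `2^{-j-2}`, so inserting the factor `(2^{j+2} ‖ψ‖)⁴ ≥ 1` is free.
    obtain ⟨j, hj1, hj2⟩ := exists_nat_pow_near_of_lt_one (norm_pos_iff.2 h0)
      (norm_charFun_le_one ζ) (y := (1 / 2 : ℝ)) (by norm_num) (by norm_num)
    refine le_trans ?_ (ENNReal.le_tsum j)
    set ψ := charFun ((volume.withDensity (truncDensity ρ (T j))).map X) ζ with hψ
    have h1 : ‖φ ζ - ψ‖ ≤ (2 ^ j * 4)⁻¹ := by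
      have := hdiff j ζ
      rw [← ofReal_norm] at this
      have h := ENNReal.toReal_mono (by simp) this
      rw [ENNReal.toReal_ofReal (norm_nonneg _)] at h
      simpa [ENNReal.toReal_mul, ENNReal.toReal_inv] using h
    have h2 : (1 / 2 : ℝ) ^ (j + 2) ≤ ‖ψ‖ := by
      have h3 : ‖φ ζ‖ ≤ ‖φ ζ - ψ‖ + ‖ψ‖ := by
        simpa using norm_add_le (φ ζ - ψ) ψ
      have h4 : ((2 : ℝ) ^ j * 4)⁻¹ = (1 / 2 : ℝ) ^ (j + 2) := by
        rw [pow_add, mul_inv, one_div, inv_pow]; norm_num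
      rw [h4] at h1
      have h5 : (1 / 2 : ℝ) ^ (j + 1) = 2 * (1 / 2 : ℝ) ^ (j + 2) := by ring
      linarith
    have h3 : ‖φ ζ‖ₑ ≤ 2⁻¹ ^ j := by
      rw [← ofReal_norm]
      refine (ENNReal.ofReal_le_ofReal hj2).trans (le_of_eq ?_)
      rw [ENNReal.ofReal_pow (by norm_num), one_div, ENNReal.ofReal_inv_of_pos (by norm_num)]
      simp
    have h4 : 1 ≤ (2 : ℝ≥0∞) ^ (j + 2) * ‖ψ‖ₑ := by
      rw [← ofReal_norm]
      have : (1 : ℝ) ≤ 2 ^ (j + 2) * ‖ψ‖ := by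
        calc (1 : ℝ) = 2 ^ (j + 2) * (1 / 2 : ℝ) ^ (j + 2) := by
              rw [← mul_pow]; norm_num
          _ ≤ _ := by gcongr
      have := ENNReal.ofReal_le_ofReal this
      rw [ENNReal.ofReal_mul (by positivity), ENNReal.ofReal_pow (by norm_num)] at this
      simpa using this
    calc ‖φ ζ‖ₑ ^ q ≤ (2⁻¹ ^ j) ^ q * 1 := by rw [mul_one]; gcongr
      _ ≤ (2⁻¹ ^ j) ^ q * ((2 : ℝ≥0∞) ^ (j + 2) * ‖ψ‖ₑ) ^ 4 := by
          gcongr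
          exact one_le_pow₀ h4
      _ = _ := by rw [mul_pow, mul_assoc]
  have hterm : ∀ j : ℕ, ((2⁻¹ : ℝ≥0∞) ^ j) ^ q * (2 ^ (j + 2)) ^ 4 * (C' * (T j : ℝ≥0∞) ^ 2)
      = (2 ^ 8 * C' * (J * 4) ^ (2 * s)) * 2⁻¹ ^ j := by
    intro j
    have h1 : (2⁻¹ : ℝ≥0∞) ^ j * 2 ^ j = 1 := by
      rw [← mul_pow, ENNReal.inv_mul_cancel (by simp) (by simp), one_pow]
    have h2 : (T j : ℝ≥0∞) = (J * (2 ^ j * 4)) ^ s := by rw [hT]; push_cast; rfl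
    rw [h2, hq]
    calc _ = 2 ^ 8 * C' * (J * 4) ^ (2 * s) * (2⁻¹ ^ j * (2⁻¹ ^ j * 2 ^ j) ^ (4 + 2 * s)) := by
          ring
      _ = _ := by rw [h1, one_pow, mul_one]
  have hmeas : ∀ j, Measurable fun ζ => (2⁻¹ ^ j) ^ q * (2 ^ (j + 2)) ^ 4 *
      ‖charFun ((volume.withDensity (truncDensity ρ (T j))).map X) ζ‖ₑ ^ 4 := by
    intro j
    have : IsFiniteMeasure (volume.withDensity (truncDensity ρ (T j)) : Measure E) :=
      isFiniteMeasure_of_le _ (withDensity_mono (ae_of_all _ (truncDensity_le_self ρ (T j))))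
    have : IsFiniteMeasure ((volume.withDensity (truncDensity ρ (T j))).map X) :=
      Measure.isFiniteMeasure_map _ _
    exact (measurable_charFun.enorm.pow_const 4).const_mul _
  have hfin : ∫⁻ ζ, ‖φ ζ‖ₑ ^ q < ∞ := by
    calc ∫⁻ ζ, ‖φ ζ‖ₑ ^ q
        ≤ ∫⁻ ζ, ∑' j : ℕ, (2⁻¹ ^ j) ^ q * (2 ^ (j + 2)) ^ 4 *
          ‖charFun ((volume.withDensity (truncDensity ρ (T j))).map X) ζ‖ₑ ^ 4 :=
          lintegral_mono hpt
      _ = ∑' j : ℕ, ∫⁻ ζ, (2⁻¹ ^ j) ^ q * (2 ^ (j + 2)) ^ 4 *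
          ‖charFun ((volume.withDensity (truncDensity ρ (T j))).map X) ζ‖ₑ ^ 4 :=
          lintegral_tsum fun j => (hmeas j).aemeasurable
      _ ≤ ∑' j : ℕ, (2⁻¹ ^ j) ^ q * (2 ^ (j + 2)) ^ 4 * (C' * (T j : ℝ≥0∞) ^ 2) := by
          refine ENNReal.tsum_le_tsum fun j => ?_
          rw [lintegral_const_mul' _ _ (by finiteness)]
          gcongr
          exact hquad _
      _ = (2 ^ 8 * C' * (J * 4) ^ (2 * s)) * ∑' j : ℕ, 2⁻¹ ^ j := by
          simp_rw [hterm]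
          rw [ENNReal.tsum_mul_left]
      _ < ∞ := by
          rw [ENNReal.tsum_geometric, ENNReal.one_sub_inv_two, inv_inv]
          refine ENNReal.mul_lt_top ?_ (by simp)
          exact ENNReal.mul_lt_top (ENNReal.mul_lt_top (by simp) hC'.lt_top)
            (ENNReal.pow_lt_top (ENNReal.mul_lt_top (by simp) (by simp)))
  refine ⟨(measurable_charFun.norm.pow_const q).aestronglyMeasurable, ?_⟩
  rw [hasFiniteIntegral_iff_enorm]
  refine lt_of_le_of_lt (lintegral_mono fun ζ => ?_) hfin
  rw [← ofReal_norm, Real.norm_of_nonneg (by positivity), ENNReal.ofReal_pow (norm_nonneg _),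
    ofReal_norm]

end CharFunIntegrable

/-! ### Polar coordinates -/

section Polar

variable {W : Type*} [NormedAddCommGroup W] [InnerProductSpace ℝ W] [FiniteDimensional ℝ W]
  [MeasurableSpace W] [BorelSpace W]

/-- The density `x^β / 2` on `(0, ∞)`. -/
noncomputable def halfPow (β x : ℝ) : ℝ≥0∞ :=
  (Set.Ioi (0 : ℝ)).indicator (fun x => ENNReal.ofReal (x ^ β / 2)) x

theorem measurable_halfPow (β : ℝ) : Measurable (halfPow β) :=
  Measurable.indicator (by fun_prop) measurableSet_Ioi

theorem halfPow_of_nonpos (β : ℝ) {x : ℝ} (hx : x ≤ 0) : halfPow β x = 0 :=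
  Set.indicator_of_notMem (by simpa using hx) _

theorem halfPow_of_pos (β : ℝ) {x : ℝ} (hx : 0 < x) : halfPow β x = ENNReal.ofReal (x ^ β / 2) :=
  Set.indicator_of_mem (by simpa using hx) _

theorem halfPow_mul (β : ℝ) {c : ℝ} (hc : 0 < c) (x : ℝ) :
    halfPow β (c * x) = ENNReal.ofReal (c ^ β) * halfPow β x := by
  rcases le_or_gt x 0 with hx | hx
  · rw [halfPow_of_nonpos _ hx, halfPow_of_nonpos _ (mul_nonpos_of_nonneg_of_nonpos hc.le hx),
      mul_zero]
  · rw [halfPow_of_pos _ hx, halfPow_of_pos _ (mul_pos hc hx), ← ENNReal.ofReal_mul (by positivity),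
      Real.mul_rpow hc.le hx.le, mul_div_assoc]

/-- Polar coordinates. -/
theorem lintegral_polar {g : W → ℝ≥0∞} (hg : Measurable g) [Nontrivial W] :
    ∫⁻ w, g w = ∫⁻ r in Set.Ioi (0 : ℝ), ENNReal.ofReal (r ^ (Module.finrank ℝ W - 1)) *
      ∫⁻ u, g (r • (u : W)) ∂(volume : Measure W).toSphere := by
  have hmp := (volume : Measure W).measurePreserving_homeomorphUnitSphereProd
  have hG : Measurable fun p : Metric.sphere (0 : W) 1 × Set.Ioi (0 : ℝ) =>
      g ((p.2 : ℝ) • (p.1 : W)) := by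
    refine hg.comp (Measurable.smul ?_ ?_)
    · exact measurable_subtype_coe.comp measurable_snd
    · exact measurable_subtype_coe.comp measurable_fst
  calc ∫⁻ w, g w = ∫⁻ w in ({0}ᶜ : Set W), g w := by rw [restrict_compl_singleton]
    _ = ∫⁻ w : ({0}ᶜ : Set W), g w ∂(volume.comap Subtype.val) := by
        rw [lintegral_subtype_comap (measurableSet_singleton _).compl]
    _ = ∫⁻ w : ({0}ᶜ : Set W), (fun p : Metric.sphere (0 : W) 1 × Set.Ioi (0 : ℝ) =>
          g ((p.2 : ℝ) • (p.1 : W))) (homeomorphUnitSphereProd W w) ∂(volume.comap Subtype.val) := by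
        refine lintegral_congr fun w => ?_
        congr 1
        have hw : ‖(w : W)‖ ≠ 0 := norm_ne_zero_iff.2 w.2
        simp [smul_smul, hw]
    _ = ∫⁻ p, g ((p.2 : ℝ) • (p.1 : W)) ∂((volume : Measure W).toSphere.prod
          (Measure.volumeIoiPow (Module.finrank ℝ W - 1))) := hmp.lintegral_comp hG
    _ = ∫⁻ r : Set.Ioi (0 : ℝ), ∫⁻ u, g ((r : ℝ) • (u : W)) ∂(volume : Measure W).toSphere
          ∂(Measure.volumeIoiPow (Module.finrank ℝ W - 1)) := lintegral_prod_symm' _ hG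
    _ = ∫⁻ r : Set.Ioi (0 : ℝ), ENNReal.ofReal ((r : ℝ) ^ (Module.finrank ℝ W - 1)) *
          ∫⁻ u, g ((r : ℝ) • (u : W)) ∂(volume : Measure W).toSphere
            ∂(volume.comap Subtype.val) := by
        rw [Measure.volumeIoiPow, lintegral_withDensity_eq_lintegral_mul]
        · rfl
        · fun_prop
        · exact hG.lintegral_prod_left'
    _ = _ := by
        rw [← lintegral_subtype_comap measurableSet_Ioi]

/-- Polar coordinates, in the square of the radius. -/
theorem lintegral_polar_sq {g : W → ℝ≥0∞} (hg : Measurable g) [Nontrivial W] :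
    ∫⁻ w, g w = ∫⁻ x, halfPow (Module.finrank ℝ W / 2 - 1) x *
      ∫⁻ u, g (√x • (u : W)) ∂(volume : Measure W).toSphere := by
  rw [lintegral_polar hg]
  set D := Module.finrank ℝ W with hD
  have hD1 : 1 ≤ D := Module.finrank_pos
  have himg : (Set.Ioi (0 : ℝ)) = Real.sqrt '' (Set.Ioi (0 : ℝ)) := by
    ext x
    simp only [Set.mem_image, Set.mem_Ioi]
    exact ⟨fun hx => ⟨x ^ 2, by positivity, Real.sqrt_sq hx.le⟩,
      fun ⟨y, hy, h⟩ => h ▸ Real.sqrt_pos.2 hy⟩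
  have h1 : ∀ x ∈ Set.Ioi (0 : ℝ), HasDerivWithinAt Real.sqrt (1 / (2 * √x)) (Set.Ioi 0) x :=
    fun x hx => (Real.hasDerivAt_sqrt (ne_of_gt hx)).hasDerivWithinAt
  have hinj : Set.InjOn Real.sqrt (Set.Ioi 0) := fun x hx y hy h => by
    rwa [Real.sqrt_inj (le_of_lt hx) (le_of_lt hy)] at h
  conv_lhs => rw [himg]
  rw [lintegral_image_eq_lintegral_abs_deriv_mul measurableSet_Ioi h1 hinj,
    ← lintegral_indicator measurableSet_Ioi]
  refine lintegral_congr fun x => ?_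
  by_cases hx : x ∈ Set.Ioi (0 : ℝ)
  · rw [Set.indicator_of_mem hx, halfPow_of_pos _ hx, ← mul_assoc,
      ← ENNReal.ofReal_mul (by positivity)]
    congr 2
    have hx0 : (0 : ℝ) < x := hx
    rw [abs_of_pos (by positivity), Real.sqrt_eq_rpow, ← Real.rpow_natCast, ← Real.rpow_mul hx0.le,
      Nat.cast_sub hD1, one_div, mul_inv, ← Real.rpow_neg hx0.le, mul_assoc, ← Real.rpow_add hx0,
      mul_comm]
    rw [div_eq_mul_inv]
    congr 2
    push_cast
    ring
  · rw [Set.indicator_of_notMem hx, halfPow_of_nonpos _ (by simpa using hx), zero_mul]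

end Polar

/-! ### Spheres fibered over linear coordinates -/

section LinearCoordinates

variable {A B H W : Type*}

/-- Linear isomorphisms change Haar measures by a constant factor. -/
theorem exists_lintegral_linearEquiv [NormedAddCommGroup A] [NormedSpace ℝ A]
    [FiniteDimensional ℝ A] [MeasureSpace A] [BorelSpace A]
    [(volume : Measure A).IsAddHaarMeasure] [NormedAddCommGroup H] [NormedSpace ℝ H]
    [FiniteDimensional ℝ H] [MeasureSpace H] [BorelSpace H]
    [(volume : Measure H).IsAddHaarMeasure] (L : A ≃L[ℝ] H) :
    ∃ κ : ℝ≥0∞, κ ≠ 0 ∧ κ ≠ ∞ ∧ ∀ g : H → ℝ≥0∞, Measurable g →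
      ∫⁻ h, g h = κ * ∫⁻ a, g (L a) := by
  have : ((volume : Measure A).map L).IsAddHaarMeasure := L.isAddHaarMeasure_map _
  have h := Measure.isAddLeftInvariant_eq_smul (volume : Measure H) ((volume : Measure A).map L)
  have hpos := Measure.addHaarScalarFactor_pos_of_isAddHaarMeasure (volume : Measure H)
    ((volume : Measure A).map L)
  refine ⟨((volume : Measure H).addHaarScalarFactor ((volume : Measure A).map L) : ℝ≥0),
    by exact_mod_cast hpos.ne', ENNReal.coe_ne_top, fun g hg => ?_⟩
  conv_lhs => rw [h]
  rw [lintegral_smul_measure, lintegral_map hg L.continuous.measurable]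
  rfl

/-- Substitution of a dilation. -/
theorem lintegral_eq_mul_lintegral_smul [NormedAddCommGroup A] [NormedSpace ℝ A]
    [FiniteDimensional ℝ A] [MeasureSpace A] [BorelSpace A]
    [(volume : Measure A).IsAddHaarMeasure] {c : ℝ} (hc : 0 < c) {g : A → ℝ≥0∞}
    (hg : Measurable g) :
    ∫⁻ a, g a = ENNReal.ofReal (c ^ Module.finrank ℝ A) * ∫⁻ a, g (c • a) := by
  have h := Measure.map_addHaar_smul (volume : Measure A) hc.ne'
  have h2 : ∫⁻ a, g (c • a) = ENNReal.ofReal |(c ^ Module.finrank ℝ A)⁻¹| * ∫⁻ a, g a := by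
    rw [← lintegral_map hg (measurable_const_smul c), h, lintegral_smul_measure]
    rfl
  rw [h2, ← mul_assoc, ← ENNReal.ofReal_mul (by positivity), abs_of_pos (by positivity),
    mul_inv_cancel₀ (by positivity), ENNReal.ofReal_one, one_mul]

theorem measurable_lintegral_sphere_fiber [NormedAddCommGroup A] [NormedSpace ℝ A]
    [FiniteDimensional ℝ A] [MeasurableSpace A] [BorelSpace A]
    [NormedAddCommGroup W] [InnerProductSpace ℝ W]
    [FiniteDimensional ℝ W] [MeasurableSpace W] [BorelSpace W] {G : Type*} [NormedAddCommGroup G] [NormedSpace ℝ G]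
    [FiniteDimensional ℝ G] [MeasurableSpace G] [BorelSpace G] (L : (A × W) ≃L[ℝ] G)
    {q : A → ℝ} (hq : Measurable q) {g : G → ℝ≥0∞} (hg : Measurable g) :
    Measurable fun p : A × ℝ =>
      ∫⁻ u, g (L (p.1, √(p.2 - q p.1) • (u : W))) ∂(volume : Measure W).toSphere := by
  have h : Measurable fun x : (A × ℝ) × Metric.sphere (0 : W) 1 =>
      g (L (x.1.1, √(x.1.2 - q x.1.1) • (x.2 : W))) := by
    refine hg.comp (L.continuous.measurable.comp ?_)
    have : Measurable fun x : (A × ℝ) × Metric.sphere (0 : W) 1 => (x.2 : W) :=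
      measurable_subtype_coe.comp measurable_snd
    fun_prop
  exact h.lintegral_prod_right'

theorem lintegral_halfPow_Ioo_lt_top {γ : ℝ} (hγ : -1 < γ) :
    ∫⁻ t in Set.Ioo (0 : ℝ) 1, ENNReal.ofReal (t ^ γ) < ∞ := by
  have h : IntegrableOn (fun t : ℝ => t ^ γ) (Set.Ioo 0 1) :=
    (intervalIntegral.integrableOn_Ioo_rpow_iff one_pos).2 hγ
  exact (hasFiniteIntegral_iff_ofReal (by
    filter_upwards [ae_restrict_mem measurableSet_Ioo] with t ht
    exact Real.rpow_nonneg ht.1.le _)).1 h.2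

theorem lintegral_halfPow_Ioo_ne_zero (γ : ℝ) :
    ∫⁻ t in Set.Ioo (0 : ℝ) 1, ENNReal.ofReal (t ^ γ) ≠ 0 := by
  rw [← pos_iff_ne_zero, setLIntegral_pos_iff (by fun_prop)]
  have : Function.support (fun t : ℝ => ENNReal.ofReal (t ^ γ)) ∩ Set.Ioo 0 1 = Set.Ioo 0 1 := by
    refine Set.inter_eq_right.2 fun t ht => ?_
    simpa using Real.rpow_pos_of_pos ht.1 _
  rw [this]
  simp

variable [NormedAddCommGroup A] [NormedSpace ℝ A]
    [FiniteDimensional ℝ A] [MeasureSpace A] [BorelSpace A]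
    [(volume : Measure A).IsAddHaarMeasure] [NormedAddCommGroup H] [InnerProductSpace ℝ H]
    [FiniteDimensional ℝ H] [MeasurableSpace H] [BorelSpace H]
    [NormedAddCommGroup W] [InnerProductSpace ℝ W]
    [FiniteDimensional ℝ W] [MeasurableSpace W] [BorelSpace W] [Nontrivial W]

/-- Coordinates on `H` made of the component in `A`, the square of the norm, and the direction of
the component in `W`. -/
theorem exists_lintegral_sphere_fibration {G : Type*} [NormedAddCommGroup G] [NormedSpace ℝ G]
    [FiniteDimensional ℝ G] [MeasureSpace G] [BorelSpace G]
    [(volume : Measure G).IsAddHaarMeasure] (L : (A × W) ≃L[ℝ] G)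
    (q : A → ℝ) :
    ∃ κ : ℝ≥0∞, κ ≠ 0 ∧ κ ≠ ∞ ∧ ∀ g : G → ℝ≥0∞, Measurable g →
      ∫⁻ h, g h = κ * ∫⁻ a, ∫⁻ t, halfPow (Module.finrank ℝ W / 2 - 1) (t - q a) *
        ∫⁻ u, g (L (a, √(t - q a) • (u : W))) ∂(volume : Measure W).toSphere := by
  have : (volume : Measure (A × W)).IsAddHaarMeasure :=
    inferInstanceAs ((volume : Measure A).prod (volume : Measure W)).IsAddHaarMeasure
  obtain ⟨κ, h0, h1, hκ⟩ := exists_lintegral_linearEquiv L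
  refine ⟨κ, h0, h1, fun g hg => ?_⟩
  have hm : Measurable fun p : A × W => g (L p) := hg.comp L.continuous.measurable
  rw [hκ g hg, Measure.volume_eq_prod, lintegral_prod _ hm.aemeasurable]
  congr 1
  refine lintegral_congr fun a => ?_
  rw [lintegral_polar_sq (g := fun w => g (L (a, w))) (hm.comp measurable_prodMk_left)]
  exact (lintegral_sub_right_eq_self _ (q a)).symm

/-- The uniform measure of a sphere of `H` in the coordinates of
`exists_lintegral_sphere_fibration`. -/
theorem exists_lintegral_toSphere [Nontrivial H] (L : (A × W) ≃L[ℝ] H) {q : A → ℝ}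
    (hq : Measurable q) (hqs : ∀ (c : ℝ) a, q (c • a) = c ^ 2 * q a) (hq0 : ∀ a, 0 ≤ q a)
    (hL : ∀ a w, ‖L (a, w)‖ ^ 2 = q a + ‖w‖ ^ 2) {R : ℝ} (hR : 0 < R) :
    ∃ κ : ℝ≥0∞, κ ≠ 0 ∧ κ ≠ ∞ ∧ ∀ g : H → ℝ≥0∞, Measurable g →
      ∫⁻ u, g (√R • (u : H)) ∂(volume : Measure H).toSphere =
        κ * ∫⁻ a, halfPow (Module.finrank ℝ W / 2 - 1) (R - q a) *
          ∫⁻ u, g (L (a, √(R - q a) • (u : W))) ∂(volume : Measure W).toSphere := by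
  obtain ⟨κ, h0, h1, hκ⟩ := exists_lintegral_sphere_fibration L q
  set β : ℝ := Module.finrank ℝ W / 2 - 1 with hβ
  have hβ1 : -1 < β := by
    have : 0 < Module.finrank ℝ W := Module.finrank_pos
    have : (0 : ℝ) < Module.finrank ℝ W := by exact_mod_cast this
    rw [hβ]; linarith
  set β' : ℝ := Module.finrank ℝ H / 2 - 1 with hβ'
  have hβ1' : -1 < β' := by
    have : 0 < Module.finrank ℝ H := Module.finrank_pos
    have : (0 : ℝ) < Module.finrank ℝ H := by exact_mod_cast this
    rw [hβ']; linarith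
  set γ : ℝ := Module.finrank ℝ A / 2 + β with hγ
  have hγ1 : -1 < γ := by
    have : (0 : ℝ) ≤ Module.finrank ℝ A := by positivity
    rw [hγ]; linarith
  set I₁ : ℝ≥0∞ := ∫⁻ x in Set.Ioo (0 : ℝ) 1, ENNReal.ofReal (x ^ β') with hI₁
  set I₂ : ℝ≥0∞ := ∫⁻ x in Set.Ioo (0 : ℝ) 1, ENNReal.ofReal (x ^ γ) with hI₂
  have hI₁0 : I₁ ≠ 0 := lintegral_halfPow_Ioo_ne_zero _
  have hI₁t : I₁ ≠ ∞ := (lintegral_halfPow_Ioo_lt_top hβ1').ne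
  have hI₂0 : I₂ ≠ 0 := lintegral_halfPow_Ioo_ne_zero _
  have hI₂t : I₂ ≠ ∞ := (lintegral_halfPow_Ioo_lt_top hγ1).ne
  set cR : ℝ≥0∞ := ENNReal.ofReal (R⁻¹ ^ γ) with hcR
  have hcR0 : cR ≠ 0 := by simp [hcR, Real.rpow_pos_of_pos (inv_pos.2 hR)]
  have hcRt : cR ≠ ∞ := ENNReal.ofReal_ne_top
  refine ⟨(2⁻¹ * I₁)⁻¹ * (κ * (cR * I₂)), ?_, ?_, fun g hg => ?_⟩
  · exact mul_ne_zero (ENNReal.inv_ne_zero.2 (ENNReal.mul_ne_top (by simp) hI₁t))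
      (mul_ne_zero h0 (mul_ne_zero hcR0 hI₂0))
  · exact ENNReal.mul_ne_top (ENNReal.inv_ne_top.2 (mul_ne_zero (by simp) hI₁0))
      (ENNReal.mul_ne_top h1 (ENNReal.mul_ne_top hcRt hI₂t))
  set Q : ℝ≥0∞ := ∫⁻ a, halfPow β (R - q a) *
    ∫⁻ u, g (L (a, √(R - q a) • (u : W))) ∂(volume : Measure W).toSphere with hQ
  -- `G` extends `g`, restricted to the sphere of radius `√R`, to the unit ball as a function
  -- constant along rays. Computing `∫ G` in polar coordinates gives the sphere integral, and in the
  -- fibered coordinates a multiple of `Q`; `κ` is the quotient of the constants.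
  set G : H → ℝ≥0∞ := fun v => {v : H | ‖v‖ ^ 2 < 1}.indicator
    (fun v => g ((√R * ‖v‖⁻¹) • v)) v with hG
  have hGm : Measurable G := by
    refine Measurable.indicator (hg.comp (by fun_prop)) (measurableSet_lt (by fun_prop) (by fun_prop))
  have lhs : ∫⁻ v, G v = 2⁻¹ * I₁ * ∫⁻ u, g (√R • (u : H)) ∂(volume : Measure H).toSphere := by
    rw [lintegral_polar_sq hGm, ← hβ', hI₁, mul_assoc, mul_comm _ (∫⁻ u, _ ∂_),
      ← lintegral_indicator measurableSet_Ioo, ← lintegral_const_mul _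
        (Measurable.indicator (by fun_prop) measurableSet_Ioo), ← lintegral_const_mul _
        ((Measurable.indicator (by fun_prop) measurableSet_Ioo).const_mul _)]
    refine lintegral_congr fun x => ?_
    rcases le_or_gt x 0 with hx | hx
    · rw [halfPow_of_nonpos _ hx, Set.indicator_of_notMem (fun h => absurd h.1 (not_lt.2 hx))]
      simp
    have hu : ∀ u : Metric.sphere (0 : H) 1, ‖√x • (u : H)‖ = √x := fun u => by
      rw [norm_smul, norm_eq_of_mem_sphere u, mul_one, Real.norm_of_nonneg (Real.sqrt_nonneg _)]
    rcases lt_or_ge x 1 with hx1 | hx1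
    · have : ∀ u : Metric.sphere (0 : H) 1, G (√x • (u : H)) = g (√R • (u : H)) := by
        intro u
        rw [hG]
        simp only
        rw [Set.indicator_of_mem (by
          rw [Set.mem_ofPred_eq, hu, Real.sq_sqrt hx.le]; exact hx1), hu, smul_smul, mul_assoc,
          inv_mul_cancel₀ (Real.sqrt_pos.2 hx).ne', mul_one]
      simp_rw [this]
      rw [halfPow_of_pos _ hx, Set.indicator_of_mem (show x ∈ Set.Ioo (0 : ℝ) 1 from ⟨hx, hx1⟩), div_eq_inv_mul,
        ENNReal.ofReal_mul (by positivity), ENNReal.ofReal_inv_of_pos (by norm_num)]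
      simp only [ENNReal.ofReal_ofNat]
      ring
    · have : ∀ u : Metric.sphere (0 : H) 1, G (√x • (u : H)) = 0 := by
        intro u
        rw [hG]
        simp only
        rw [Set.indicator_of_notMem]
        rw [Set.mem_ofPred_eq, hu, Real.sq_sqrt hx.le]; exact not_lt.2 hx1
      simp_rw [this]
      rw [Set.indicator_of_notMem (fun h => absurd h.2 (not_lt.2 hx1))]
      simp
  -- Since `q` is homogeneous of degree two, dilating `a` by `√(t/R)` carries the level `t` to the
  -- level `R`; the Jacobian and the power in `halfPow` combine into `t^γ`.
  have hscale : ∀ t : ℝ, 0 < t → t < 1 →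
      ∫⁻ a, halfPow β (t - q a) * ∫⁻ u, G (L (a, √(t - q a) • (u : W)))
        ∂(volume : Measure W).toSphere = ENNReal.ofReal (t ^ γ) * (cR * Q) := by
    intro t ht ht1
    set c : ℝ := √(t / R) with hc
    have hc0 : 0 < c := Real.sqrt_pos.2 (by positivity)
    have hc2 : c ^ 2 = t / R := Real.sq_sqrt (by positivity)
    have hm : Measurable fun a => halfPow β (t - q a) * ∫⁻ u, G (L (a, √(t - q a) • (u : W)))
        ∂(volume : Measure W).toSphere :=
      ((measurable_halfPow β).comp (by fun_prop)).mul
        ((measurable_lintegral_sphere_fiber L hq hGm).comp (measurable_id.prodMk measurable_const))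
    rw [lintegral_eq_mul_lintegral_smul hc0 hm]
    have hpt : ∀ a, halfPow β (t - q (c • a)) *
        ∫⁻ u, G (L (c • a, √(t - q (c • a)) • (u : W))) ∂(volume : Measure W).toSphere =
        ENNReal.ofReal ((t / R) ^ β) * (halfPow β (R - q a) *
          ∫⁻ u, g (L (a, √(R - q a) • (u : W))) ∂(volume : Measure W).toSphere) := by
      intro a
      have h1 : t - q (c • a) = t / R * (R - q a) := by
        rw [hqs, hc2]; field_simp
      rw [h1, halfPow_mul _ (by positivity), ← mul_assoc]
      rcases le_or_gt (R - q a) 0 with hRa | hRa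
      · rw [halfPow_of_nonpos _ hRa]; simp
      congr 1
      refine lintegral_congr fun u => ?_
      have h2 : L (c • a, √(t / R * (R - q a)) • (u : W)) = c • L (a, √(R - q a) • (u : W)) := by
        rw [← map_smul, Prod.smul_mk, smul_smul, Real.sqrt_mul (by positivity)]
      have h3 : ‖c • L (a, √(R - q a) • (u : W))‖ = √t := by
        rw [← Real.sqrt_sq (norm_nonneg _)]
        congr 1
        rw [norm_smul, mul_pow, hL, norm_smul, mul_pow,
          Real.norm_of_nonneg (Real.sqrt_nonneg (R - q a)), Real.sq_sqrt hRa.le,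
          norm_eq_of_mem_sphere, Real.norm_of_nonneg hc0.le, hc2]
        field_simp
        ring
      rw [h2, hG]
      simp only
      rw [Set.indicator_of_mem (by rw [Set.mem_ofPred_eq, h3, Real.sq_sqrt ht.le]; exact ht1), h3,
        smul_smul]
      have h4 : √R * (√t)⁻¹ * c = 1 := by
        rw [hc, Real.sqrt_div ht.le]
        have := Real.sqrt_pos.2 ht
        have := Real.sqrt_pos.2 hR
        field_simp
      rw [h4, one_smul]
    simp_rw [hpt]
    rw [lintegral_const_mul' _ _ ENNReal.ofReal_ne_top, ← hQ, ← mul_assoc, ← mul_assoc,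
      ← ENNReal.ofReal_mul (by positivity), hcR, ← ENNReal.ofReal_mul (by positivity)]
    congr 2
    rw [hc, Real.sqrt_eq_rpow, ← Real.rpow_natCast, ← Real.rpow_mul (by positivity),
      ← Real.rpow_add (by positivity), div_eq_mul_inv t R, ← Real.mul_rpow ht.le (by positivity), hγ]
    congr 1
    ring
  have hjm : Measurable fun p : A × ℝ => halfPow β (p.2 - q p.1) *
      ∫⁻ u, G (L (p.1, √(p.2 - q p.1) • (u : W))) ∂(volume : Measure W).toSphere :=
    ((measurable_halfPow β).comp (by fun_prop)).mul (measurable_lintegral_sphere_fiber L hq hGm)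
  have rhs : ∫⁻ v, G v = κ * (cR * I₂) * Q := by
    rw [hκ G hGm, lintegral_lintegral_swap hjm.aemeasurable]
    have hpt : ∀ t, ∫⁻ a, halfPow β (t - q a) * ∫⁻ u, G (L (a, √(t - q a) • (u : W)))
        ∂(volume : Measure W).toSphere = (Set.Ioo (0 : ℝ) 1).indicator
          (fun t => ENNReal.ofReal (t ^ γ)) t * (cR * Q) := by
      intro t
      by_cases ht : t ∈ Set.Ioo (0 : ℝ) 1
      · rw [Set.indicator_of_mem ht, hscale t ht.1 ht.2]
      rw [Set.indicator_of_notMem ht, zero_mul]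
      refine lintegral_eq_zero_of_ae_eq_zero (ae_of_all _ fun a => ?_)
      rcases le_or_gt (t - q a) 0 with h | h
      · simp only [halfPow_of_nonpos _ h, zero_mul, Pi.zero_apply]
      have ht1 : 1 ≤ t := by
        by_contra h2
        exact ht ⟨by linarith [hq0 a], not_le.1 h2⟩
      have : ∀ u : Metric.sphere (0 : W) 1, G (L (a, √(t - q a) • (u : W))) = 0 := by
        intro u
        rw [hG]
        simp only
        rw [Set.indicator_of_notMem]
        rw [Set.mem_ofPred_eq, hL, norm_smul, mul_pow, Real.norm_of_nonneg (Real.sqrt_nonneg _),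
          Real.sq_sqrt h.le, norm_eq_of_mem_sphere]
        linarith
      simp_rw [this]
      simp
    simp_rw [hpt]
    rw [lintegral_mul_const _ (Measurable.indicator (by fun_prop) measurableSet_Ioo),
      lintegral_indicator measurableSet_Ioo, ← hI₂]
    ring
  rw [mul_assoc, ← rhs, lhs, ← mul_assoc, ENNReal.inv_mul_cancel
    (mul_ne_zero (by simp) hI₁0) (ENNReal.mul_ne_top (by simp) hI₁t), one_mul]

end LinearCoordinates

/-! ### Total momentum and energy of a family of velocities -/

section Momentum

open scoped RealInnerProductSpace
open ContinuousLinearMap (adjoint)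

variable {E P : Type*} [NormedAddCommGroup E] [InnerProductSpace ℝ E]
  [NormedAddCommGroup P] [InnerProductSpace ℝ P]

/-- The momentum and the centered energy of a velocity. -/
def stat (π : E →L[ℝ] P) (v : E) : WithLp 2 (P × ℝ) := WithLp.toLp 2 (π v, ‖v‖ ^ 2 - 1)

theorem measurable_stat [MeasurableSpace E] [BorelSpace E]
    [MeasurableSpace P] [BorelSpace P] (π : E →L[ℝ] P) : Measurable (stat π) := by
  have h1 : Measurable fun v : E => (π v, ‖v‖ ^ 2 - 1) := by fun_prop
  exact (WithLp.measurable_toLp 2 (P × ℝ)).comp h1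

/-- The vectors of `n` velocities with zero total momentum. -/
def momentumKer (π : E →L[ℝ] P) (n : ℕ) : Submodule ℝ (PiLp 2 fun _ : Fin n => E) where
  carrier := {V | ∑ i, π (V i) = 0}
  zero_mem' := by simp
  add_mem' := by
    intro V W hV hW
    simp only [Set.mem_ofPred_eq] at hV hW ⊢
    simp [Finset.sum_add_distrib, hV, hW]
  smul_mem' := by
    intro c V hV
    simp only [Set.mem_ofPred_eq] at hV ⊢
    simp [← Finset.smul_sum, hV]

theorem mem_momentumKer {π : E →L[ℝ] P} {n : ℕ} {V : PiLp 2 fun _ : Fin n => E} :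
    V ∈ momentumKer π n ↔ ∑ i, π (V i) = 0 := Iff.rfl

theorem momentumKer_sum (π : E →L[ℝ] P) {n : ℕ} (b : momentumKer π n) :
    ∑ i, π ((b : PiLp 2 fun _ : Fin n => E) i) = 0 := b.2

theorem sum_stat (π : E →L[ℝ] P) {n : ℕ} (a : Fin n → E) :
    ∑ i, stat π (a i) = WithLp.toLp 2 (∑ i, π (a i), ∑ i, ‖a i‖ ^ 2 - n) := by
  have h : ∀ i, stat π (a i) = (WithLp.linearEquiv 2 ℝ (P × ℝ)).symm (π (a i), ‖a i‖ ^ 2 - 1) :=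
    fun _ => rfl
  simp_rw [h]
  rw [← map_sum]
  refine congrArg _ (Prod.ext ?_ ?_)
  · rw [Prod.fst_sum]
  · rw [Prod.snd_sum, Finset.sum_sub_distrib]
    simp

theorem nontrivial_momentumKer [Nontrivial E] (π : E →L[ℝ] P) {n : ℕ} (hn : 2 ≤ n) :
    Nontrivial (momentumKer π n) := by
  obtain ⟨x, hx⟩ := exists_ne (0 : E)
  obtain ⟨n, rfl⟩ : ∃ k, n = k + 2 := ⟨n - 2, by omega⟩
  refine ⟨⟨⟨WithLp.toLp 2 (Fin.cons x (Fin.cons (-x) 0)), ?_⟩, 0, fun h => hx ?_⟩⟩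
  · rw [mem_momentumKer, Fin.sum_univ_succ, Fin.sum_univ_succ]
    simp
  · have := congrArg (fun b : momentumKer π (n + 2) => (b : PiLp 2 fun _ : Fin (n + 2) => E) 0) h
    simpa using this

variable [FiniteDimensional ℝ E] [FiniteDimensional ℝ P]
variable {π : E →L[ℝ] P} (hπ : ∀ p, π (adjoint π p) = p)
include hπ

theorem norm_adjoint_sq (p : P) : ‖adjoint π p‖ ^ 2 = ‖p‖ ^ 2 := by
  rw [← real_inner_self_eq_norm_sq, ContinuousLinearMap.adjoint_inner_left, hπ,
    real_inner_self_eq_norm_sq]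

/-- Splitting off the total momentum. -/
theorem sum_norm_add_adjoint_sq {n : ℕ} (hn : n ≠ 0) (p : P) (b : momentumKer π n) :
    ∑ i, ‖(b : PiLp 2 fun _ : Fin n => E) i + (n : ℝ)⁻¹ • adjoint π p‖ ^ 2
      = ‖p‖ ^ 2 / n + ‖b‖ ^ 2 := by
  have hn' : (n : ℝ) ≠ 0 := by exact_mod_cast hn
  have h1 : ‖b‖ ^ 2 = ∑ i, ‖(b : PiLp 2 fun _ : Fin n => E) i‖ ^ 2 := by
    rw [← PiLp.norm_sq_eq_of_L2]; rfl
  simp_rw [norm_add_sq_real]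
  rw [Finset.sum_add_distrib, Finset.sum_add_distrib, ← Finset.mul_sum, h1]
  have h2 : ∑ i, ⟪(b : PiLp 2 fun _ : Fin n => E) i, (n : ℝ)⁻¹ • adjoint π p⟫ = 0 := by
    simp_rw [inner_smul_right, ContinuousLinearMap.adjoint_inner_right]
    rw [← Finset.mul_sum, ← sum_inner, momentumKer_sum, inner_zero_left, mul_zero]
  rw [h2, norm_smul, mul_pow, norm_adjoint_sq hπ]
  simp
  field_simp
  ring

theorem sum_proj_add_adjoint {n : ℕ} (hn : n ≠ 0) (p : P) (b : momentumKer π n) :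
    ∑ i, π ((b : PiLp 2 fun _ : Fin n => E) i + (n : ℝ)⁻¹ • adjoint π p) = p := by
  have hn' : (n : ℝ) ≠ 0 := by exact_mod_cast hn
  simp_rw [map_add, map_smul, hπ]
  rw [Finset.sum_add_distrib, momentumKer_sum, zero_add, Finset.sum_const, Finset.card_univ,
    Fintype.card_fin, ← Nat.cast_smul_eq_nsmul ℝ, smul_smul, mul_inv_cancel₀ hn', one_smul]

/-- Coordinates on `n` velocities: the total momentum and the part with zero momentum. -/
theorem exists_momentum_equiv {n : ℕ} (hn : n ≠ 0) :
    ∃ L : (P × momentumKer π n) ≃L[ℝ] (Fin n → E), ∀ p b i,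
      L (p, b) i = (b : PiLp 2 fun _ : Fin n => E) i + (n : ℝ)⁻¹ • adjoint π p := by
  let T : (P × momentumKer π n) →ₗ[ℝ] (Fin n → E) :=
    { toFun := fun x i => (x.2 : PiLp 2 fun _ : Fin n => E) i + (n : ℝ)⁻¹ • adjoint π x.1
      map_add' := fun x y => by
        ext1 i
        simp only [Prod.snd_add, Submodule.coe_add, PiLp.add_apply, Prod.fst_add, map_add, smul_add,
          Pi.add_apply]
        abel
      map_smul' := fun c x => by
        ext1 i
        simp only [Prod.smul_snd, Submodule.coe_smul, PiLp.smul_apply, Prod.smul_fst, map_smul,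
          RingHom.id_apply, Pi.smul_apply, smul_add]
        rw [smul_comm] }
  have hT : ∀ x i, T x i = (x.2 : PiLp 2 fun _ : Fin n => E) i + (n : ℝ)⁻¹ • adjoint π x.1 :=
    fun _ _ => rfl
  have hp : ∀ x, ∑ i, π (T x i) = x.1 := fun x => sum_proj_add_adjoint hπ hn x.1 x.2
  have hinj : Function.Injective T := by
    intro x y hxy
    have h1 : x.1 = y.1 := by rw [← hp x, ← hp y, hxy]
    refine Prod.ext h1 (Subtype.ext (PiLp.ext fun i => ?_))
    have := congrFun hxy i
    rw [hT, hT, h1] at this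
    exact add_right_cancel this
  have hn' : (n : ℝ) ≠ 0 := by exact_mod_cast hn
  have hsurj : Function.Surjective T := by
    intro V
    refine ⟨(∑ i, π (V i), ⟨WithLp.toLp 2 fun i => V i - (n : ℝ)⁻¹ •
      adjoint π (∑ i, π (V i)), ?_⟩), ?_⟩
    · rw [mem_momentumKer]
      simp_rw [map_sub, map_smul, hπ]
      rw [Finset.sum_sub_distrib, Finset.sum_const, Finset.card_univ,
        Fintype.card_fin, ← Nat.cast_smul_eq_nsmul ℝ, smul_smul, mul_inv_cancel₀ hn', one_smul,
        sub_self]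
    · ext1 i
      rw [hT]
      simp
  exact ⟨(LinearEquiv.ofBijective T ⟨hinj, hsurj⟩).toContinuousLinearEquiv, fun p b i => rfl⟩

theorem finrank_momentumKer {n : ℕ} (hn : n ≠ 0) :
    Module.finrank ℝ P + Module.finrank ℝ (momentumKer π n) = n * Module.finrank ℝ E := by
  obtain ⟨L, -⟩ := exists_momentum_equiv hπ hn
  have := L.toLinearEquiv.finrank_eq
  rw [Module.finrank_prod, Module.finrank_pi_fintype] at this
  simpa using this

/-- Coordinates on the vectors of `N` velocities with zero momentum: the velocities of a block, and
the part with zero momentum of the remaining ones. -/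
theorem exists_block_equiv {H : Type*} [NormedAddCommGroup H] [InnerProductSpace ℝ H]
    [FiniteDimensional ℝ H] {N m n : ℕ} (hn : n ≠ 0) (e : Fin m ⊕ Fin n ≃ Fin N)
    (j : H →ₗ[ℝ] (Fin N → E)) (hjn : ∀ h, ‖h‖ ^ 2 = ∑ i, ‖j h i‖ ^ 2)
    (hjr : ∀ V, V ∈ LinearMap.range j ↔ ∑ i, π (V i) = 0) :
    ∃ L : ((Fin m → E) × momentumKer π n) ≃L[ℝ] H,
      (∀ a b i, j (L (a, b)) (e (Sum.inl i)) = a i) ∧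
      ∀ a b k, j (L (a, b)) (e (Sum.inr k)) =
        (b : PiLp 2 fun _ : Fin n => E) k + (n : ℝ)⁻¹ • adjoint π (-∑ i, π (a i)) := by
  have hn' : (n : ℝ) ≠ 0 := by exact_mod_cast hn
  have hsum : ∀ V : Fin N → E, ∑ i, π (V i) =
      ∑ i, π (V (e (Sum.inl i))) + ∑ k, π (V (e (Sum.inr k))) := fun V => by
    rw [← e.sum_comp, Fintype.sum_sum_type]
  -- The remaining velocities carry the opposite of the block's momentum; adding to each of them an
  -- `n`-th of the block's momentum recentres them. The map sought is the inverse of `T`.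
  let T : H →ₗ[ℝ] ((Fin m → E) × momentumKer π n) :=
    { toFun := fun h => (fun i => j h (e (Sum.inl i)), ⟨WithLp.toLp 2 fun k =>
          j h (e (Sum.inr k)) + (n : ℝ)⁻¹ • adjoint π (∑ i, π (j h (e (Sum.inl i)))), by
        have h1 := (hjr (j h)).1 ⟨h, rfl⟩
        rw [hsum] at h1
        rw [mem_momentumKer]
        simp_rw [map_add, map_smul, hπ]
        rw [Finset.sum_add_distrib, Finset.sum_const, Finset.card_univ,
          Fintype.card_fin, ← Nat.cast_smul_eq_nsmul ℝ, smul_smul, mul_inv_cancel₀ hn', one_smul,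
          add_comm, h1]⟩)
      map_add' := fun x y => by
        refine Prod.ext ?_ (Subtype.ext (PiLp.ext fun i => ?_))
        · ext1 i; simp
        · simp [Finset.sum_add_distrib]; abel
      map_smul' := fun c x => by
        refine Prod.ext ?_ (Subtype.ext (PiLp.ext fun i => ?_))
        · ext1 i; simp
        · simp [← Finset.smul_sum, smul_comm c] }
  have hT1 : ∀ h i, (T h).1 i = j h (e (Sum.inl i)) := fun _ _ => rfl
  have hT2 : ∀ h k, ((T h).2 : PiLp 2 fun _ : Fin n => E) k =
      j h (e (Sum.inr k)) + (n : ℝ)⁻¹ • adjoint π (∑ i, π ((T h).1 i)) := fun _ _ => rfl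
  have hT2' : ∀ h k, j h (e (Sum.inr k)) = ((T h).2 : PiLp 2 fun _ : Fin n => E) k +
      (n : ℝ)⁻¹ • adjoint π (-∑ i, π ((T h).1 i)) := fun h k => by
    rw [hT2, map_neg, smul_neg, add_neg_cancel_right]
  have hinj : Function.Injective T := by
    rw [← LinearMap.ker_eq_bot, LinearMap.ker_eq_bot']
    intro h hh
    have : ∀ i, j h i = 0 := by
      intro i
      obtain ⟨x, rfl⟩ := e.surjective i
      rcases x with i | k
      · rw [← hT1, hh]; rfl
      · rw [hT2', hh]; simp
    have h2 := hjn h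
    simp only [this, norm_zero] at h2
    simpa using h2
  have hsurj : Function.Surjective T := by
    rintro ⟨a, b⟩
    set V : Fin N → E := fun i => Sum.elim a (fun k => (b : PiLp 2 fun _ : Fin n => E) k +
      (n : ℝ)⁻¹ • adjoint π (-∑ i, π (a i))) (e.symm i) with hV
    have hVr : V ∈ LinearMap.range j := by
      rw [hjr, hsum]
      simp only [hV, Equiv.symm_apply_apply, Sum.elim_inl, Sum.elim_inr]
      rw [sum_proj_add_adjoint hπ hn, add_neg_cancel]
    obtain ⟨h, hh⟩ := hVr
    refine ⟨h, ?_⟩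
    have h1 : (T h).1 = a := by
      ext1 i
      rw [hT1, hh, hV]; simp
    refine Prod.ext h1 (Subtype.ext (PiLp.ext fun k => ?_))
    rw [hT2, h1, hh, hV]
    simp
  refine ⟨(LinearEquiv.ofBijective T ⟨hinj, hsurj⟩).symm.toContinuousLinearEquiv,
    fun a b i => ?_, fun a b k => ?_⟩
  · have := LinearEquiv.apply_symm_apply (LinearEquiv.ofBijective T ⟨hinj, hsurj⟩) (a, b)
    have h := hT1 ((LinearEquiv.ofBijective T ⟨hinj, hsurj⟩).symm (a, b)) i
    rw [← LinearEquiv.ofBijective_apply T (hf := ⟨hinj, hsurj⟩), this] at h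
    exact h.symm
  · have := LinearEquiv.apply_symm_apply (LinearEquiv.ofBijective T ⟨hinj, hsurj⟩) (a, b)
    have h := hT2' ((LinearEquiv.ofBijective T ⟨hinj, hsurj⟩).symm (a, b)) k
    rw [← LinearEquiv.ofBijective_apply T (hf := ⟨hinj, hsurj⟩), this] at h
    exact h

end Momentum

/-! ### Density of the momentum and energy of a block -/

section BlockDensity

open scoped RealInnerProductSpace
open ContinuousLinearMap (adjoint)

variable {E P : Type*} [NormedAddCommGroup E] [InnerProductSpace ℝ E] [FiniteDimensional ℝ E]
  [MeasurableSpace E] [BorelSpace E]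
  [NormedAddCommGroup P] [InnerProductSpace ℝ P] [FiniteDimensional ℝ P]
  [MeasurableSpace P] [BorelSpace P] {π : E →L[ℝ] P}

/-- The integral of `g` over the vectors of `n` velocities with given momentum `p` and energy `t`,
up to a constant factor. -/
noncomputable def blockDensity (π : E →L[ℝ] P) {n : ℕ} (g : (Fin n → E) → ℝ≥0∞) (p : P) (t : ℝ) :
    ℝ≥0∞ :=
  halfPow (Module.finrank ℝ (momentumKer π n) / 2 - 1) (t - ‖p‖ ^ 2 / n) *
    ∫⁻ u, g (fun i => ((√(t - ‖p‖ ^ 2 / n) • (u : momentumKer π n) : momentumKer π n) :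
      PiLp 2 fun _ : Fin n => E) i + (n : ℝ)⁻¹ • adjoint π p)
      ∂(volume : Measure (momentumKer π n)).toSphere

variable (hπ : ∀ p, π (adjoint π p) = p)
include hπ

theorem measurable_blockDensity {n : ℕ} (hn : n ≠ 0) {g : (Fin n → E) → ℝ≥0∞} (hg : Measurable g) :
    Measurable fun x : P × ℝ => blockDensity π g x.1 x.2 := by
  obtain ⟨L, hL⟩ := exists_momentum_equiv hπ hn
  have h := measurable_lintegral_sphere_fiber L
    (q := fun p : P => ‖p‖ ^ 2 / n) (by fun_prop) hg
  refine ((measurable_halfPow _).comp (by fun_prop)).mul ?_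
  have h2 : ∀ x b, L (x, b) = fun i => (b : PiLp 2 fun _ : Fin n => E) i + (n : ℝ)⁻¹ • adjoint π x :=
    fun x b => funext fun i => hL x b i
  simp only [h2] at h
  exact h

/-- The law of the momentum and the energy of a block of velocities. -/
theorem exists_lintegral_sum_stat [Nontrivial E] {n : ℕ} (hn : 2 ≤ n) :
    ∃ κ : ℝ≥0∞, κ ≠ 0 ∧ κ ≠ ∞ ∧ ∀ (g : (Fin n → E) → ℝ≥0∞) (Ψ : WithLp 2 (P × ℝ) → ℝ≥0∞),
      Measurable g → Measurable Ψ → ∫⁻ b, Ψ (∑ i, stat π (b i)) * g b =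
        κ * ∫⁻ y : WithLp 2 (P × ℝ), Ψ y * blockDensity π g y.fst (y.snd + n) := by
  have hn0 : n ≠ 0 := by omega
  have := nontrivial_momentumKer π hn
  obtain ⟨L, hL⟩ := exists_momentum_equiv hπ hn0
  obtain ⟨κ, h0, h1, hκ⟩ := exists_lintegral_sphere_fibration L (fun p : P => ‖p‖ ^ 2 / n)
  refine ⟨κ, h0, h1, fun g Ψ hg hΨ => ?_⟩
  have hΨm : Measurable fun b : Fin n → E => Ψ (∑ i, stat π (b i)) :=
    hΨ.comp (Finset.measurable_fun_sum _ fun i _ => (measurable_stat π).comp (measurable_pi_apply i))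
  have hbm : Measurable fun y : P × ℝ => Ψ (WithLp.toLp 2 y) * blockDensity π g y.1 (y.2 + n) :=
    (hΨ.comp (WithLp.measurable_toLp 2 _)).mul ((measurable_blockDensity hπ hn0 hg).comp
      (measurable_fst.prodMk (measurable_snd.add_const _)))
  rw [hκ (fun b => Ψ (∑ i, stat π (b i)) * g b) (hΨm.mul hg)]
  congr 1
  have h2 : ∫⁻ y : WithLp 2 (P × ℝ), Ψ y * blockDensity π g y.fst (y.snd + n) =
      ∫⁻ y : P × ℝ, Ψ (WithLp.toLp 2 y) * blockDensity π g y.1 (y.2 + n) :=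
    (WithLp.volume_preserving_ofLp P ℝ).lintegral_comp hbm
  rw [h2, Measure.volume_eq_prod, lintegral_prod _ hbm.aemeasurable]
  refine lintegral_congr fun p => ?_
  rw [← lintegral_sub_right_eq_self (fun t => Ψ (WithLp.toLp 2 (p, t)) *
    blockDensity π g p (t + n)) (n : ℝ)]
  refine lintegral_congr fun t => ?_
  simp only [sub_add_cancel]
  rw [blockDensity, mul_left_comm]
  rcases le_or_gt (t - ‖p‖ ^ 2 / n) 0 with ht | ht
  · rw [halfPow_of_nonpos _ ht, zero_mul, zero_mul]
  congr 1
  -- Along a fiber the summed statistic is constant, so `Ψ` leaves the inner integral.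
  have h3 : ∀ u : Metric.sphere (0 : momentumKer π n) 1,
      ∑ i, stat π (L (p, √(t - ‖p‖ ^ 2 / n) • (u : momentumKer π n)) i) =
        WithLp.toLp 2 (p, t - n) := by
    intro u
    rw [sum_stat]
    simp_rw [hL]
    rw [sum_proj_add_adjoint hπ hn0, sum_norm_add_adjoint_sq hπ hn0, norm_smul, mul_pow,
      norm_eq_of_mem_sphere, Real.norm_of_nonneg (Real.sqrt_nonneg _), Real.sq_sqrt ht.le]
    congr 3
    ring
  simp_rw [h3]
  have hm4 : Measurable fun u : Metric.sphere (0 : momentumKer π n) 1 =>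
      g (L (p, √(t - ‖p‖ ^ 2 / n) • (u : momentumKer π n))) := by
    refine hg.comp (L.continuous.measurable.comp ?_)
    exact measurable_const.prodMk (measurable_subtype_coe.const_smul (√(t - ‖p‖ ^ 2 / n)))
  rw [lintegral_const_mul _ hm4]
  congr 1
  refine lintegral_congr fun u => ?_
  congr 1
  ext1 i
  rw [hL]

omit [MeasurableSpace P] [BorelSpace P] in
/-- The uniform measure on the sphere with zero momentum, in a block and its complement. -/
theorem exists_lintegral_sphere_block [Nontrivial E] {H : Type*} [NormedAddCommGroup H]
    [InnerProductSpace ℝ H] [FiniteDimensional ℝ H] [MeasurableSpace H] [BorelSpace H]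
    {N m n : ℕ} (hn : 2 ≤ n) (e : Fin m ⊕ Fin n ≃ Fin N)
    (j : H →ₗ[ℝ] (Fin N → E)) (hjn : ∀ h, ‖h‖ ^ 2 = ∑ i, ‖j h i‖ ^ 2)
    (hjr : ∀ V, V ∈ LinearMap.range j ↔ ∑ i, π (V i) = 0) :
    ∃ κ : ℝ≥0∞, κ ≠ 0 ∧ κ ≠ ∞ ∧ ∀ (Φ : (Fin m → E) → ℝ≥0∞) (g : (Fin n → E) → ℝ≥0∞),
      Measurable Φ → Measurable g →
        ∫⁻ V, Φ (fun i => V (e (Sum.inl i))) * g (fun k => V (e (Sum.inr k)))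
            ∂((sphereUniform H √N).map j) =
          κ * ∫⁻ a, Φ a * blockDensity π g (-∑ i, π (a i)) (N - ∑ i, ‖a i‖ ^ 2) := by
  have hn0 : n ≠ 0 := by omega
  have hn0' : (n : ℝ) ≠ 0 := by exact_mod_cast hn0
  have := nontrivial_momentumKer π hn
  obtain ⟨L, hL1, hL2⟩ := exists_block_equiv hπ hn0 e j hjn hjr
  have hHn : Nontrivial H := by
    obtain ⟨b, hb⟩ := exists_ne (0 : momentumKer π n)
    refine ⟨⟨L (0, b), 0, fun h => hb ?_⟩⟩
    have := (map_eq_zero_iff L L.injective).1 h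
    exact (Prod.ext_iff.1 this).2
  have hN : 0 < (N : ℝ) := by
    have h := Fintype.card_congr e
    simp only [Fintype.card_sum, Fintype.card_fin] at h
    have : 0 < N := by omega
    exact_mod_cast this
  set q : (Fin m → E) → ℝ := fun a => ∑ i, ‖a i‖ ^ 2 + ‖-∑ i, π (a i)‖ ^ 2 / n with hq
  have hqm : Measurable q := by
    have : Continuous q := by rw [hq]; fun_prop
    exact this.measurable
  have hLn : ∀ a w, ‖L (a, w)‖ ^ 2 = q a + ‖w‖ ^ 2 := by
    intro a w
    rw [hjn, ← e.sum_comp, Fintype.sum_sum_type]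
    simp_rw [hL1, hL2]
    rw [sum_norm_add_adjoint_sq hπ hn0, hq, add_assoc]
  have hqs : ∀ (c : ℝ) a, q (c • a) = c ^ 2 * q a := by
    intro c a
    simp only [hq, Pi.smul_apply, norm_smul, mul_pow, map_smul, norm_neg, ← Finset.smul_sum,
      Real.norm_eq_abs, sq_abs, ← Finset.mul_sum]
    ring
  have : (volume : Measure (Fin m → E)).IsAddHaarMeasure := by
    rw [volume_pi]; infer_instance
  obtain ⟨κ, h0, h1, hκ⟩ := exists_lintegral_toSphere L hqm hqs
    (fun a => by rw [hq]; positivity) hLn hN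
  have hs0 : (volume : Measure H).toSphere Set.univ ≠ 0 := by
    rw [Ne, Measure.measure_univ_eq_zero]; exact Measure.toSphere_ne_zero _
  have hst : (volume : Measure H).toSphere Set.univ ≠ ∞ := measure_ne_top _ _
  refine ⟨((volume : Measure H).toSphere Set.univ)⁻¹ * κ,
    mul_ne_zero (ENNReal.inv_ne_zero.2 hst) h0, ENNReal.mul_ne_top (ENNReal.inv_ne_top.2 hs0) h1,
    fun Φ g hΦ hg => ?_⟩
  have hjm : Measurable j := j.continuous_of_finiteDimensional.measurable
  have hVm : Measurable fun V : Fin N → E =>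
      Φ (fun i => V (e (Sum.inl i))) * g (fun k => V (e (Sum.inr k))) :=
    (hΦ.comp (by fun_prop)).mul (hg.comp (by fun_prop))
  rw [lintegral_map hVm hjm, sphereUniform, lintegral_smul_measure,
    lintegral_map (f := fun h => Φ (fun i => j h (e (Sum.inl i))) *
      g (fun k => j h (e (Sum.inr k))))
      (g := fun u : Metric.sphere (0 : H) 1 => √(N : ℝ) • (u : H)) (hVm.comp hjm) (measurable_subtype_coe.const_smul √(N : ℝ)),
    hκ (fun h => Φ (fun i => j h (e (Sum.inl i))) * g (fun k => j h (e (Sum.inr k))))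
      (hVm.comp hjm), smul_eq_mul, mul_assoc]
  congr 2
  refine lintegral_congr fun a => ?_
  -- The energy left on the fiber is `N` minus the block's energy and minus the energy of the
  -- compensating momentum. This is the argument of `halfPow` in `blockDensity` for the complement.
  have h5 : (N : ℝ) - ∑ i, ‖a i‖ ^ 2 - ‖-∑ i, π (a i)‖ ^ 2 / n = N - q a := by
    rw [hq]; ring
  rw [blockDensity, h5, mul_left_comm]
  congr 1
  simp_rw [hL1, hL2]
  rw [lintegral_const_mul]
  have := hg.comp (f := fun u : Metric.sphere (0 : momentumKer π n) 1 => fun k =>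
    j (L (a, √(N - q a) • (u : momentumKer π n))) (e (Sum.inr k))) (by
      have h6 : Measurable fun u : Metric.sphere (0 : momentumKer π n) 1 =>
          j (L (a, √(N - q a) • (u : momentumKer π n))) :=
        hjm.comp (L.continuous.measurable.comp
          (measurable_const.prodMk (measurable_subtype_coe.const_smul √(N - q a))))
      fun_prop)
  simp only [Function.comp_def, hL2] at this
  exact this

end BlockDensity

/-! ### Gaussian averages of a linearly growing weight -/

section Gaussian

variable (F : Type*) [NormedAddCommGroup F] [InnerProductSpace ℝ F] [FiniteDimensional ℝ F]
  [MeasurableSpace F] [BorelSpace F]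

theorem lintegral_exp_mul_one_add_enorm_lt_top :
    ∫⁻ x : F, ENNReal.ofReal (Real.exp (-(1 / 2) * ‖x‖ ^ 2)) * (1 + ‖x‖ₑ) < ∞ := by
  have hg : Integrable fun x : F => Real.exp (-(1 / 4) * ‖x‖ ^ 2) := by
    have := (GaussianFourier.integrable_cexp_neg_mul_sq_norm_add
      (b := ((1 / 4 : ℝ) : ℂ)) (by rw [Complex.ofReal_re]; positivity) 0 (0 : F)).norm
    refine this.congr (ae_of_all _ fun ζ => ?_)
    simp only [zero_mul, add_zero]
    rw [Complex.norm_exp]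
    norm_cast
  refine lt_of_le_of_lt (lintegral_mono fun x => ?_) (hg.const_mul 2).lintegral_lt_top
  have h1 : (1 + ‖x‖ₑ : ℝ≥0∞) = ENNReal.ofReal (1 + ‖x‖) := by
    rw [ENNReal.ofReal_add zero_le_one (norm_nonneg _), ENNReal.ofReal_one, ofReal_norm]
  rw [h1, ← ENNReal.ofReal_mul (Real.exp_pos _).le]
  refine ENNReal.ofReal_le_ofReal ?_
  have h2 : Real.exp (-(1 / 2) * ‖x‖ ^ 2) =
      Real.exp (-(1 / 4) * ‖x‖ ^ 2) * Real.exp (-(1 / 4 * ‖x‖ ^ 2)) := by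
    rw [← Real.exp_add]; congr 1; ring
  have h3 : Real.exp (-(1 / 4 * ‖x‖ ^ 2)) * (1 + ‖x‖) ≤ 2 := by
    rw [Real.exp_neg, inv_mul_le_iff₀ (Real.exp_pos _)]
    have := Real.add_one_le_exp (1 / 4 * ‖x‖ ^ 2)
    nlinarith [sq_nonneg (‖x‖ - 1)]
  rw [h2, mul_assoc, mul_comm (2 : ℝ)]
  exact mul_le_mul_of_nonneg_left h3 (Real.exp_pos _).le

/-- The substitution `y = c + ε x` extracts `ε^D`, and `ε ≤ 1` bounds the weight by `(1 + ‖x‖)(1 +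
‖c‖)`, whatever `ε` is. -/
theorem exists_lintegral_gaussian_mul_le :
    ∃ C : ℝ≥0∞, C ≠ ∞ ∧ ∀ (c : F) (ε : ℝ), 0 < ε → ε ≤ 1 →
      ∫⁻ y, ENNReal.ofReal (Real.exp (-(1 / (2 * ε ^ 2)) * ‖y - c‖ ^ 2)) * (1 + ‖y‖ₑ)
        ≤ C * (1 + ‖c‖ₑ) * ENNReal.ofReal (ε ^ Module.finrank ℝ F) := by
  refine ⟨_, (lintegral_exp_mul_one_add_enorm_lt_top F).ne, fun c ε hε hε1 => ?_⟩
  rw [← lintegral_add_right_eq_self _ c]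
  simp only [add_sub_cancel_right]
  rw [lintegral_eq_mul_lintegral_smul hε (by fun_prop), mul_comm]
  gcongr
  rw [← lintegral_mul_const _ (by fun_prop)]
  refine lintegral_mono fun x => ?_
  rw [mul_assoc]
  refine mul_le_mul' (ENNReal.ofReal_le_ofReal (le_of_eq ?_)) ?_
  · congr 1
    rw [norm_smul, Real.norm_of_nonneg hε.le]
    field_simp
  · have h1 : ‖ε • x + c‖ₑ ≤ ‖x‖ₑ + ‖c‖ₑ := by
      refine (enorm_add_le _ _).trans (by
        gcongr
        rw [enorm_smul]
        calc ‖ε‖ₑ * ‖x‖ₑ ≤ 1 * ‖x‖ₑ := by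
              gcongr
              rw [← ofReal_norm, Real.norm_of_nonneg hε.le]
              exact ENNReal.ofReal_le_one.2 hε1
          _ = _ := one_mul _)
    calc (1 + ‖ε • x + c‖ₑ : ℝ≥0∞) ≤ 1 + (‖x‖ₑ + ‖c‖ₑ) := by gcongr
      _ ≤ 1 + (‖x‖ₑ + ‖c‖ₑ) + ‖x‖ₑ * ‖c‖ₑ := le_self_add
      _ = _ := by ring

end Gaussian

/-! ### Small ball estimate for two statistics -/

section StatSmallBall

open ContinuousLinearMap (adjoint)

variable {E P : Type*} [NormedAddCommGroup E] [InnerProductSpace ℝ E] [FiniteDimensional ℝ E]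
  [MeasurableSpace E] [BorelSpace E]
  [NormedAddCommGroup P] [InnerProductSpace ℝ P] [FiniteDimensional ℝ P]
  [MeasurableSpace P] [BorelSpace P] {π : E →L[ℝ] P}

/-- One statistic lives on a paraboloid: under Lebesgue measure its density is unbounded for Kac and
does not exist for Boltzmann. The sum of two has a density proportional to the power `β = (2 dim E -
dim P)/2 - 1` of the residual energy, and the two dimension bounds say that `0 ≤ β ≤ 1`, hence local
boundedness and at most linear growth. Kac has `β = 0` and Boltzmann `β = 1/2`. -/
theorem exists_smallBall_stat [Nontrivial E] (hπ : ∀ p, π (adjoint π p) = p)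
    (hd1 : 2 + Module.finrank ℝ P ≤ 2 * Module.finrank ℝ E)
    (hd2 : 2 * Module.finrank ℝ E ≤ 4 + Module.finrank ℝ P) :
    ∃ C : ℝ≥0∞, C ≠ ∞ ∧ SmallBall (stat π) C := by
  obtain ⟨κ, -, hκ, hint⟩ := exists_lintegral_sum_stat hπ (le_refl 2)
  obtain ⟨C, hC, hG⟩ := exists_lintegral_gaussian_mul_le (WithLp 2 (P × ℝ))
  set ω := (volume : Measure (momentumKer π 2)).toSphere Set.univ with hω
  have hωt : ω ≠ ∞ := measure_ne_top _ _
  set β : ℝ := Module.finrank ℝ (momentumKer π 2) / 2 - 1 with hβ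
  have hfr := finrank_momentumKer hπ (two_ne_zero)
  have hβ0 : 0 ≤ β := by
    have : 2 ≤ Module.finrank ℝ (momentumKer π 2) := by omega
    have : (2 : ℝ) ≤ Module.finrank ℝ (momentumKer π 2) := by exact_mod_cast this
    rw [hβ]; linarith
  have hβ1 : β ≤ 1 := by
    have : Module.finrank ℝ (momentumKer π 2) ≤ 4 := by omega
    have : (Module.finrank ℝ (momentumKer π 2) : ℝ) ≤ 4 := by exact_mod_cast this
    rw [hβ]; linarith
  have hbd : ∀ y : WithLp 2 (P × ℝ), blockDensity π (n := 2) (fun _ => 1) y.fst (y.snd + (2 : ℕ)) ≤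
      ω * 3 * (1 + ‖y‖ₑ) := by
    intro y
    rw [blockDensity, lintegral_one, mul_comm, mul_assoc]
    gcongr
    have h1 : (3 * (1 + ‖y‖ₑ) : ℝ≥0∞) = ENNReal.ofReal (3 * (1 + ‖y‖)) := by
      rw [ENNReal.ofReal_mul (by norm_num), ENNReal.ofReal_add zero_le_one (norm_nonneg _),
        ENNReal.ofReal_one, ofReal_norm]
      norm_num
    rw [h1]
    set x := y.snd + (2 : ℕ) - ‖y.fst‖ ^ 2 / (2 : ℕ) with hx
    rcases le_or_gt x 0 with h0 | h0
    · rw [halfPow_of_nonpos _ h0]; exact zero_le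
    · rw [halfPow_of_pos _ h0]
      refine ENNReal.ofReal_le_ofReal ?_
      have h2 : x ≤ 2 + ‖y‖ := by
        have h3 : ‖y.snd‖ ≤ ‖y‖ := by
          refine (sq_le_sq₀ (norm_nonneg _) (norm_nonneg _)).1 ?_
          rw [WithLp.prod_norm_sq_eq_of_L2]
          linarith [sq_nonneg ‖y.fst‖]
        have h4 := le_abs_self y.snd
        rw [Real.norm_eq_abs] at h3
        have h5 : 0 ≤ ‖y.fst‖ ^ 2 / (2 : ℕ) := by positivity
        rw [hx]; push_cast at *; linarith
      have h3 : (1 : ℝ) ≤ 2 + ‖y‖ := by linarith [norm_nonneg y]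
      have h4 : x ^ β ≤ 2 + ‖y‖ := by
        calc x ^ β ≤ (2 + ‖y‖) ^ β := Real.rpow_le_rpow h0.le h2 hβ0
          _ ≤ (2 + ‖y‖) ^ (1 : ℝ) := Real.rpow_le_rpow_of_exponent_le h3 hβ1
          _ = _ := Real.rpow_one _
      linarith [norm_nonneg y]
  refine ⟨κ * (ω * 3) * C, by finiteness, fun c ε hε hε1 => ?_⟩
  set Ψ : WithLp 2 (P × ℝ) → ℝ≥0∞ := fun y =>
    ENNReal.ofReal (Real.exp (-(1 / (2 * ε ^ 2)) * ‖y - c‖ ^ 2)) with hΨ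
  have hΨm : Measurable Ψ := by rw [hΨ]; fun_prop
  have hm : Measurable fun x : E × E => Ψ (stat π x.1 + stat π x.2) :=
    hΨm.comp (((measurable_stat π).comp measurable_fst).add ((measurable_stat π).comp measurable_snd))
  have h1 : ∫⁻ v, ∫⁻ w, Ψ (stat π v + stat π w) = ∫⁻ b : Fin 2 → E, Ψ (∑ i, stat π (b i)) * 1 := by
    have := (volume_preserving_finTwoArrow E).lintegral_comp hm
    rw [Measure.volume_eq_prod, lintegral_prod _ hm.aemeasurable] at this
    rw [← this]
    refine lintegral_congr fun b => ?_
    rw [mul_one, Fin.sum_univ_two]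
    rfl
  calc _ = ∫⁻ v, ∫⁻ w, Ψ (stat π v + stat π w) := rfl
    _ = κ * ∫⁻ y : WithLp 2 (P × ℝ), Ψ y *
          blockDensity π (n := 2) (fun _ => 1) y.fst (y.snd + (2 : ℕ)) := by
        rw [h1, hint (fun _ => 1) Ψ measurable_const hΨm]
    _ ≤ κ * ∫⁻ y : WithLp 2 (P × ℝ), ω * 3 * (Ψ y * (1 + ‖y‖ₑ)) := by
        gcongr κ * ?_
        refine lintegral_mono fun y => ?_
        rw [mul_left_comm]
        exact mul_le_mul_right (hbd y) _
    _ = κ * (ω * 3) * ∫⁻ y : WithLp 2 (P × ℝ), Ψ y * (1 + ‖y‖ₑ) := by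
        rw [lintegral_const_mul' (ω * 3) _ (by finiteness), mul_assoc κ]
    _ ≤ κ * (ω * 3) * (C * (1 + ‖c‖ₑ) * ENNReal.ofReal (ε ^ Module.finrank ℝ _)) := by
        gcongr
        exact hG c ε hε hε1
    _ = _ := by ring

end StatSmallBall

/-! ### Product densities -/

section TensorPower

variable {E : Type*} [MeasureSpace E] [SigmaFinite (volume : Measure E)]

theorem lintegral_fin_prod (n : ℕ) {g : Fin n → E → ℝ≥0∞} (hg : ∀ i, Measurable (g i)) :
    ∫⁻ x : Fin n → E, ∏ i, g i (x i) = ∏ i, ∫⁻ v, g i v := by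
  induction n with
  | zero => simp [volume_pi]
  | succ n ih =>
    have hm : Measurable fun y : E × (Fin n → E) => g 0 y.1 * ∏ i : Fin n, g i.succ (y.2 i) :=
      ((hg 0).comp measurable_fst).mul (Finset.measurable_fun_prod _ fun i _ =>
        (hg i.succ).comp (by fun_prop))
    have h := (volume_preserving_piFinSuccAbove (fun _ : Fin (n + 1) => E) 0).lintegral_comp hm
    rw [Fin.prod_univ_succ, ← ih fun i => hg i.succ, ← lintegral_prod_mul (hg 0).aemeasurable
      (Finset.measurable_fun_prod _ fun i _ => (hg i.succ).comp (by fun_prop)).aemeasurable,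
      ← Measure.volume_eq_prod, ← h]
    refine lintegral_congr fun x => ?_
    rw [Fin.prod_univ_succ]
    rfl

theorem tensorPower_eq_withDensity {f : ProbabilityMeasure E} {ρ : E → ℝ≥0∞} (hρ : Measurable ρ)
    (hf : (f : Measure E) = volume.withDensity ρ) (n : ℕ) :
    tensorPower f n = volume.withDensity fun x => ∏ i, ρ (x i) := by
  refine Measure.pi_eq fun s hs => ?_
  rw [withDensity_apply _ (MeasurableSet.univ_pi hs), ← lintegral_indicator (MeasurableSet.univ_pi hs)]
  have h1 : ∀ x : Fin n → E, (Set.univ.pi s).indicator (fun x => ∏ i, ρ (x i)) x =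
      ∏ i, (s i).indicator ρ (x i) := by
    intro x
    by_cases hx : x ∈ Set.univ.pi s
    · rw [Set.indicator_of_mem hx]
      exact Finset.prod_congr rfl fun i _ => (Set.indicator_of_mem (hx i trivial) _).symm
    · rw [Set.indicator_of_notMem hx]
      simp only [Set.mem_pi, Set.mem_univ, true_implies, not_forall] at hx
      obtain ⟨i, hi⟩ := hx
      exact (Finset.prod_eq_zero (Finset.mem_univ i) (Set.indicator_of_notMem hi _)).symm
  simp_rw [h1]
  rw [lintegral_fin_prod n fun i => hρ.indicator (hs i)]
  refine Finset.prod_congr rfl fun i _ => ?_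
  rw [lintegral_indicator (hs i), hf, withDensity_apply _ (hs i)]

end TensorPower

/-! ### Law of the summed statistics -/

section BlockLaw

open ContinuousLinearMap (adjoint)
open scoped Topology

variable {E P : Type*} [NormedAddCommGroup E] [InnerProductSpace ℝ E] [FiniteDimensional ℝ E]
  [MeasurableSpace E] [BorelSpace E]
  [NormedAddCommGroup P] [InnerProductSpace ℝ P] [FiniteDimensional ℝ P]
  [MeasurableSpace P] [BorelSpace P] {π : E →L[ℝ] P}

/-- The sum of the statistics of a block of velocities. -/
def sumStat (π : E →L[ℝ] P) {n : ℕ} (a : Fin n → E) : WithLp 2 (P × ℝ) := ∑ i, stat π (a i)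

omit [FiniteDimensional ℝ E] in
theorem measurable_sumStat (π : E →L[ℝ] P) (n : ℕ) : Measurable (sumStat π (n := n)) :=
  Finset.measurable_fun_sum _ fun i _ => (measurable_stat π).comp (measurable_pi_apply i)

instance (f : ProbabilityMeasure E) : IsProbabilityMeasure ((f : Measure E).map (stat π)) :=
  Measure.isProbabilityMeasure_map (measurable_stat π).aemeasurable

instance (f : ProbabilityMeasure E) (n : ℕ) :
    IsProbabilityMeasure ((tensorPower f n).map (sumStat π)) :=
  Measure.isProbabilityMeasure_map (measurable_sumStat π n).aemeasurable

omit [FiniteDimensional ℝ E] in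
theorem charFun_map_sumStat (f : ProbabilityMeasure E) (n : ℕ) :
    charFun ((tensorPower f n).map (sumStat π)) =
      fun ζ => charFun ((f : Measure E).map (stat π)) ζ ^ n := by
  have h := charFun_map_sum_pi_eq_prod (fun _ : Fin n => (f : Measure E).map (stat π))
  have h2 : (Measure.pi fun _ : Fin n => (f : Measure E).map (stat π)) =
      (tensorPower f n).map fun a i => stat π (a i) :=
    (Measure.pi_map_pi (fun _ => (measurable_stat π).aemeasurable)).symm
  have h4 : Measurable fun (a : Fin n → E) i => stat π (a i) :=
    measurable_pi_lambda _ fun i => (measurable_stat π).comp (measurable_pi_apply i)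
  rw [h2, Measure.map_map (by fun_prop) h4] at h
  ext ζ
  have h3 := congrFun h ζ
  rw [Finset.prod_apply, Finset.prod_const, Finset.card_univ, Fintype.card_fin] at h3
  rw [← h3]
  rfl

variable (hπ : ∀ p, π (adjoint π p) = p)
include hπ

/-- The density of the statistics of a block, and the product density on the sphere in terms of
it. -/
theorem exists_density_sumStat [Nontrivial E] {f : ProbabilityMeasure E} {ρ : E → ℝ≥0∞}
    (hρ : Measurable ρ) (hf : (f : Measure E) = volume.withDensity ρ) {n : ℕ} (hn : 2 ≤ n) :
    ∃ h : WithLp 2 (P × ℝ) → ℝ≥0∞, Measurable h ∧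
      (tensorPower f n).map (sumStat π) = volume.withDensity h ∧
      ∀ {H : Type} [NormedAddCommGroup H] [InnerProductSpace ℝ H] [FiniteDimensional ℝ H]
        [MeasurableSpace H] [BorelSpace H] {N m : ℕ} (e : Fin m ⊕ Fin n ≃ Fin N)
        (j : H →ₗ[ℝ] (Fin N → E)) (_ : ∀ h, ‖h‖ ^ 2 = ∑ i, ‖j h i‖ ^ 2)
        (_ : ∀ V, V ∈ LinearMap.range j ↔ ∑ i, π (V i) = 0),
        ∃ κ : ℝ≥0∞, κ ≠ 0 ∧ κ ≠ ∞ ∧ ∀ Φ : (Fin m → E) → ℝ≥0∞, Measurable Φ →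
          ∫⁻ V, Φ (fun i => V (e (Sum.inl i))) * ∏ i, ρ (V i) ∂((sphereUniform H √N).map j) =
            κ * ∫⁻ a, Φ a * h (-sumStat π a) ∂(tensorPower f m) := by
  have hn0 : n ≠ 0 := by omega
  obtain ⟨κ, hκ0, hκt, hκ⟩ := exists_lintegral_sum_stat hπ hn
  have hprod : ∀ k, Measurable fun b : Fin k → E => ∏ i, ρ (b i) := fun k =>
    Finset.measurable_fun_prod _ fun i _ => hρ.comp (measurable_pi_apply i)
  have hbm : Measurable fun y : WithLp 2 (P × ℝ) =>
      blockDensity π (fun b : Fin n → E => ∏ i, ρ (b i)) y.fst (y.snd + n) := by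
    have h1 : Measurable fun y : P × ℝ =>
        blockDensity π (fun b : Fin n → E => ∏ i, ρ (b i)) y.1 (y.2 + n) :=
      (measurable_blockDensity hπ hn0 (hprod n)).comp
        (measurable_fst.prodMk (measurable_snd.add_const _))
    exact h1.comp (WithLp.measurable_ofLp 2 (P × ℝ))
  refine ⟨fun y => κ * blockDensity π (fun b : Fin n → E => ∏ i, ρ (b i)) y.fst (y.snd + n),
    hbm.const_mul κ, ?_, ?_⟩
  · refine Measure.ext_of_lintegral _ fun Ψ hΨ => ?_
    rw [lintegral_map hΨ (measurable_sumStat π n), tensorPower_eq_withDensity hρ hf,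
      lintegral_withDensity_eq_lintegral_mul _ (hprod n) (g := fun a => Ψ (sumStat π a))
        (hΨ.comp (measurable_sumStat π n)),
      lintegral_withDensity_eq_lintegral_mul _ (hbm.const_mul κ) hΨ]
    have h1 := hκ (fun b : Fin n → E => ∏ i, ρ (b i)) Ψ (hprod n) hΨ
    simp only [Pi.mul_apply, mul_assoc]
    rw [lintegral_const_mul' _ _ hκt]
    simp only [mul_comm _ (Ψ _)]
    rw [← h1]
    rfl
  · intro H _ _ _ _ _ N m e j hjn hjr
    -- The same `blockDensity` occurs twice: as the density of the complement's statistics, up to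
    -- `κ`, and as the weight that the sphere measure puts on a block `a`. Membership in the sphere
    -- forces the complement's sum to be `-sumStat π a`, so the weight is `h` at that point.
    obtain ⟨κ', h0', ht', hκ'⟩ := exists_lintegral_sphere_block hπ hn e j hjn hjr
    refine ⟨κ⁻¹ * κ', mul_ne_zero (ENNReal.inv_ne_zero.2 hκt) h0',
      ENNReal.mul_ne_top (ENNReal.inv_ne_top.2 hκ0) ht', fun Φ hΦ => ?_⟩
    have h1 := hκ' (fun a => Φ a * ∏ i, ρ (a i)) (fun b => ∏ i, ρ (b i)) (hΦ.mul (hprod m)) (hprod n)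
    have h2 : ∀ V : Fin N → E, Φ (fun i => V (e (Sum.inl i))) * ∏ i, ρ (V i) =
        (Φ (fun i => V (e (Sum.inl i))) * ∏ i, ρ (V (e (Sum.inl i)))) *
          ∏ k, ρ (V (e (Sum.inr k))) := by
      intro V
      rw [← e.prod_comp, Fintype.prod_sum_type, mul_assoc]
    rw [lintegral_congr h2]
    have hm : Measurable fun a : Fin m → E => blockDensity π (fun b : Fin n → E => ∏ i, ρ (b i))
        (-sumStat π a).fst ((-sumStat π a).snd + n) :=
      hbm.comp (measurable_sumStat π m).neg
    rw [h1, tensorPower_eq_withDensity hρ hf,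
      lintegral_withDensity_eq_lintegral_mul _ (hprod m) (g := fun a => Φ a * (κ * blockDensity π
        (fun b : Fin n → E => ∏ i, ρ (b i)) (-sumStat π a).fst ((-sumStat π a).snd + n)))
        (hΦ.mul (hm.const_mul κ))]
    have hN : (N : ℝ) = m + n := by
      have h := Fintype.card_congr e
      simp only [Fintype.card_sum, Fintype.card_fin] at h
      exact_mod_cast h.symm
    have h3 : ∀ a : Fin m → E, (-sumStat π a).fst = -∑ i, π (a i) ∧
        (-sumStat π a).snd + n = N - ∑ i, ‖a i‖ ^ 2 := by
      intro a
      rw [sumStat, sum_stat]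
      refine ⟨rfl, ?_⟩
      change -(∑ i, ‖a i‖ ^ 2 - (m : ℝ)) + n = N - ∑ i, ‖a i‖ ^ 2
      rw [hN]
      ring
    simp only [Pi.mul_apply, h3]
    have h4 : ∀ a : Fin m → E, (∏ i, ρ (a i)) * (Φ a * (κ * blockDensity π
        (fun b : Fin n → E => ∏ i, ρ (b i)) (-∑ i, π (a i)) (N - ∑ i, ‖a i‖ ^ 2))) =
        κ * ((Φ a * ∏ i, ρ (a i)) * blockDensity π
        (fun b : Fin n → E => ∏ i, ρ (b i)) (-∑ i, π (a i)) (N - ∑ i, ‖a i‖ ^ 2)) := fun a => by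
      ring
    simp_rw [h4]
    rw [lintegral_const_mul' _ _ hκt, ← mul_assoc, mul_right_comm κ⁻¹,
      ENNReal.inv_mul_cancel hκ0 hκt, one_mul]

/-- The characteristic function of the statistics of a velocity with a density tends to `0` at
infinity. -/
theorem tendsto_charFun_stat [Nontrivial E] {f : ProbabilityMeasure E} {ρ : E → ℝ≥0∞}
    (hρ : Measurable ρ) (hf : (f : Measure E) = volume.withDensity ρ) :
    Tendsto (charFun ((f : Measure E).map (stat π))) (cocompact _) (𝓝 0) := by
  -- A single statistic may be singular, but the sum of two has a density: Riemann-Lebesgue applies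
  -- to `φ²`, and a square root concludes.
  obtain ⟨h, hm, hh, -⟩ := exists_density_sumStat hπ hρ hf (le_refl 2)
  have h1 := tendsto_charFun_cocompact hm hh
  rw [charFun_map_sumStat] at h1
  have h2 := (h1.norm).sqrt
  simp only [norm_pow, norm_zero, Real.sqrt_zero, Real.sqrt_sq (norm_nonneg _)] at h2
  exact tendsto_zero_iff_norm_tendsto_zero.2 h2

end BlockLaw

/-! ### Moments of the statistic -/

section StatMoments

variable {E P : Type*} [NormedAddCommGroup E] [InnerProductSpace ℝ E] [FiniteDimensional ℝ E]
  [MeasurableSpace E] [BorelSpace E]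
  [NormedAddCommGroup P] [InnerProductSpace ℝ P] [FiniteDimensional ℝ P]
  [MeasurableSpace P] [BorelSpace P]

theorem integrable_norm_pow_of_lintegral_lt_top {μ : Measure E} {k : ℕ}
    (h : ∫⁻ v, ‖v‖ₑ ^ k ∂μ < ∞) : Integrable (fun v => ‖v‖ ^ k) μ := by
  refine ⟨by fun_prop, ?_⟩
  rw [hasFiniteIntegral_iff_enorm]
  refine lt_of_le_of_lt (lintegral_mono fun v => ?_) h
  rw [enorm_pow, enorm_norm]

variable (π : E →L[ℝ] P)

/-- The energy is quadratic in the velocity, so its second moment is the fourth moment of `f`; this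
is where `k ≥ 4` is used. -/
theorem memLp_stat {f : ProbabilityMeasure E} (h4 : ∫⁻ v, ‖v‖ₑ ^ 4 ∂(f : Measure E) < ∞) :
    MemLp (stat π) 2 (f : Measure E) := by
  have h1 : MemLp (fun v : E => ‖v‖ ^ 2) 2 (f : Measure E) := by
    rw [memLp_two_iff_integrable_sq (by fun_prop)]
    refine (integrable_norm_pow_of_lintegral_lt_top h4).congr (ae_of_all _ fun v => ?_)
    simp only
    ring
  have h2 : MemLp (fun v : E => (‖π‖ + 1) * (‖v‖ ^ 2 + 1)) 2 (f : Measure E) :=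
    (h1.add (memLp_const 1)).const_mul _
  refine h2.mono' (measurable_stat π).aestronglyMeasurable (ae_of_all _ fun v => ?_)
  have h3 : ‖stat π v‖ ≤ ‖π v‖ + |‖v‖ ^ 2 - 1| := by
    have h5 : ‖stat π v‖ ^ 2 = ‖π v‖ ^ 2 + |‖v‖ ^ 2 - 1| ^ 2 := WithLp.prod_norm_sq_eq_of_L2 _
    refine (sq_le_sq₀ (norm_nonneg _) (by positivity)).1 ?_
    rw [h5]
    nlinarith [mul_nonneg (norm_nonneg (π v)) (abs_nonneg (‖v‖ ^ 2 - 1))]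
  have h5 : ‖π v‖ ≤ ‖π‖ * (‖v‖ ^ 2 + 1) := (π.le_opNorm v).trans (by
    gcongr
    nlinarith [sq_nonneg (‖v‖ - 1)])
  have h6 : |‖v‖ ^ 2 - 1| ≤ ‖v‖ ^ 2 + 1 := by
    rw [abs_le]; constructor <;> nlinarith [sq_nonneg ‖v‖]
  calc ‖stat π v‖ ≤ _ := h3
    _ ≤ _ := by linarith

/-- The normalizations of `f` centre the statistic. The sphere thus fixes the sum of the statistics
at its mean, the point where the local limit theorem gives a lower bound of the right order. -/
theorem integral_stat {f : ProbabilityMeasure E} (h4 : ∫⁻ v, ‖v‖ₑ ^ 4 ∂(f : Measure E) < ∞)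
    (h2 : ∫⁻ v, ‖v‖ₑ ^ 2 ∂(f : Measure E) = 1) (hmean : ∫ v, π v ∂(f : Measure E) = 0) :
    ∫ v, stat π v ∂(f : Measure E) = 0 := by
  have hi : Integrable (stat π) (f : Measure E) := (memLp_stat π h4).integrable one_le_two
  have h2i : Integrable (fun v : E => ‖v‖ ^ 2) (f : Measure E) :=
    integrable_norm_pow_of_lintegral_lt_top (by rw [h2]; simp)
  have h2v : ∫ v, ‖v‖ ^ 2 ∂(f : Measure E) = 1 := by
    rw [integral_eq_lintegral_of_nonneg_ae (ae_of_all _ fun v => by positivity) (by fun_prop)]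
    have : ∀ v : E, ENNReal.ofReal (‖v‖ ^ 2) = ‖v‖ₑ ^ 2 := fun v => by
      rw [ENNReal.ofReal_pow (norm_nonneg _), ofReal_norm]
    simp_rw [this]
    rw [h2, ENNReal.toReal_one]
  apply (WithLp.prodContinuousLinearEquiv 2 ℝ P ℝ).injective
  rw [map_zero, ← ContinuousLinearEquiv.integral_comp_comm]
  have hi1 : Integrable (fun v => π v) (f : Measure E) := by
    have := (WithLp.fstL 2 ℝ P ℝ).integrable_comp hi
    exact this
  have hi2 : Integrable (fun v : E => ‖v‖ ^ 2 - 1) (f : Measure E) :=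
    h2i.sub (integrable_const _)
  have h3 : ∀ v, WithLp.prodContinuousLinearEquiv 2 ℝ P ℝ (stat π v) = (π v, ‖v‖ ^ 2 - 1) :=
    fun v => rfl
  simp_rw [h3]
  rw [integral_pair hi1 hi2, hmean, integral_sub h2i (integrable_const _), h2v]
  simp

end StatMoments

/-! ### Blocks under the conditioned measure -/

section Conditioning

open ContinuousLinearMap (adjoint)
open scoped Topology

variable {E P : Type*} [NormedAddCommGroup E] [InnerProductSpace ℝ E] [FiniteDimensional ℝ E]
  [MeasurableSpace E] [BorelSpace E]
  [NormedAddCommGroup P] [InnerProductSpace ℝ P] [FiniteDimensional ℝ P]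
  [MeasurableSpace P] [BorelSpace P] {π : E →L[ℝ] P}

/-- The product density conditioned to the sphere has, on a block of velocities of comparable size
with its complement, a bounded density with respect to the tensor power. -/
theorem exists_lintegral_conditioned_block_le [Nontrivial E] (hπ : ∀ p, π (adjoint π p) = p)
    (hd1 : 2 + Module.finrank ℝ P ≤ 2 * Module.finrank ℝ E)
    (hd2 : 2 * Module.finrank ℝ E ≤ 4 + Module.finrank ℝ P)
    {f : ProbabilityMeasure E} {ρ : E → ℝ≥0∞}
    (hρ : Measurable ρ) (hf : (f : Measure E) = volume.withDensity ρ)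
    (hp : ∃ p : ℝ, 1 < p ∧ ∫⁻ v, ρ v ^ p < ∞)
    (h4 : ∫⁻ v, ‖v‖ₑ ^ 4 ∂(f : Measure E) < ∞)
    (h2 : ∫⁻ v, ‖v‖ₑ ^ 2 ∂(f : Measure E) = 1) (hmean : ∫ v, π v ∂(f : Measure E) = 0) :
    ∃ (C : ℝ) (N₀ : ℕ), 0 ≤ C ∧ ∀ N ≥ N₀, ∀ {H : Type} [NormedAddCommGroup H]
      [InnerProductSpace ℝ H] [FiniteDimensional ℝ H] [MeasurableSpace H] [BorelSpace H]
      (j : H →ₗ[ℝ] (Fin N → E)) (_ : ∀ h, ‖h‖ ^ 2 = ∑ i, ‖j h i‖ ^ 2)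
      (_ : ∀ V, V ∈ LinearMap.range j ↔ ∑ i, π (V i) = 0),
      condMass ((sphereUniform H √N).map j) ρ ≠ 0 ∧ condMass ((sphereUniform H √N).map j) ρ ≠ ∞ ∧
      ∀ (m n : ℕ) (e : Fin m ⊕ Fin n ≃ Fin N), N ≤ 3 * m → N ≤ 3 * n →
        ∀ Φ : (Fin m → E) → ℝ≥0∞, Measurable Φ →
          ∫⁻ V, Φ (fun i => V (e (Sum.inl i))) ∂(conditioned ((sphereUniform H √N).map j) ρ) ≤
            ENNReal.ofReal C * ∫⁻ a, Φ a ∂(tensorPower f m) := by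
  obtain ⟨p, hp1, hpi⟩ := hp
  obtain ⟨Cb, hCb, hsb⟩ := exists_smallBall_stat hπ hd1 hd2
  have hρ1 : ∫⁻ v, ρ v = 1 := by
    have h1 : (f : Measure E) Set.univ = 1 := measure_univ
    rwa [hf, withDensity_apply _ .univ, setLIntegral_univ] at h1
  have hmem := memLp_stat π h4
  have hB : ∫⁻ v, ‖stat π v‖ₑ ∂(volume.withDensity ρ) ≠ ∞ := by
    rw [← hf]
    exact (hmem.integrable one_le_two).2.ne
  obtain ⟨q, hq⟩ := exists_integrable_norm_charFun_pow (measurable_stat π) hCb hsb hρ hρ1 hB hp1 hpi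
  rw [← hf] at hq
  set ν := (f : Measure E).map (stat π) with hν
  have hνp : IsProbabilityMeasure ν := by rw [hν]; infer_instance
  have hν2 : MemLp id 2 ν := by
    rw [hν, memLp_map_measure_iff aestronglyMeasurable_id (measurable_stat π).aemeasurable]
    exact hmem
  have hν0 : ∫ x, x ∂ν = 0 := by
    rw [hν, integral_map (f := fun x => x) (measurable_stat π).aemeasurable aestronglyMeasurable_id]
    exact integral_stat π h4 h2 hmean
  obtain ⟨C₀, c₀, hC₀, hc₀, hev⟩ := exists_local_limit (tendsto_charFun_stat hπ hρ hf) hν2 hν0 hq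
  obtain ⟨n₀, hn₀⟩ := eventually_atTop.1 hev
  set D := Module.finrank ℝ (WithLp 2 (P × ℝ)) with hD
  set iC := invConst (WithLp 2 (P × ℝ)) with hiC
  have hiC0 : 0 < iC := invConst_pos _
  set B : ℕ → ℝ := fun n => iC * (C₀ / √(n : ℝ) ^ D) with hBdef
  set b : ℕ → ℝ := fun n => iC * (c₀ / √(n : ℝ) ^ D) with hbdef
  -- The ratio of the upper bound `B n` to the lower bound `b N`; the factor `√3 ^ D` accounts for
  -- `n ≥ N/3`.
  set C := C₀ / c₀ * √3 ^ D with hC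
  -- One and the same `κ` appears in the bound for `Z_N` and in the bound for the unnormalized block
  -- integral, and disappears in the quotient. The threshold forces `m` and `n` to be at least `n₀ +
  -- 2`.
  have key : ∀ N ≥ 3 * n₀ + 6, ∀ {H : Type} [NormedAddCommGroup H]
      [InnerProductSpace ℝ H] [FiniteDimensional ℝ H] [MeasurableSpace H] [BorelSpace H]
      (j : H →ₗ[ℝ] (Fin N → E)) (_ : ∀ h, ‖h‖ ^ 2 = ∑ i, ‖j h i‖ ^ 2)
      (_ : ∀ V, V ∈ LinearMap.range j ↔ ∑ i, π (V i) = 0),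
      ∀ (m n : ℕ) (e : Fin m ⊕ Fin n ≃ Fin N), N ≤ 3 * m → N ≤ 3 * n →
        ∃ κ : ℝ≥0∞, κ ≠ 0 ∧ κ ≠ ∞ ∧
          κ * ENNReal.ofReal (b N) ≤ condMass ((sphereUniform H √N).map j) ρ ∧
          ∀ Φ : (Fin m → E) → ℝ≥0∞, Measurable Φ →
            ∫⁻ V, Φ (fun i => V (e (Sum.inl i))) * ∏ i, ρ (V i) ∂((sphereUniform H √N).map j) ≤
              κ * ENNReal.ofReal (B n) * ∫⁻ a, Φ a ∂(tensorPower f m) := by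
    intro N hN H _ _ _ _ _ j hjn hjr m n e hm hn
    obtain ⟨h, hhm, hhd, hh⟩ := exists_density_sumStat hπ hρ hf (n := n) (by omega)
    obtain ⟨κ, hκ0, hκt, hκ⟩ := hh e j hjn hjr
    obtain ⟨hm', hhm', hhd', -⟩ := exists_density_sumStat hπ hρ hf (n := m) (by omega)
    obtain ⟨hi, hup, -⟩ := hn₀ n (by omega)
    obtain ⟨-, -, hlow⟩ := hn₀ N (by omega)
    have hcard : m + n = N := by
      have h := Fintype.card_congr e
      simpa only [Fintype.card_sum, Fintype.card_fin] using h
    have hac : (tensorPower f m).map (sumStat π) ≪ volume := by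
      rw [hhd']; exact withDensity_absolutelyContinuous _ _
    have hint : Integrable (charFun ((tensorPower f n).map (sumStat π))) := by
      rw [charFun_map_sumStat]; exact hi
    refine ⟨κ, hκ0, hκt, ?_, fun Φ hΦ => ?_⟩
    · have h5 := hκ (fun _ => 1) measurable_const
      simp only [one_mul] at h5
      rw [condMass, h5]
      gcongr
      -- `Z_N / κ` is the density at the origin of the sum of all `N` statistics: the characteristic
      -- functions of the two blocks multiply to `φ ^ N`.
      have h6 := le_lintegral_density_neg hhm hhd hint ((tensorPower f m).map (sumStat π)) hac
      rw [lintegral_map (f := fun s => h (-s)) (hhm.comp measurable_neg) (measurable_sumStat π m)] at h6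
      refine le_trans (ENNReal.ofReal_le_ofReal ?_) h6
      rw [charFun_map_sumStat, charFun_map_sumStat]
      simp_rw [← pow_add]
      rw [add_comm n m, hcard]
      exact mul_le_mul_of_nonneg_left hlow hiC0.le
    · rw [hκ Φ hΦ, mul_assoc, ← lintegral_const_mul _ hΦ]
      refine mul_le_mul_right (lintegral_mono_ae ?_) κ
      have h6 := density_le hhm hhd hint
      have h7 : ∀ᵐ y ∂(tensorPower f m).map (sumStat π), h (-y) ≤ ENNReal.ofReal (B n) := by
        suffices h8 : ∀ᵐ y, h y ≤ ENNReal.ofReal (B n) by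
          exact hac.ae_le ((Measure.measurePreserving_neg
            (volume : Measure (WithLp 2 (P × ℝ)))).quasiMeasurePreserving.ae h8)
        filter_upwards [h6] with y hy
        refine hy.trans (ENNReal.ofReal_le_ofReal ?_)
        rw [charFun_map_sumStat]
        simp_rw [norm_pow]
        exact mul_le_mul_of_nonneg_left hup hiC0.le
      filter_upwards [ae_of_ae_map (measurable_sumStat π m).aemeasurable h7] with a ha
      rw [mul_comm]
      gcongr
  refine ⟨C, 3 * n₀ + 6, by positivity, fun N hN H _ _ _ _ _ j hjn hjr => ?_⟩
  have hN0 : 0 < (N : ℝ) := by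
    have : 0 < N := by omega
    exact_mod_cast this
  have hb0 : 0 < b N := by simp only [hbdef]; positivity
  have hjm : Measurable j := j.continuous_of_finiteDimensional.measurable
  have hpm : Measurable fun V : Fin N → E => ∏ i, ρ (V i) :=
    Finset.measurable_fun_prod _ fun i _ => hρ.comp (measurable_pi_apply i)
  have hZ : condMass ((sphereUniform H √N).map j) ρ ≠ 0 ∧
      condMass ((sphereUniform H √N).map j) ρ ≠ ∞ := by
    have hc : N / 2 + (N - N / 2) = N := by omega
    obtain ⟨κ, hκ0, hκt, hlow, hup⟩ := key N hN j hjn hjr (N / 2) (N - N / 2)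
      (finSumFinEquiv.trans (finCongr hc)) (by omega) (by omega)
    constructor
    · intro h0
      rw [h0, nonpos_iff_eq_zero, mul_eq_zero] at hlow
      rcases hlow with h | h
      · exact hκ0 h
      · exact absurd (ENNReal.ofReal_eq_zero.1 h) (not_le.2 hb0)
    · have h5 := hup (fun _ => 1) measurable_const
      simp only [one_mul] at h5
      refine ne_top_of_le_ne_top ?_ h5
      rw [lintegral_one, measure_univ, mul_one]
      exact ENNReal.mul_ne_top hκt ENNReal.ofReal_ne_top
  refine ⟨hZ.1, hZ.2, fun m n e hm hn Φ hΦ => ?_⟩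
  obtain ⟨κ, hκ0, hκt, hlow, hup⟩ := key N hN j hjn hjr m n e hm hn
  have hVm : Measurable fun V : Fin N → E => Φ fun i => V (e (Sum.inl i)) := hΦ.comp (by fun_prop)
  rw [conditioned, lintegral_smul_measure, lintegral_withDensity_eq_lintegral_mul _ hpm hVm,
    smul_eq_mul]
  have h5 : B n ≤ C * b N := by
    have hn0 : 0 < (n : ℝ) := by
      have : 0 < n := by omega
      exact_mod_cast this
    have h6 : √(N : ℝ) ≤ √3 * √(n : ℝ) := by
      rw [← Real.sqrt_mul (by norm_num)]
      exact Real.sqrt_le_sqrt (by exact_mod_cast hn)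
    have h7 : √(N : ℝ) ^ D ≤ √3 ^ D * √(n : ℝ) ^ D := by
      rw [← mul_pow]; gcongr
    have h8 : (√(n : ℝ) ^ D)⁻¹ ≤ √3 ^ D * (√(N : ℝ) ^ D)⁻¹ := by
      rw [← div_eq_mul_inv, le_div_iff₀ (by positivity), inv_mul_le_iff₀ (by positivity)]
      linarith
    calc B n = iC * C₀ * (√(n : ℝ) ^ D)⁻¹ := by simp only [hBdef]; ring
      _ ≤ iC * C₀ * (√3 ^ D * (√(N : ℝ) ^ D)⁻¹) := by gcongr
      _ = C * b N := by simp only [hbdef, hC]; field_simp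
  calc _ = (condMass ((sphereUniform H √N).map j) ρ)⁻¹ *
        ∫⁻ V, Φ (fun i => V (e (Sum.inl i))) * ∏ i, ρ (V i) ∂((sphereUniform H √N).map j) := by
        congr 1
        refine lintegral_congr fun V => ?_
        rw [Pi.mul_apply, mul_comm]
    _ ≤ (condMass ((sphereUniform H √N).map j) ρ)⁻¹ * (κ * ENNReal.ofReal (B n) *
        ∫⁻ a, Φ a ∂(tensorPower f m)) := by gcongr; exact hup Φ hΦ
    _ ≤ (condMass ((sphereUniform H √N).map j) ρ)⁻¹ * (ENNReal.ofReal C *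
        condMass ((sphereUniform H √N).map j) ρ * ∫⁻ a, Φ a ∂(tensorPower f m)) := by
        gcongr _ * (?_ * _)
        calc κ * ENNReal.ofReal (B n) ≤ κ * ENNReal.ofReal (C * b N) := by gcongr
          _ = ENNReal.ofReal C * (κ * ENNReal.ofReal (b N)) := by
              rw [ENNReal.ofReal_mul (by positivity)]; ring
          _ ≤ _ := by gcongr
    _ = (condMass ((sphereUniform H √N).map j) ρ)⁻¹ * condMass ((sphereUniform H √N).map j) ρ *
        (ENNReal.ofReal C * ∫⁻ a, Φ a ∂(tensorPower f m)) := by ring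
    _ = _ := by rw [ENNReal.inv_mul_cancel hZ.1 hZ.2, one_mul]

end Conditioning

/-! ### Splitting the empirical measure into two blocks -/

section BlockSplitting

theorem smul_empirical_add_smul_empirical {E : Type*} [MeasurableSpace E] {N m n : ℕ} [NeZero N]
    [NeZero m] [NeZero n] (e : Fin m ⊕ Fin n ≃ Fin N) (V : Fin N → E) :
    (empirical V : Measure E) =
      ((m : ℝ≥0∞) / N) • (empirical (fun i => V (e (Sum.inl i))) : Measure E) +
        ((n : ℝ≥0∞) / N) • (empirical (fun i => V (e (Sum.inr i))) : Measure E) := by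
  have h : ∀ k : ℕ, [NeZero k] → ((k : ℝ≥0∞) / N) * (k : ℝ≥0∞)⁻¹ = (N : ℝ≥0∞)⁻¹ := by
    intro k _
    rw [div_eq_mul_inv, mul_right_comm, ENNReal.mul_inv_cancel (by simp [NeZero.ne k]) (by simp),
      one_mul]
  change (N : ℝ≥0∞)⁻¹ • ∑ i, Measure.dirac (V i) =
    ((m : ℝ≥0∞) / N) • ((m : ℝ≥0∞)⁻¹ • ∑ i, Measure.dirac (V (e (Sum.inl i)))) +
      ((n : ℝ≥0∞) / N) • ((n : ℝ≥0∞)⁻¹ • ∑ i, Measure.dirac (V (e (Sum.inr i))))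
  rw [smul_smul, smul_smul, h, h, ← smul_add, ← e.sum_comp, Fintype.sum_sum_type]

/-- The empirical measure is the mixture of those of the two blocks with weights `m/N` and `n/N`.
The cost is convex, and the weights are simply bounded by `1`. -/
theorem W1_empirical_le_add {E : Type*} [NormedAddCommGroup E] [MeasurableSpace E] {N m n : ℕ}
    [NeZero N] [NeZero m] [NeZero n] (e : Fin m ⊕ Fin n ≃ Fin N) (V : Fin N → E)
    (f : ProbabilityMeasure E) :
    W1 (empirical V : Measure E) (f : Measure E) ≤
      W1 (empirical (fun i => V (e (Sum.inl i))) : Measure E) (f : Measure E) +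
        W1 (empirical (fun i => V (e (Sum.inr i))) : Measure E) (f : Measure E) := by
  have hN : (N : ℝ≥0∞) ≠ 0 := by simp [NeZero.ne N]
  have hc : m + n = N := by
    have h := Fintype.card_congr e
    simpa only [Fintype.card_sum, Fintype.card_fin] using h
  have hf : (f : Measure E) = ((m : ℝ≥0∞) / N) • (f : Measure E) +
      ((n : ℝ≥0∞) / N) • (f : Measure E) := by
    rw [← add_smul, ENNReal.div_add_div_same, ← Nat.cast_add, hc, ENNReal.div_self hN (by simp),
      one_smul]
  have hle : ∀ k : ℕ, k ≤ N → (k : ℝ≥0∞) / N ≤ 1 := fun k hk =>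
    ENNReal.div_le_of_le_mul (by rw [one_mul]; exact_mod_cast hk)
  have hm := hle m (by omega)
  have hn := hle n (by omega)
  conv_lhs => rw [hf, smul_empirical_add_smul_empirical e V]
  refine (mkw_add_le _ _ _ _ _).trans (add_le_add ?_ ?_)
  · refine (mkw_smul_le _ _ _ (ne_top_of_le_ne_top (by simp) hm)).trans ?_
    calc _ ≤ 1 * _ := mul_le_mul_left hm _
      _ = _ := one_mul _
  · refine (mkw_smul_le _ _ _ (ne_top_of_le_ne_top (by simp) hn)).trans ?_
    calc _ ≤ 1 * _ := mul_le_mul_left hn _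
      _ = _ := one_mul _

theorem isProbabilityMeasure_conditioned {E : Type*} [MeasurableSpace E] {N : ℕ}
    {σ : Measure (Fin N → E)} {ρ : E → ℝ≥0∞} (h0 : condMass σ ρ ≠ 0) (ht : condMass σ ρ ≠ ∞) :
    IsProbabilityMeasure (conditioned σ ρ) := by
  constructor
  rw [conditioned, Measure.smul_apply, withDensity_apply _ .univ, setLIntegral_univ, smul_eq_mul]
  exact ENNReal.inv_mul_cancel h0 ht

end BlockSplitting

/-! ### Rate for conditioned products -/

section ConditionedRate

open ContinuousLinearMap (adjoint)

variable {E P : Type*} [NormedAddCommGroup E] [InnerProductSpace ℝ E] [FiniteDimensional ℝ E]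
  [MeasurableSpace E] [BorelSpace E]
  [NormedAddCommGroup P] [InnerProductSpace ℝ P] [FiniteDimensional ℝ P]
  [MeasurableSpace P] [BorelSpace P]

/-- `σ` is the uniform measure on the sphere of radius `√N` of the vectors of `N` velocities with
zero total momentum. -/
def IsMomentumSphere (π : E →L[ℝ] P) (N : ℕ) (σ : Measure (Fin N → E)) : Prop :=
  ∃ (H : Type) (_ : NormedAddCommGroup H) (_ : InnerProductSpace ℝ H) (_ : FiniteDimensional ℝ H)
    (_ : MeasurableSpace H) (_ : BorelSpace H) (j : H →ₗ[ℝ] (Fin N → E)),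
    (∀ h, ‖h‖ ^ 2 = ∑ i, ‖j h i‖ ^ 2) ∧ (∀ V, V ∈ LinearMap.range j ↔ ∑ i, π (V i) = 0) ∧
      σ = (sphereUniform H √N).map j

omit [InnerProductSpace ℝ E] [FiniteDimensional ℝ E] [BorelSpace E] in
theorem lintegral_enorm_pow_four_lt_top {f : ProbabilityMeasure E} {k : ℝ} (hk : 4 ≤ k)
    (h : moment k f < ∞) : ∫⁻ v, ‖v‖ₑ ^ 4 ∂(f : Measure E) < ∞ := by
  have h1 : ∫⁻ v, (1 + ‖v‖ₑ ^ k) ∂(f : Measure E) < ∞ := by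
    rw [lintegral_add_left measurable_const, lintegral_one, measure_univ]
    exact ENNReal.add_lt_top.2 ⟨by simp, h⟩
  refine lt_of_le_of_lt (lintegral_mono fun v => ?_) h1
  rcases le_total ‖v‖ₑ 1 with hv | hv
  · exact (pow_le_one' hv 4).trans le_self_add
  · refine le_trans ?_ le_add_self
    rw [← ENNReal.rpow_natCast]
    exact ENNReal.rpow_le_rpow_of_exponent_le hv (by exact_mod_cast hk)

/-- Rate of chaos for product densities conditioned to spheres. -/
theorem conditioned_rate [Nontrivial E] {π : E →L[ℝ] P} (hπ : ∀ p, π (adjoint π p) = p)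
    (hd1 : 2 + Module.finrank ℝ P ≤ 2 * Module.finrank ℝ E)
    (hd2 : 2 * Module.finrank ℝ E ≤ 4 + Module.finrank ℝ P) {d : ℕ} (Q : GridChart E d)
    {σ : ∀ N, Measure (Fin N → E)} (hσ : ∀ N, IsMomentumSphere π N (σ N))
    {k : ℝ} (hk : 4 ≤ k) {f : ProbabilityMeasure E} {ρ : E → ℝ≥0∞}
    (hρ : Measurable ρ) (hf : (f : Measure E) = volume.withDensity ρ)
    (hp : ∃ p : ℝ, 1 < p ∧ ∫⁻ v, ρ v ^ p < ∞) (hm : moment k f < ∞)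
    (h2 : ∫⁻ v, ‖v‖ₑ ^ 2 ∂(f : Measure E) = 1) (hmean : ∫ v, π v ∂(f : Measure E) = 0) :
    (∀ᶠ N : ℕ in atTop, condMass (σ N) ρ ≠ 0 ∧ condMass (σ N) ρ ≠ ∞) ∧
    ∀ α : ℝ, α < 1 / (max (d : ℝ) 2 + d / k) → ∃ C : ℝ, ∀ (N : ℕ) [NeZero N],
      condMass (σ N) ρ ≠ 0 → condMass (σ N) ρ ≠ ∞ →
        OmegaInf (conditioned (σ N) ρ) f = meanW1 (conditioned (σ N) ρ) f ∧
          meanW1 (conditioned (σ N) ρ) f ≤ ENNReal.ofReal (C / (N : ℝ) ^ α) := by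
  obtain ⟨C₁, N₀, hC₁, hblock⟩ := exists_lintegral_conditioned_block_le hπ hd1 hd2 hρ hf hp
    (lintegral_enorm_pow_four_lt_top hk hm) h2 hmean
  have hblock' : ∀ N ≥ N₀, condMass (σ N) ρ ≠ 0 ∧ condMass (σ N) ρ ≠ ∞ ∧
      ∀ (m n : ℕ) (e : Fin m ⊕ Fin n ≃ Fin N), N ≤ 3 * m → N ≤ 3 * n →
        ∀ Φ : (Fin m → E) → ℝ≥0∞, Measurable Φ →
          ∫⁻ V, Φ (fun i => V (e (Sum.inl i))) ∂(conditioned (σ N) ρ) ≤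
            ENNReal.ofReal C₁ * ∫⁻ a, Φ a ∂(tensorPower f m) := by
    intro N hN
    obtain ⟨H, _, _, _, _, _, j, hjn, hjr, hσN⟩ := hσ N
    rw [hσN]
    exact hblock N hN j hjn hjr
  refine ⟨eventually_atTop.2 ⟨N₀, fun N hN => ⟨(hblock' N hN).1, (hblock' N hN).2.1⟩⟩,
    fun α hα => ?_⟩
  have hk0 : 0 < k := by linarith
  -- A nonnegative exponent is needed for the monotonicity of `N ↦ N^a`; the bound for `a` implies
  -- the one for `α`.
  set a : ℝ := max α 0 with ha
  have ha0 : 0 ≤ a := le_max_right _ _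
  have haα : a < 1 / (max (d : ℝ) 2 + d / k) := max_lt hα (by positivity)
  obtain ⟨C₂, hC₂, hrate⟩ := exists_meanW1_tensorPower_le Q hk0 (moment k f).toNNReal haα
  have hrate' : ∀ (m : ℕ) [NeZero m], meanW1 (tensorPower f m) f ≤ ENNReal.ofReal (C₂ / (m : ℝ) ^ a) :=
    fun m _ => hrate f (by rw [ENNReal.coe_toNNReal hm.ne]) m
  -- The first term settles the finitely many small `N` through `W₁ ≤ 1`; the second is the sum of
  -- the two block contributions.
  set C : ℝ := max ((max N₀ 6 : ℕ) ^ a : ℝ) (C₁ * (2 * (C₂ * 3 ^ a))) with hC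
  have hC0 : 0 ≤ C := le_trans (by positivity) (le_max_left _ _)
  refine ⟨C, fun N _ h0 ht => ?_⟩
  have hprob := isProbabilityMeasure_conditioned h0 ht
  refine ⟨OmegaInf_eq_meanW1 Q _ f, ?_⟩
  have hN1 : (1 : ℝ) ≤ N := by exact_mod_cast NeZero.one_le
  have hNa : C / (N : ℝ) ^ a ≤ C / (N : ℝ) ^ α := by
    refine div_le_div_of_nonneg_left hC0 (by positivity) ?_
    exact Real.rpow_le_rpow_of_exponent_le hN1 (le_max_left _ _)
  refine le_trans ?_ (ENNReal.ofReal_le_ofReal hNa)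
  rcases lt_or_ge N (max N₀ 6) with hN | hN
  · refine (meanW1_le_one _ f).trans ?_
    rw [ENNReal.one_le_ofReal, one_le_div (by positivity)]
    refine le_trans ?_ (le_max_left _ _)
    gcongr
  have hN6 : 6 ≤ N := (le_max_right _ _).trans hN
  obtain ⟨-, -, hb⟩ := hblock' N ((le_max_left _ _).trans hN)
  have hc : N / 2 + (N - N / 2) = N := by omega
  -- Each half is in turn the block and the complement, so both are compared with tensor powers;
  -- exchangeability of the conditioned measure is not needed.
  set m := N / 2 with hmdef
  set n := N - m with hndef
  have hm0 : NeZero m := ⟨by omega⟩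
  have hn0 : NeZero n := ⟨by omega⟩
  set e : Fin m ⊕ Fin n ≃ Fin N := finSumFinEquiv.trans (finCongr hc) with he
  have hterm : ∀ (l : ℕ) [NeZero l], N ≤ 3 * l →
      meanW1 (tensorPower f l) f ≤ ENNReal.ofReal (C₂ * 3 ^ a / (N : ℝ) ^ a) := by
    intro l _ hl
    refine (hrate' l).trans (ENNReal.ofReal_le_ofReal ?_)
    have hl1 : (1 : ℝ) ≤ l := by exact_mod_cast NeZero.one_le
    rw [div_le_div_iff₀ (by positivity) (by positivity), mul_assoc,
      ← Real.mul_rpow (by norm_num) (by positivity)]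
    gcongr
    exact_mod_cast hl
  have hmW : Measurable fun V : Fin N → E =>
      W1 (empirical (fun i => V (e (Sum.inl i))) : Measure E) (f : Measure E) := by
    have hsel : Measurable fun (V : Fin N → E) i => V (e (Sum.inl i)) := by fun_prop
    exact (measurable_W1_empirical Q m f).comp hsel
  calc meanW1 (conditioned (σ N) ρ) f
      ≤ ∫⁻ V, (W1 (empirical (fun i => V (e (Sum.inl i))) : Measure E) (f : Measure E) +
        W1 (empirical (fun i => V (e (Sum.inr i))) : Measure E) (f : Measure E))
          ∂(conditioned (σ N) ρ) := lintegral_mono fun V => W1_empirical_le_add e V f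
    _ = ∫⁻ V, W1 (empirical (fun i => V (e (Sum.inl i))) : Measure E) (f : Measure E)
          ∂(conditioned (σ N) ρ) +
        ∫⁻ V, W1 (empirical (fun i => V (e (Sum.inr i))) : Measure E) (f : Measure E)
          ∂(conditioned (σ N) ρ) := lintegral_add_left hmW _
    _ ≤ ENNReal.ofReal C₁ * meanW1 (tensorPower f m) f +
        ENNReal.ofReal C₁ * meanW1 (tensorPower f n) f := by
        refine add_le_add ?_ ?_
        · exact hb m n e (by omega) (by omega) _ (measurable_W1_empirical Q m f)
        · exact hb n m ((Equiv.sumComm _ _).trans e) (by omega) (by omega) _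
            (measurable_W1_empirical Q n f)
    _ ≤ ENNReal.ofReal C₁ * ENNReal.ofReal (C₂ * 3 ^ a / (N : ℝ) ^ a) +
        ENNReal.ofReal C₁ * ENNReal.ofReal (C₂ * 3 ^ a / (N : ℝ) ^ a) := by
        gcongr
        · exact hterm m (by omega)
        · exact hterm n (by omega)
    _ = ENNReal.ofReal (C₁ * (2 * (C₂ * 3 ^ a)) / (N : ℝ) ^ a) := by
        rw [← ENNReal.ofReal_mul hC₁, ← ENNReal.ofReal_add (by positivity) (by positivity)]
        congr 1
        ring
    _ ≤ ENNReal.ofReal (C / (N : ℝ) ^ a) := by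
        refine ENNReal.ofReal_le_ofReal ?_
        gcongr
        exact le_max_right _ _

end ConditionedRate

/-! ### Kac's and Boltzmann's spheres -/

section Spheres

/-- The identity chart of the line. -/
noncomputable def realChart : GridChart ℝ 1 where
  q x _ := x
  measurable_q := by fun_prop
  K := 1
  antilipschitz := AntilipschitzWith.of_le_mul_dist fun x y => by
    rw [NNReal.coe_one, one_mul]
    exact dist_le_pi_dist (fun _ : Fin 1 => x) (fun _ => y) 0
  abs_le x i := le_rfl

/-- Cartesian coordinates. -/
noncomputable def euclideanChart (d : ℕ) : GridChart (EuclideanSpace ℝ (Fin d)) d where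
  q := WithLp.ofLp
  measurable_q := WithLp.measurable_ofLp 2 _
  K := _
  antilipschitz := PiLp.antilipschitzWith_ofLp 2 _
  abs_le x i := PiLp.norm_apply_le x i

/-- A momentum valued in a zero-dimensional space imposes no constraint, which puts Kac's sphere in
the same framework as Boltzmann's. -/
theorem isMomentumSphere_kacUniform (N : ℕ) :
    IsMomentumSphere (0 : ℝ →L[ℝ] EuclideanSpace ℝ (Fin 0)) N (kacUniform N) := by
  refine ⟨EuclideanSpace ℝ (Fin N), inferInstance, inferInstance, inferInstance, inferInstance,
    inferInstance, (WithLp.linearEquiv 2 ℝ (Fin N → ℝ)).toLinearMap, fun h => ?_, fun V => ?_, rfl⟩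
  · exact EuclideanSpace.norm_sq_eq h
  · simp

theorem isMomentumSphere_boltzmannUniform (N : ℕ) :
    IsMomentumSphere (ContinuousLinearMap.id ℝ (EuclideanSpace ℝ (Fin 3))) N
      (boltzmannUniform N) := by
  refine ⟨zeroMomentum N, inferInstance, inferInstance, inferInstance, inferInstance,
    inferInstance, (WithLp.linearEquiv 2 ℝ (Fin N → EuclideanSpace ℝ (Fin 3))).toLinearMap ∘ₗ
      (zeroMomentum N).subtype, fun h => ?_, fun V => ?_, rfl⟩
  · exact PiLp.norm_sq_eq_of_L2 _ (h : PiLp 2 fun _ : Fin N => EuclideanSpace ℝ (Fin 3))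
  · constructor
    · rintro ⟨h, rfl⟩
      exact h.2
    · intro hV
      exact ⟨⟨WithLp.toLp 2 V, hV⟩, rfl⟩

end Spheres

/-! ### The uniform measure on Kac's sphere and the Gaussian -/

section GaussianSphere

/-- The density of the standard Gaussian law on `ℝ^N` as a function of the square of the norm. -/
noncomputable def gaussianProfile (N : ℕ) (t : ℝ) : ℝ≥0∞ :=
  ENNReal.ofReal ((√(2 * Real.pi))⁻¹ ^ N * Real.exp (-t / 2))

theorem measurable_gaussianProfile (N : ℕ) : Measurable (gaussianProfile N) := by
  unfold gaussianProfile; fun_prop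

theorem prod_gaussianPDF {N : ℕ} (x : Fin N → ℝ) :
    ∏ i, gaussianPDF 0 1 (x i) = gaussianProfile N (∑ i, x i ^ 2) := by
  simp only [gaussianPDF]
  rw [← ENNReal.ofReal_prod_of_nonneg fun i _ => gaussianPDFReal_nonneg _ _ _, gaussianProfile]
  congr 1
  simp only [gaussianPDFReal, NNReal.coe_one, mul_one, sub_zero]
  rw [Finset.prod_mul_distrib, Finset.prod_const, Finset.card_univ, Fintype.card_fin,
    ← Real.exp_sum, ← Finset.sum_div, Finset.sum_neg_distrib]

theorem stdGaussian_eq_withDensity :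
    (stdGaussian : Measure ℝ) = volume.withDensity (gaussianPDF 0 1) :=
  gaussianReal_of_var_ne_zero 0 one_ne_zero

/-- Projecting the standard Gaussian law to the sphere gives the uniform measure. -/
theorem map_stdGaussian_eq_kacUniform {N : ℕ} (hN : 1 ≤ N) :
    (tensorPower stdGaussian N).map (fun x i => √(N : ℝ) * (√(∑ j, x j ^ 2))⁻¹ * x i) =
      kacUniform N := by
  have : Nonempty (Fin N) := ⟨⟨0, by omega⟩⟩
  have hproj : Measurable fun (x : Fin N → ℝ) i => √(N : ℝ) * (√(∑ j, x j ^ 2))⁻¹ * x i := by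
    fun_prop
  set H := EuclideanSpace ℝ (Fin N) with hH
  set ω := (volume : Measure H).toSphere Set.univ with hω
  have hω0 : ω ≠ 0 := by
    rw [hω, Ne, Measure.measure_univ_eq_zero]; exact Measure.toSphere_ne_zero _
  have hωt : ω ≠ ∞ := measure_ne_top _ _
  have hprofile : Measurable fun x : Fin N → ℝ => gaussianProfile N (∑ i, x i ^ 2) :=
    (measurable_gaussianProfile N).comp (by fun_prop)
  -- The radial integral separates from the angular one. Its value is read off from the test
  -- function `1`, without computing it.
  set I : ℝ≥0∞ := ∫⁻ t, halfPow (Module.finrank ℝ H / 2 - 1) t * gaussianProfile N t with hI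
  have key : ∀ g : (Fin N → ℝ) → ℝ≥0∞, Measurable g →
      ∫⁻ x, g (fun i => √(N : ℝ) * (√(∑ j, x j ^ 2))⁻¹ * x i) ∂(tensorPower stdGaussian N) =
        I * ∫⁻ u, g (WithLp.ofLp (√(N : ℝ) • (u : H))) ∂(volume : Measure H).toSphere := by
    intro g hg
    rw [tensorPower_eq_withDensity (measurable_gaussianPDF 0 1) stdGaussian_eq_withDensity]
    simp_rw [prod_gaussianPDF]
    rw [lintegral_withDensity_eq_lintegral_mul _ hprofile
      (g := fun x => g (fun i => √(N : ℝ) * (√(∑ j, x j ^ 2))⁻¹ * x i)) (hg.comp hproj)]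
    have hG : Measurable fun x : Fin N → ℝ => gaussianProfile N (∑ i, x i ^ 2) *
      g (fun i => √(N : ℝ) * (√(∑ j, x j ^ 2))⁻¹ * x i) := hprofile.mul (hg.comp hproj)
    have hgu : Measurable fun u : Metric.sphere (0 : H) 1 =>
        g (WithLp.ofLp (√(N : ℝ) • (u : H))) :=
      hg.comp ((WithLp.measurable_ofLp 2 _).comp (measurable_subtype_coe.const_smul √(N : ℝ)))
    have h1 := (PiLp.volume_preserving_ofLp (Fin N)).lintegral_comp hG
    simp only [Pi.mul_apply] at h1 ⊢
    rw [← h1, lintegral_polar_sq (W := H) (g := fun y : H => gaussianProfile N (∑ i, y i ^ 2) *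
      g (fun i => √(N : ℝ) * (√(∑ j, y j ^ 2))⁻¹ * y i)) (hG.comp (WithLp.measurable_ofLp 2 _)), hI,
      ← lintegral_mul_const (f := fun t => halfPow (Module.finrank ℝ H / 2 - 1) t *
        gaussianProfile N t) _ ((measurable_halfPow _).mul (measurable_gaussianProfile N))]
    refine lintegral_congr fun t => ?_
    rcases le_or_gt t 0 with ht | ht
    · rw [halfPow_of_nonpos _ ht, zero_mul, zero_mul, zero_mul]
    rw [mul_assoc, ← lintegral_const_mul _ hgu]
    congr 1
    refine lintegral_congr fun u => ?_
    have hs : ∑ i, (√t • (u : H)) i ^ 2 = t := by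
      have h2 := EuclideanSpace.real_norm_sq_eq (√t • (u : H))
      rw [← h2, norm_smul, mul_pow, norm_eq_of_mem_sphere, Real.norm_of_nonneg (Real.sqrt_nonneg _),
        Real.sq_sqrt ht.le, one_pow, mul_one]
    rw [hs]
    congr 2
    ext1 i
    have h3 := (Real.sqrt_pos.2 ht).ne'
    change √(N : ℝ) * (√t)⁻¹ * (√t * (u : H) i) = √(N : ℝ) * (u : H) i
    field_simp
  have hI1 : I = ω⁻¹ := by
    have h1 := key (fun _ => 1) measurable_const
    rw [lintegral_one, lintegral_one, measure_univ, ← hω] at h1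
    exact ENNReal.eq_inv_of_mul_eq_one_left h1.symm
  refine Measure.ext_of_lintegral _ fun g hg => ?_
  rw [lintegral_map hg hproj, key g hg, hI1, kacUniform, lintegral_map hg (WithLp.measurable_ofLp 2 _),
    sphereUniform, lintegral_smul_measure, lintegral_map (f := fun y : H => g (WithLp.ofLp y))
      (g := fun u : Metric.sphere (0 : H) 1 => √(N : ℝ) • (u : H))
      (hg.comp (WithLp.measurable_ofLp 2 _)) (measurable_subtype_coe.const_smul √(N : ℝ))]
  rfl

theorem isProbabilityMeasure_kacUniform {N : ℕ} (hN : 1 ≤ N) :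
    IsProbabilityMeasure (kacUniform N) := by
  rw [← map_stdGaussian_eq_kacUniform hN]
  exact Measure.isProbabilityMeasure_map (by fun_prop)

theorem ae_kacUniform (N : ℕ) : ∀ᵐ x ∂kacUniform N, ∑ i, x i ^ 2 = (N : ℝ) := by
  have hS : MeasurableSet {x : Fin N → ℝ | ∑ i, x i ^ 2 = (N : ℝ)} :=
    measurableSet_eq_fun (by fun_prop) measurable_const
  rw [kacUniform, ae_map_iff (WithLp.measurable_ofLp 2 _).aemeasurable hS, sphereUniform]
  refine Measure.ae_smul_measure ?_ _
  refine (ae_map_iff (f := fun u : Metric.sphere (0 : EuclideanSpace ℝ (Fin N)) 1 =>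
    √(N : ℝ) • (u : EuclideanSpace ℝ (Fin N)))
    (measurable_subtype_coe.const_smul √(N : ℝ)).aemeasurable (WithLp.measurable_ofLp 2 _ hS)).2
    (ae_of_all _ fun u => ?_)
  have h2 := EuclideanSpace.real_norm_sq_eq (√(N : ℝ) • (u : EuclideanSpace ℝ (Fin N)))
  rw [norm_smul, mul_pow, norm_eq_of_mem_sphere, Real.norm_of_nonneg (Real.sqrt_nonneg _),
    Real.sq_sqrt (by positivity), one_pow, mul_one] at h2
  exact h2.symm

/-- The Gaussian product density is constant on Kac's sphere. -/
theorem condMass_kacUniform_gaussianPDF {N : ℕ} (hN : 1 ≤ N) :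
    condMass (kacUniform N) (gaussianPDF 0 1) = gaussianProfile N N := by
  have := isProbabilityMeasure_kacUniform hN
  have h : ∀ᵐ x ∂kacUniform N, ∏ i, gaussianPDF 0 1 (x i) = gaussianProfile N N := by
    filter_upwards [ae_kacUniform N] with x hx
    rw [prod_gaussianPDF, hx]
  rw [condMass, lintegral_congr_ae h, lintegral_const, measure_univ, mul_one]

theorem gaussianProfile_ne_zero (N : ℕ) (t : ℝ) : gaussianProfile N t ≠ 0 := by
  have : 0 < (√(2 * Real.pi))⁻¹ ^ N * Real.exp (-t / 2) := by positivity
  simpa [gaussianProfile] using this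

/-- The Gaussian product density only depends on the energy, so conditioning it does not change the
uniform measure. The estimate for `kacUniform` becomes an instance of the one for conditioned
products. -/
theorem conditioned_kacUniform_gaussianPDF {N : ℕ} (hN : 1 ≤ N) :
    conditioned (kacUniform N) (gaussianPDF 0 1) = kacUniform N := by
  have h : ∀ᵐ x ∂kacUniform N, ∏ i, gaussianPDF 0 1 (x i) = gaussianProfile N N := by
    filter_upwards [ae_kacUniform N] with x hx
    rw [prod_gaussianPDF, hx]
  rw [conditioned, condMass_kacUniform_gaussianPDF hN, withDensity_congr_ae h, withDensity_const,
    smul_smul, ENNReal.inv_mul_cancel (gaussianProfile_ne_zero N N) ENNReal.ofReal_ne_top, one_smul]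

theorem lintegral_enorm_rpow_stdGaussian_lt_top {k : ℝ} (hk : 0 < k) :
    moment k stdGaussian < ∞ := by
  have h := (memLp_id_gaussianReal' (μ := 0) (v := 1) (ENNReal.ofReal k) ENNReal.ofReal_ne_top)
  have h2 := lintegral_rpow_enorm_lt_top_of_eLpNorm_lt_top (by simpa using hk)
    ENNReal.ofReal_ne_top h.2
  rw [ENNReal.toReal_ofReal hk.le] at h2
  exact h2

theorem lintegral_enorm_sq_stdGaussian :
    ∫⁻ v, ‖v‖ₑ ^ 2 ∂(stdGaussian : Measure ℝ) = 1 := by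
  have h := variance_id_gaussianReal (μ := 0) (v := 1)
  have hm : MemLp id 2 (gaussianReal 0 1) := memLp_id_gaussianReal 2
  rw [variance_of_integral_eq_zero measurable_id.aemeasurable (by simp)] at h
  have h3 : Integrable (fun x : ℝ => x ^ 2) (gaussianReal 0 1) := hm.integrable_sq
  have h4 := ofReal_integral_eq_lintegral_ofReal h3 (ae_of_all _ fun x => sq_nonneg x)
  have h5 : ∫ x : ℝ, x ^ 2 ∂(gaussianReal 0 1) = 1 := by simpa using h
  rw [h5, ENNReal.ofReal_one] at h4
  refine Eq.trans (lintegral_congr fun v => ?_) h4.symm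
  rw [← ofReal_norm, ← ENNReal.ofReal_pow (norm_nonneg _), Real.norm_eq_abs, sq_abs]

theorem lintegral_gaussianPDF_sq_lt_top : ∫⁻ v, gaussianPDF 0 1 v ^ (2 : ℝ) < ∞ := by
  have hb : ∀ v, gaussianPDF 0 1 v ≤ 1 := by
    intro v
    rw [gaussianPDF, ENNReal.ofReal_le_one, gaussianPDFReal]
    refine mul_le_one₀ (inv_le_one_of_one_le₀ ?_) (Real.exp_pos _).le (Real.exp_le_one_iff.2 ?_)
    · rw [Real.one_le_sqrt]
      have := Real.pi_gt_three
      norm_num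
      linarith
    · rw [neg_div]
      have : 0 ≤ (v - 0) ^ 2 / (2 * ((1 : ℝ≥0) : ℝ)) := by positivity
      linarith
  calc ∫⁻ v, gaussianPDF 0 1 v ^ (2 : ℝ) ≤ ∫⁻ v, gaussianPDF 0 1 v := by
        refine lintegral_mono fun v => ?_
        calc gaussianPDF 0 1 v ^ (2 : ℝ) ≤ gaussianPDF 0 1 v ^ (1 : ℝ) :=
              ENNReal.rpow_le_rpow_of_exponent_ge (hb v) one_le_two
          _ = _ := ENNReal.rpow_one _
    _ = 1 := lintegral_gaussianPDF_eq_one 0 one_ne_zero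
    _ < ∞ := by simp

/-- Concentration of the norm of a Gaussian vector. -/
theorem exists_integral_abs_one_sub_le : ∃ C : ℝ, ∀ N : ℕ, 1 ≤ N →
    ∫⁻ x : Fin N → ℝ, ENNReal.ofReal |1 - (∑ i, x i ^ 2) / N| ∂(tensorPower stdGaussian N) ≤
      ENNReal.ofReal (C / (N : ℝ) ^ (1 / 2 : ℝ)) := by
  -- With `Y = ∑ (x_i² - 1)` one has `E Y² = N v` and `|Y|/N ≤ (Y²/N + 1)/(2√N)`, whence the
  -- constant `(v + 1)/2`.
  set v := Var[fun x : ℝ => x ^ 2 - 1; gaussianReal 0 1] with hv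
  refine ⟨(v + 1) / 2, fun N hN => ?_⟩
  have hN0 : (0 : ℝ) < N := by exact_mod_cast hN
  have hmem : MemLp (fun x : ℝ => x ^ 2 - 1) 2 (gaussianReal 0 1) := by
    have h4 : MemLp (fun x : ℝ => x ^ 2) 2 (gaussianReal 0 1) := by
      rw [memLp_two_iff_integrable_sq (by fun_prop)]
      have h5 : Integrable (fun x : ℝ => ‖x‖ ^ 4) (gaussianReal 0 1) :=
        (memLp_id_gaussianReal (μ := 0) (v := 1) 4).integrable_norm_pow (by norm_num)
      refine h5.congr (ae_of_all _ fun x => ?_)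
      simp only [Real.norm_eq_abs]
      rw [show 4 = 2 * 2 by norm_num, pow_mul, sq_abs]
    exact h4.sub (memLp_const 1)
  have hmean : ∫ x : ℝ, (x ^ 2 - 1) ∂(gaussianReal 0 1) = 0 := by
    have h := variance_id_gaussianReal (μ := 0) (v := 1)
    rw [variance_of_integral_eq_zero measurable_id.aemeasurable (by simp)] at h
    have h2 : Integrable (fun x : ℝ => x ^ 2) (gaussianReal 0 1) :=
      (memLp_id_gaussianReal 2).integrable_sq
    rw [integral_sub h2 (integrable_const 1)]
    have h5 : ∫ x : ℝ, x ^ 2 ∂(gaussianReal 0 1) = 1 := by simpa using h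
    simp [h5]
  set Y : (Fin N → ℝ) → ℝ := ∑ i : Fin N, fun x => x i ^ 2 - 1 with hY
  have hYx : ∀ x, Y x = ∑ i, x i ^ 2 - N := by
    intro x; simp [hY, Finset.sum_apply]
  have hvar := variance_sum_pi (μ := fun _ : Fin N => gaussianReal 0 1)
    (X := fun _ x => x ^ 2 - 1) fun _ => hmem
  have hcomp : ∀ i : Fin N, MemLp (fun x : Fin N → ℝ => x i ^ 2 - 1) 2
      (Measure.pi fun _ : Fin N => gaussianReal 0 1) := fun i =>
    hmem.comp_measurePreserving (measurePreserving_eval (fun _ : Fin N => gaussianReal 0 1) i)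
  have hYmem : MemLp Y 2 (Measure.pi fun _ : Fin N => gaussianReal 0 1) :=
    memLp_finsetSum' _ fun i _ => hcomp i
  have hYmean : ∫ x, Y x ∂(Measure.pi fun _ : Fin N => gaussianReal 0 1) = 0 := by
    simp only [hY, Finset.sum_apply]
    rw [integral_finsetSum _ fun i _ => (hcomp i).integrable one_le_two]
    refine Finset.sum_eq_zero fun i _ => ?_
    rw [integral_comp_eval (μ := fun _ : Fin N => gaussianReal 0 1)
      (f := fun x : ℝ => x ^ 2 - 1) (by fun_prop), hmean]
  rw [variance_of_integral_eq_zero hYmem.1.aemeasurable hYmean] at hvar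
  simp only [Finset.sum_const, Finset.card_univ, Fintype.card_fin, nsmul_eq_mul] at hvar
  have hint : Integrable (fun x => (Y x ^ 2 / N + 1) / (2 * √(N : ℝ)))
      (Measure.pi fun _ : Fin N => gaussianReal 0 1) :=
    ((hYmem.integrable_sq.div_const _).add (integrable_const 1)).div_const _
  have hs : 0 < √(N : ℝ) := Real.sqrt_pos.2 hN0
  have hs2 : √(N : ℝ) ^ 2 = N := Real.sq_sqrt hN0.le
  calc ∫⁻ x : Fin N → ℝ, ENNReal.ofReal |1 - (∑ i, x i ^ 2) / N| ∂(tensorPower stdGaussian N)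
      ≤ ∫⁻ x, ENNReal.ofReal ((Y x ^ 2 / N + 1) / (2 * √(N : ℝ)))
          ∂(Measure.pi fun _ : Fin N => gaussianReal 0 1) := by
        refine lintegral_mono fun x => ENNReal.ofReal_le_ofReal ?_
        have h1 : 1 - (∑ i, x i ^ 2) / (N : ℝ) = -Y x / N := by
          rw [hYx]; field_simp; ring
        rw [h1, abs_div, abs_neg, abs_of_pos hN0, ← sq_abs (Y x), div_add_one hN0.ne', div_div,
          div_le_div_iff₀ hN0 (by positivity)]
        have h2 : 2 * |Y x| * √(N : ℝ) ≤ |Y x| ^ 2 + √(N : ℝ) ^ 2 := two_mul_le_add_sq _ _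
        rw [hs2] at h2
        calc _ = 2 * |Y x| * √(N : ℝ) * N := by ring
          _ ≤ _ := mul_le_mul_of_nonneg_right h2 hN0.le
    _ = ENNReal.ofReal (∫ x, (Y x ^ 2 / N + 1) / (2 * √(N : ℝ))
          ∂(Measure.pi fun _ : Fin N => gaussianReal 0 1)) :=
        (ofReal_integral_eq_lintegral_ofReal hint (ae_of_all _ fun x => by positivity)).symm
    _ = _ := by
        congr 1
        rw [integral_div, integral_add (hYmem.integrable_sq.div_const _) (integrable_const 1),
          integral_div, hvar, ← Real.sqrt_eq_rpow]
        simp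
        field_simp
        rfl

/-- The uniform measure on Kac's sphere is close to the Gaussian tensor power. -/
theorem exists_W1prod_kacUniform_le : ∃ C : ℝ, ∀ N : ℕ, 1 ≤ N →
    W1prod (kacUniform N) (tensorPower stdGaussian N) ≤
      ENNReal.ofReal (C / (N : ℝ) ^ (1 / 2 : ℝ)) := by
  obtain ⟨C, hC⟩ := exists_integral_abs_one_sub_le
  refine ⟨C, fun N hN => le_trans ?_ (hC N hN)⟩
  have hN0 : (0 : ℝ) < N := by exact_mod_cast hN
  have hproj : Measurable fun (x : Fin N → ℝ) i => √(N : ℝ) * (√(∑ j, x j ^ 2))⁻¹ * x i := by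
    fun_prop
  have hpair : Measurable fun x : Fin N → ℝ =>
    ((fun i => √(N : ℝ) * (√(∑ j, x j ^ 2))⁻¹ * x i : Fin N → ℝ), x) := hproj.prodMk measurable_id
  -- A Gaussian vector of norm `r` is coupled with its radial projection. Cauchy-Schwarz bounds the
  -- cost by `|1 - r/√N|`, which is at most `|1 - r²/N|`.
  refine (mkw_le _ ((tensorPower stdGaussian N).map
    fun x => (fun i => √(N : ℝ) * (√(∑ j, x j ^ 2))⁻¹ * x i, x)) ?_ ?_).trans ?_
  · rw [Measure.fst, Measure.map_map measurable_fst hpair]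
    exact map_stdGaussian_eq_kacUniform hN
  · rw [Measure.snd, Measure.map_map measurable_snd hpair]
    exact Measure.map_id
  refine (lintegral_map_le _ _).trans (lintegral_mono fun x => ?_)
  have hs : 0 < √(N : ℝ) := Real.sqrt_pos.2 hN0
  have hs2 : √(N : ℝ) ^ 2 = N := Real.sq_sqrt hN0.le
  set r := √(∑ j, x j ^ 2) with hr
  set s := √(N : ℝ)
  have hr0 : 0 ≤ r := Real.sqrt_nonneg _
  have hr2 : r ^ 2 = ∑ j, x j ^ 2 := Real.sq_sqrt (Finset.sum_nonneg fun i _ => sq_nonneg _)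
  have hcs : ∑ i, |x i| ≤ s * r := by
    refine abs_le_of_sq_le_sq' ?_ (by positivity) |>.2
    rw [mul_pow, hs2, hr2]
    simpa using sq_sum_le_card_mul_sum_sq (s := Finset.univ) (f := fun i => |x i|)
  have hedist : ∀ i, edist (s * r⁻¹ * x i) (x i) = ENNReal.ofReal (|s * r⁻¹ - 1| * |x i|) := by
    intro i
    rw [edist_dist, Real.dist_eq, ← abs_mul, sub_mul, one_mul]
  calc (N : ℝ≥0∞)⁻¹ * ∑ i, min (edist (s * r⁻¹ * x i) (x i)) 1
      ≤ (N : ℝ≥0∞)⁻¹ * ∑ i, ENNReal.ofReal (|s * r⁻¹ - 1| * |x i|) := by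
        gcongr with i
        exact (min_le_left _ _).trans (hedist i).le
    _ = ENNReal.ofReal ((N : ℝ)⁻¹ * (|s * r⁻¹ - 1| * ∑ i, |x i|)) := by
        rw [← ENNReal.ofReal_sum_of_nonneg fun i _ => by positivity, ← Finset.mul_sum,
          ENNReal.ofReal_mul (p := (N : ℝ)⁻¹) (by positivity), ENNReal.ofReal_inv_of_pos hN0,
          ENNReal.ofReal_natCast]
    _ ≤ _ := by
        refine ENNReal.ofReal_le_ofReal ?_
        rw [← hr2, ← hs2]
        have h1 : (s ^ 2)⁻¹ * (|s * r⁻¹ - 1| * ∑ i, |x i|) ≤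
            (s ^ 2)⁻¹ * (|s * r⁻¹ - 1| * (s * r)) := by gcongr
        refine h1.trans ?_
        rcases hr0.eq_or_lt with h0 | h0
        · rw [← h0]; simp
        have h2 : (s ^ 2)⁻¹ * (|s * r⁻¹ - 1| * (s * r)) = |1 - r / s| := by
          rw [← abs_of_pos (mul_pos hs h0), ← abs_mul, ← abs_of_pos (inv_pos.2 (sq_pos_of_pos hs)),
            ← abs_mul]
          congr 1
          field_simp
        have h3 : 1 - r ^ 2 / s ^ 2 = (1 - r / s) * (1 + r / s) := by field_simp; ring
        rw [h2, h3, abs_mul]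
        refine le_mul_of_one_le_right (abs_nonneg _) ?_
        have : 0 ≤ r / s := by positivity
        rw [abs_of_nonneg (by positivity)]
        linarith

/-- Rate of chaos for product densities conditioned to Kac's spheres. -/
theorem conditioned_kacUniform_rate {k : ℝ} (hk : 4 ≤ k) {f : ProbabilityMeasure ℝ}
    {ρ : ℝ → ℝ≥0∞} (hρ : Measurable ρ) (hf : (f : Measure ℝ) = volume.withDensity ρ)
    (hp : ∃ p : ℝ, 1 < p ∧ ∫⁻ v, ρ v ^ p < ∞) (hm : moment k f < ∞)
    (h2 : ∫⁻ v, ‖v‖ₑ ^ 2 ∂(f : Measure ℝ) = 1) :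
    (∀ᶠ N : ℕ in atTop, condMass (kacUniform N) ρ ≠ 0 ∧ condMass (kacUniform N) ρ ≠ ∞) ∧
    ∀ α : ℝ, α < 1 / (2 + 2 / k) → ∃ C : ℝ, ∀ (N : ℕ) [NeZero N],
      condMass (kacUniform N) ρ ≠ 0 → condMass (kacUniform N) ρ ≠ ∞ →
        OmegaInf (conditioned (kacUniform N) ρ) f = meanW1 (conditioned (kacUniform N) ρ) f ∧
          meanW1 (conditioned (kacUniform N) ρ) f ≤ ENNReal.ofReal (C / (N : ℝ) ^ α) := by
  have hk0 : 0 < k := by linarith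
  have h := conditioned_rate (π := (0 : ℝ →L[ℝ] EuclideanSpace ℝ (Fin 0)))
    (fun p => Subsingleton.elim _ _) (by simp) (by simp) realChart isMomentumSphere_kacUniform hk
    hρ hf hp hm h2 (Subsingleton.elim _ _)
  -- In dimension one the general threshold is `1/(2 + 1/k)`, above the one claimed.
  refine ⟨h.1, fun α hα => h.2 α (hα.trans_le ?_)⟩
  rw [Nat.cast_one, max_eq_right one_le_two]
  gcongr
  norm_num

end GaussianSphere

end KacChaos

/-! ### The theorem -/

theorem mainTheorem7 :
    -- (i) independent samples
    (∀ (d : ℕ) (_ : 1 ≤ d) (k : ℝ) (_ : 0 < k) (M : ℝ≥0) (α : ℝ)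
        (_ : α < 1 / (max (d : ℝ) 2 + d / k)),
      ∃ C : ℝ, ∀ f : ProbabilityMeasure (EuclideanSpace ℝ (Fin d)), KacChaos.moment k f ≤ M →
        ∀ (N : ℕ) [NeZero N],
          KacChaos.OmegaInf (KacChaos.tensorPower f N) f
              = KacChaos.meanW1 (KacChaos.tensorPower f N) f ∧
            KacChaos.meanW1 (KacChaos.tensorPower f N) f
              ≤ ENNReal.ofReal (C / (N : ℝ) ^ α)) ∧
    -- (ii) the uniform measure on Kac's sphere against the Gaussian
    (∀ (α : ℝ) (_ : α < 1 / 2), ∃ C : ℝ, ∀ (N : ℕ) [NeZero N],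
      KacChaos.OmegaInf (KacChaos.kacUniform N) KacChaos.stdGaussian
          = KacChaos.meanW1 (KacChaos.kacUniform N) KacChaos.stdGaussian ∧
        KacChaos.meanW1 (KacChaos.kacUniform N) KacChaos.stdGaussian
          ≤ ENNReal.ofReal (C / (N : ℝ) ^ α)) ∧
    (∃ C : ℝ, ∀ (N : ℕ), 1 ≤ N →
      KacChaos.W1prod (KacChaos.kacUniform N) (KacChaos.tensorPower KacChaos.stdGaussian N)
        ≤ ENNReal.ofReal (C / (N : ℝ) ^ (1 / 2 : ℝ))) ∧
    -- (iii) product measures conditioned to Kac's spheres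
    (∀ (k : ℝ) (_ : 4 ≤ k) (f : ProbabilityMeasure ℝ) (ρ : ℝ → ℝ≥0∞) (_ : Measurable ρ)
        (_ : (f : Measure ℝ) = volume.withDensity ρ)
        (_ : ∃ p : ℝ, 1 < p ∧ ∫⁻ v, ρ v ^ p < ∞)
        (_ : KacChaos.moment k f < ∞)
        (_ : ∫⁻ v, ‖v‖ₑ ^ 2 ∂(f : Measure ℝ) = 1),
      (∀ᶠ N : ℕ in atTop, KacChaos.condMass (KacChaos.kacUniform N) ρ ≠ 0 ∧
        KacChaos.condMass (KacChaos.kacUniform N) ρ ≠ ∞) ∧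
      ∀ (α : ℝ) (_ : α < 1 / (2 + 2 / k)), ∃ C : ℝ, ∀ (N : ℕ) [NeZero N],
        KacChaos.condMass (KacChaos.kacUniform N) ρ ≠ 0 →
        KacChaos.condMass (KacChaos.kacUniform N) ρ ≠ ∞ →
          KacChaos.OmegaInf (KacChaos.conditioned (KacChaos.kacUniform N) ρ) f
              = KacChaos.meanW1 (KacChaos.conditioned (KacChaos.kacUniform N) ρ) f ∧
            KacChaos.meanW1 (KacChaos.conditioned (KacChaos.kacUniform N) ρ) f
              ≤ ENNReal.ofReal (C / (N : ℝ) ^ α)) ∧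
    -- (iii) product measures conditioned to Boltzmann's spheres
    (∀ (k : ℝ) (_ : 4 ≤ k) (f : ProbabilityMeasure (EuclideanSpace ℝ (Fin 3)))
        (ρ : EuclideanSpace ℝ (Fin 3) → ℝ≥0∞) (_ : Measurable ρ)
        (_ : (f : Measure (EuclideanSpace ℝ (Fin 3))) = volume.withDensity ρ)
        (_ : ∃ p : ℝ, 1 < p ∧ ∫⁻ v, ρ v ^ p < ∞)
        (_ : KacChaos.moment k f < ∞)
        (_ : ∫ v, v ∂(f : Measure (EuclideanSpace ℝ (Fin 3))) = 0)
        (_ : ∫⁻ v, ‖v‖ₑ ^ 2 ∂(f : Measure (EuclideanSpace ℝ (Fin 3))) = 1),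
      (∀ᶠ N : ℕ in atTop, KacChaos.condMass (KacChaos.boltzmannUniform N) ρ ≠ 0 ∧
        KacChaos.condMass (KacChaos.boltzmannUniform N) ρ ≠ ∞) ∧
      ∀ (α : ℝ) (_ : α < 1 / (3 + 3 / k)), ∃ C : ℝ, ∀ (N : ℕ) [NeZero N],
        KacChaos.condMass (KacChaos.boltzmannUniform N) ρ ≠ 0 →
        KacChaos.condMass (KacChaos.boltzmannUniform N) ρ ≠ ∞ →
          KacChaos.OmegaInf (KacChaos.conditioned (KacChaos.boltzmannUniform N) ρ) f
              = KacChaos.meanW1 (KacChaos.conditioned (KacChaos.boltzmannUniform N) ρ) f ∧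
            KacChaos.meanW1 (KacChaos.conditioned (KacChaos.boltzmannUniform N) ρ) f
              ≤ ENNReal.ofReal (C / (N : ℝ) ^ α)) := by
  refine ⟨fun d _ k hk M α hα => ?_, fun α hα => ?_, KacChaos.exists_W1prod_kacUniform_le,
    fun k hk f ρ hρ hf hp hm h2 => ?_, fun k hk f ρ hρ hf hp hm hmean h2 => ?_⟩
  · obtain ⟨C, -, hC⟩ :=
      KacChaos.exists_meanW1_tensorPower_le (KacChaos.euclideanChart d) hk M hα
    exact ⟨C, fun f hf N _ => ⟨KacChaos.OmegaInf_eq_meanW1 (KacChaos.euclideanChart d) _ f,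
      hC f hf N⟩⟩
  -- The Gaussian has moments of every order and `1/(2 + 2/k)` tends to `1/2`, so a suitable `k`
  -- exists for each `α < 1/2`.
  · obtain ⟨k, hk, hαk⟩ : ∃ k : ℝ, 4 ≤ k ∧ α < 1 / (2 + 2 / k) := by
      have hlim : Tendsto (fun k : ℝ => 1 / (2 + 2 / k)) atTop (nhds (1 / (2 + 0))) :=
        tendsto_const_nhds.div (tendsto_const_nhds.add (tendsto_const_nhds.div_atTop tendsto_id))
          (by norm_num)
      rw [add_zero] at hlim
      exact ((eventually_ge_atTop 4).and (hlim.eventually (lt_mem_nhds hα))).exists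
    obtain ⟨C, hC⟩ := (KacChaos.conditioned_kacUniform_rate hk
      (measurable_gaussianPDF 0 1) KacChaos.stdGaussian_eq_withDensity
      ⟨2, one_lt_two, KacChaos.lintegral_gaussianPDF_sq_lt_top⟩
      (KacChaos.lintegral_enorm_rpow_stdGaussian_lt_top (by linarith))
      KacChaos.lintegral_enorm_sq_stdGaussian).2 α hαk
    refine ⟨C, fun N _ => ?_⟩
    have hN : 1 ≤ N := NeZero.one_le
    have h := hC N
    rw [KacChaos.condMass_kacUniform_gaussianPDF hN,
      KacChaos.conditioned_kacUniform_gaussianPDF hN] at h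
    exact h (KacChaos.gaussianProfile_ne_zero N N) ENNReal.ofReal_ne_top
  · exact KacChaos.conditioned_kacUniform_rate hk hρ hf hp hm h2
  · have h := KacChaos.conditioned_rate
      (π := ContinuousLinearMap.id ℝ (EuclideanSpace ℝ (Fin 3)))
      (fun p => by rw [ContinuousLinearMap.adjoint_id]; rfl) (by simp) (by simp)
      (KacChaos.euclideanChart 3) KacChaos.isMomentumSphere_boltzmannUniform hk hρ hf hp hm h2
      (by simpa using hmean)
    refine ⟨h.1, fun α hα => h.2 α ?_⟩
    norm_num
    simpa using hα
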